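/- \textbf{Theorem (a posteriori error).} Let $T>0$, let $\Omega_x=(x_L,x_R)$ be a bounded open interval, and let $\tilde Q_T=(0,T)\times\Omega_x$. Consider the one and one-half dimensional Maxwell system for $W=(E_1,E_2,B)^T$, $$M_1W_t+M_2W_x=b,\qquad W(0,\cdot)=W^0,\qquad M_1=\begin{pmatrix}0&0&0\\1&0&0\\0&1&0\\0&0&1\end{pmatrix},\quad M_2=\begin{pmatrix}1&0&0\\0&0&0\\0&0&1\\0&1&0\end{pmatrix}.$$ \emph{Mesh and finite element space.} Let $0=t_0<\dots<t_M=T$ and $x_L=x_0<\dots<x_N=x_R$ be partitions, $I_m=(t_{m-1},t_m]$, $S_m=I_m\times\Omega_x$, with elements $I_m\times\tau_j$, $\tau_j=(x_{j-1},x_j)$. Let $h=\max_{m,j}\operatorname{diam}(I_m\times\tau_j)$ and assume $|I_m|\ge\sigma h$ for all $m$, where $\sigma>0$. For an integer $k\ge1$ let $\tilde V_h$ be the space of functions $g=(g_1,g_2,g_3)$ which on each slab $S_m$ are continuous, whose components on each element are polynomials of degree at most $k$ in $t$ and at most $k$ in $x$, and which vanish for $x\in\partial\Omega_x$; they may jump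 at the times $t_m$. Write $g_\pm(t,x)=\lim_{s\to0^\pm}g(t+s,x)$ and $\hat g=(g_1,g_1,g_2,g_3)^T$. \emph{Streamline diffusion method.} Let $\delta=\kappa h$ with $\kappa>0$. For data $b\in L_2(\tilde Q_T)^4$ and $W^0\in L_2(\Omega_x)^3$, a streamline diffusion approximation is a function $W^h\in\tilde V_h$ such that, with $W^h_-(t_0,\cdot):=W^0$, for $m=1,\dots,M$ and all $g\in\tilde V_h$, $$\begin{aligned}&(M_1W^h_t+M_2W^h_x,\ \hat g+\delta(M_1g_t+M_2g_x))_{L_2(S_m)}+(W^h_+(t_{m-1}),g_+(t_{m-1}))_{L_2(\Omega_x)}\\&\qquad=(b,\ \hat g+\delta(M_1g_t+M_2g_x))_{L_2(S_m)}+(W^h_-(t_{m-1}),g_+(t_{m-1}))_{L_2(\Omega_x)}.\end{aligned}$$ \emph{Claim.} Let $K\subset\Omega_x$ be compact. There is a constant $C$, depending only on $T,\Omega_x,K,k,\sigma,\kappa$, such that the following holds for every mesh as above and all data $b,W^0$. In particular, it holds with the same $C$ for $b=b^{h,i-1}$, $W=W^i$, $W^h=W^{h,i}$ at every step $i$ of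 the Vlasov--Maxwell iteration. If $W\in L_2(\tilde Q_T)^3$ is a weak solution of $M_1W_t+M_2W_x=b$, $W(0,\cdot)=W^0$, with $W=0$ almost everywhere on $(0,T)\times(\Omega_x\setminus K)$, and $W^h$ is a streamline diffusion approximation for $b,W^0$, then the numerical error $\tilde e=W-W^h$ satisfies $$\|\tilde e\|_{H^{-1}(\tilde Q_T)}\le C\left(\|h\tilde R_1\|_{L_2(\tilde Q_T)}+\|h\tilde R_2\|_{L_2(\tilde Q_T)}\right).$$ Here $\tilde R_1=b-M_1W^h_t-M_2W^h_x$ (computed on each slab) is the interior residual, $\tilde R_2|_{S_m}=\big(W^h_+(t_{m-1},x)-W^h_-(t_{m-1},x)\big)/h$ is the time-jump residual, and $$\|u\|_{H^{-1}(\tilde Q_T)}=\sup_{0\ne\psi\in C_0^\infty(\tilde Q_T)^3}\frac{(u,\psi)_{L_2(\tilde Q_T)}}{\|\psi\|_{H^1(\tilde Q_T)}}.$$ Weak solution means that for all $\Phi\in C_0^\infty((-\infty,T)\times\Omega_x)^4$, $$\int_{\tilde Q_T}W\cdot(-M_1^T\Phi_t-M_2^T\Phi_x)\,dx\,dt=\int_{\tilde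 Q_T}b\cdot\Phi\,dx\,dt+\int_{\Omega_x}(M_1W^0)\cdot\Phi(0,x)\,dx.$$ -/

import Mathlib

open MeasureTheory
open scoped Matrix ENNReal NNReal ContDiff

/-!  The one and one-half dimensional Maxwell system.  Points of space-time are pairs
`z = (t, x) : ℝ × ℝ`; the unknown is `W = (E₁, E₂, B)`, with values in `Fin 3 → ℝ`. -/

/-- The matrix `M₁`, so that `M₁ W_t = (0, ∂ₜE₁, ∂ₜE₂, ∂ₜB)`. -/
def maxwellM₁ : Matrix (Fin 4) (Fin 3) ℝ :=
  !![0, 0, 0;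
     1, 0, 0;
     0, 1, 0;
     0, 0, 1]

/-- The matrix `M₂`, so that `M₂ W_x = (∂ₓE₁, 0, ∂ₓB, ∂ₓE₂)`. -/
def maxwellM₂ : Matrix (Fin 4) (Fin 3) ℝ :=
  !![1, 0, 0;
     0, 0, 0;
     0, 0, 1;
     0, 1, 0]

/-- Time derivative of a function of `(t, x)`. -/
noncomputable def timeDeriv {n : ℕ} (u : ℝ × ℝ → Fin n → ℝ) (z : ℝ × ℝ) : Fin n → ℝ :=
  deriv (fun s => u (s, z.2)) z.1

/-- Space derivative of a function of `(t, x)`. -/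
noncomputable def spaceDeriv {n : ℕ} (u : ℝ × ℝ → Fin n → ℝ) (z : ℝ × ℝ) : Fin n → ℝ :=
  deriv (fun y => u (z.1, y)) z.2

/-- The Maxwell operator `u ↦ M₁ u_t + M₂ u_x`. -/
noncomputable def maxwellOp (u : ℝ × ℝ → Fin 3 → ℝ) (z : ℝ × ℝ) : Fin 4 → ℝ :=
  maxwellM₁ *ᵥ timeDeriv u z + maxwellM₂ *ᵥ spaceDeriv u z

/-- `ĝ = (g₁, g₁, g₂, g₃)`. -/
def hatVec (v : Fin 3 → ℝ) : Fin 4 → ℝ := ![v 0, v 0, v 1, v 2]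

/-- The (open) space-time domain `(0, T) × (xL, xR)`. -/
def spaceTimeDomain (T xL xR : ℝ) : Set (ℝ × ℝ) := Set.Ioo 0 T ×ˢ Set.Ioo xL xR

/-- `W ∈ L₂` is a weak solution of the Cauchy problem `M₁ W_t + M₂ W_x = b`, `W(0, ·) = W₀` on
`[0, T] × (xL, xR)`.  The test functions may be nonzero at `t = 0`, which encodes the initial
condition. -/
def IsWeakMaxwellSolution (T xL xR : ℝ) (b : ℝ × ℝ → Fin 4 → ℝ) (W₀ : ℝ → Fin 3 → ℝ)
    (W : ℝ × ℝ → Fin 3 → ℝ) : Prop :=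
  MemLp W 2 (volume.restrict (spaceTimeDomain T xL xR)) ∧
  ∀ Φ : ℝ × ℝ → Fin 4 → ℝ, ContDiff ℝ ∞ Φ → HasCompactSupport Φ →
    tsupport Φ ⊆ Set.Iio T ×ˢ Set.Ioo xL xR →
    (∫ z in spaceTimeDomain T xL xR,
        W z ⬝ᵥ (-(maxwellM₁ᵀ *ᵥ timeDeriv Φ z) - maxwellM₂ᵀ *ᵥ spaceDeriv Φ z)) =
      (∫ z in spaceTimeDomain T xL xR, b z ⬝ᵥ Φ z) +
        ∫ y in Set.Ioo xL xR, (maxwellM₁ *ᵥ W₀ y) ⬝ᵥ Φ (0, y)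

/-! Norms. -/

/-- The `L₂(D)` norm of a vector-valued function (Euclidean norm of the values). -/
noncomputable def l2Norm {n : ℕ} (D : Set (ℝ × ℝ)) (u : ℝ × ℝ → Fin n → ℝ) : ℝ≥0∞ :=
  eLpNorm (fun z => WithLp.toLp 2 (u z)) 2 (volume.restrict D)

/-- The `H¹(D)` norm of a smooth vector-valued function. -/
noncomputable def h1Norm (D : Set (ℝ × ℝ)) (ψ : ℝ × ℝ → Fin 3 → ℝ) : ℝ :=
  Real.sqrt (∫ z in D, (ψ z ⬝ᵥ ψ z + timeDeriv ψ z ⬝ᵥ timeDeriv ψ z +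
    spaceDeriv ψ z ⬝ᵥ spaceDeriv ψ z))

/-- The `H⁻¹(D)` norm: the supremum of `(u, ψ) / ‖ψ‖_{H¹(D)}` over `ψ ∈ [C₀^∞(D)]³`. -/
noncomputable def hNegOneNorm (D : Set (ℝ × ℝ)) (u : ℝ × ℝ → Fin 3 → ℝ) : ℝ≥0∞ :=
  ⨆ (ψ : ℝ × ℝ → Fin 3 → ℝ)
    (_ : ContDiff ℝ ∞ ψ ∧ HasCompactSupport ψ ∧ tsupport ψ ⊆ D),
    ENNReal.ofReal ((∫ z in D, u z ⬝ᵥ ψ z) / h1Norm D ψ)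

/-! Meshes and finite element spaces. -/

/-- A subdivision of `[0, T] × [xL, xR]` into the rectangles `Iₘ × τⱼ`, given by partitions
`0 = t₀ < t₁ < … < t_M = T` and `xL = x₀ < x₁ < … < x_N = xR`.  The slabs are numbered
`0, …, M - 1`: slab `m` lies over the time interval `(tₘ, tₘ₊₁]`. -/
structure SpaceTimeMesh (T xL xR : ℝ) where
  M : ℕ
  N : ℕ
  t : ℕ → ℝ
  x : ℕ → ℝ
  t_zero : t 0 = 0
  t_last : t M = T
  t_lt : ∀ m < M, t m < t (m + 1)
  x_zero : x 0 = xL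
  x_last : x N = xR
  x_lt : ∀ j < N, x j < x (j + 1)

namespace SpaceTimeMesh

variable {T xL xR : ℝ} (𝒯 : SpaceTimeMesh T xL xR)

/-- The mesh parameter `h`: the largest diameter of an element `Iₘ × τⱼ`. -/
noncomputable def h : ℝ :=
  ⨆ (m : Fin 𝒯.M) (j : Fin 𝒯.N),
    Real.sqrt ((𝒯.t (m + 1) - 𝒯.t m) ^ 2 + (𝒯.x (j + 1) - 𝒯.x j) ^ 2)

/-- All time steps are at least `σ h` (they are at most `h` by definition of `h`). -/
def TimeStepsComparable (σ : ℝ) : Prop :=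
  ∀ m < 𝒯.M, σ * 𝒯.h ≤ 𝒯.t (m + 1) - 𝒯.t m

/-- The slab `Iₘ × Ωₓ`. -/
def slab (m : ℕ) : Set (ℝ × ℝ) := Set.Ioc (𝒯.t m) (𝒯.t (m + 1)) ×ˢ Set.Ioo xL xR

/-- The function on `(0, T] × Ωₓ` which is `w m` on slab `m`. -/
noncomputable def glue {n : ℕ} (w : ℕ → ℝ × ℝ → Fin n → ℝ) (z : ℝ × ℝ) : Fin n → ℝ :=
  ∑ m ∈ Finset.range 𝒯.M, (𝒯.slab m).indicator (w m) z

/-- The finite element space: families `g 0, …, g (M - 1)` of functions on the closed slabs (no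
relation between different slabs) which are polynomials of degree at most `k` in `t` and at most
`k` in `x` on every closed element, hence continuous and in `H¹` on each slab, and which vanish on
the lateral boundary `∂Ωₓ = {xL, xR}`.  The values of `g m` off the closed slab, and of `g m` for
`m ≥ M`, are irrelevant. -/
def IsFiniteElement (k : ℕ) (g : ℕ → ℝ × ℝ → Fin 3 → ℝ) : Prop :=
  ∀ m < 𝒯.M,
    (∀ j < 𝒯.N, ∀ i : Fin 3, ∃ c : Fin (k + 1) → Fin (k + 1) → ℝ,
      ∀ z ∈ Set.Icc (𝒯.t m) (𝒯.t (m + 1)) ×ˢ Set.Icc (𝒯.x j) (𝒯.x (j + 1)),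
        g m z i = ∑ p, ∑ q, c p q * z.1 ^ (p : ℕ) * z.2 ^ (q : ℕ)) ∧
    ∀ s ∈ Set.Icc (𝒯.t m) (𝒯.t (m + 1)), g m (s, xL) = 0 ∧ g m (s, xR) = 0

/-- `w₊(tₘ, ·)`, the limit from above at the initial time of slab `m`. -/
def traceAbove (w : ℕ → ℝ × ℝ → Fin 3 → ℝ) (m : ℕ) (y : ℝ) : Fin 3 → ℝ := w m (𝒯.t m, y)

/-- `w₋(tₘ, ·)`, the limit from below at the initial time of slab `m`; at `t₀ = 0` it is the
initial value `W₀`. -/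
def traceBelow (W₀ : ℝ → Fin 3 → ℝ) (w : ℕ → ℝ × ℝ → Fin 3 → ℝ) : ℕ → ℝ → Fin 3 → ℝ
  | 0, y => W₀ y
  | m + 1, y => w m (𝒯.t (m + 1), y)

/-- `Wh` is a streamline diffusion approximation with data `b`, initial value `W₀`,
parameter `δ` and polynomial degree `k`. -/
def IsStreamlineDiffusionSolution (k : ℕ) (δ : ℝ) (b : ℝ × ℝ → Fin 4 → ℝ)
    (W₀ : ℝ → Fin 3 → ℝ) (Wh : ℕ → ℝ × ℝ → Fin 3 → ℝ) : Prop :=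
  𝒯.IsFiniteElement k Wh ∧
  ∀ m < 𝒯.M, ∀ g : ℕ → ℝ × ℝ → Fin 3 → ℝ, 𝒯.IsFiniteElement k g →
    (∫ z in 𝒯.slab m, maxwellOp (Wh m) z ⬝ᵥ (hatVec (g m z) + δ • maxwellOp (g m) z)) +
        (∫ y in Set.Ioo xL xR, 𝒯.traceAbove Wh m y ⬝ᵥ 𝒯.traceAbove g m y) =
      (∫ z in 𝒯.slab m, b z ⬝ᵥ (hatVec (g m z) + δ • maxwellOp (g m) z)) +
        ∫ y in Set.Ioo xL xR, 𝒯.traceBelow W₀ Wh m y ⬝ᵥ 𝒯.traceAbove g m y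

/-- The interior residual `R₁ = b - M₁ Wh_t - M₂ Wh_x`, computed slab by slab. -/
noncomputable def residual₁ (b : ℝ × ℝ → Fin 4 → ℝ) (Wh : ℕ → ℝ × ℝ → Fin 3 → ℝ) :
    ℝ × ℝ → Fin 4 → ℝ :=
  𝒯.glue fun m z => b z - maxwellOp (Wh m) z

/-- The time-jump residual: on each slab it is constant in time and equal to the jump of `Wh` at
the initial time of the slab, divided by `h`. -/
noncomputable def residual₂ (W₀ : ℝ → Fin 3 → ℝ) (Wh : ℕ → ℝ × ℝ → Fin 3 → ℝ) :
    ℝ × ℝ → Fin 3 → ℝ :=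
  𝒯.glue fun m z => (𝒯.h)⁻¹ • (𝒯.traceAbove Wh m z.2 - 𝒯.traceBelow W₀ Wh m z.2)

end SpaceTimeMesh

/-! The proof is a duality argument, complicated by the lateral boundary. Pairing with `ĝ` adds the
equations for `∂ₓE₁` and `∂ₜE₁`, so `E₁` behaves like a quantity of speed `1`, while `E₂ + B` and
`E₂ - B` travel with speeds `1` and `-1`. On the range of the projection `P_s = chProj s` the
pairing with `ĝ` is therefore the scalar transport operator `∂ₜ + s ∂ₓ`, and the two families `s =
±1` can be treated separately.

Error representation. Given a test function `ψ`, let `φ_s` solve `∂ₜφ + s ∂ₓφ = -P_s ψ` with zero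
final data in free space. It is an integral along characteristics, and it and its first derivatives
are bounded in `L₂` by `‖ψ‖_{H¹}` (`exists_isDualField`). A weak solution that vanishes off `K` has
data that vanish off `K`, so `φ_s` can be cut off near the boundary and used as a test function at
no cost. The discrete solution vanishes on the lateral boundary, so integrating it by parts leaves
no lateral terms. Hence `(W - W^h, ψ)` is the sum over `s` of the residuals of `W^h` paired with
`φ_s` (`error_eq`).

The difficulty. Galerkin orthogonality allows a discrete interpolant to be subtracted from `φ_s`,
which gains the factor `h`. But discrete functions vanish at both ends of `Ωₓ`, whereas `φ_s` is
only known to vanish at the end towards which its characteristics run. Split `φ_s = χ φ_s + (1 - χ)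
φ_s`, with `χ` zero at the other end and one away from it. The first part can be interpolated
(`errorFunctional_le_of_lateral`). The second lives in a boundary layer where there are no data, and
there the missing power of `h` is found in the residuals themselves.

The layer. Test the method with `P_s W^h`, switched off linearly across a single cell. Nothing
enters through the boundary, since `W^h = 0` there, so the energy identity bounds the squared
residuals upstream of the cell by `C h / dx` times those in the cell (`dx_mul_sum_localEnergy_le`).
For the cumulative energy this is a discrete differential inequality. Crossing a strip of width of
order `ε` gains one factor `h`. Two strips gain `h²` in the energy, that is `h` in the norm
(`exists_left_layer`, `exists_right_layer`, `errorFunctional_le_of_layer`). The argument needs `h`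
small compared with the distance from `K` to the boundary; on coarser meshes `h` is bounded below
and nothing has to be gained.

All bounds are kept in the form `μ E + μ⁻¹ B`, which adds up over elements, and `μ` is optimised
only at the end. -/

/-! Algebra of the Maxwell matrices: the projections onto the right (`s = 1`) and left (`s = -1`)
going characteristic variables. -/

/-- The orthogonal projection onto the characteristic variables which travel with speed `s`,
for `s = 1` or `s = -1`. -/
noncomputable def chProj (s : ℝ) (v : Fin 3 → ℝ) : Fin 3 → ℝ :=
  ![(1 + s) / 2 * v 0, (v 1 + s * v 2) / 2, (v 2 + s * v 1) / 2]

theorem chProj_add_chProj (v : Fin 3 → ℝ) : chProj 1 v + chProj (-1) v = v := by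
  ext i; fin_cases i <;> simp [chProj] <;> ring

theorem chProj_zero (s : ℝ) : chProj s 0 = 0 := by
  ext i; fin_cases i <;> simp [chProj]

theorem chProj_sub (s : ℝ) (v w : Fin 3 → ℝ) : chProj s (v - w) = chProj s v - chProj s w := by
  ext i; fin_cases i <;> simp [chProj] <;> ring

theorem chProj_smul (s c : ℝ) (v : Fin 3 → ℝ) : chProj s (c • v) = c • chProj s v := by
  ext i; fin_cases i <;> simp [chProj] <;> ring

theorem chProj_idem {s : ℝ} (hs : s = 1 ∨ s = -1) (v : Fin 3 → ℝ) :
    chProj s (chProj s v) = chProj s v := by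
  rcases hs with rfl | rfl <;> ext i <;> fin_cases i <;> simp [chProj] <;> ring

theorem dotProduct_chProj {s : ℝ} (hs : s = 1 ∨ s = -1) (w v : Fin 3 → ℝ) :
    w ⬝ᵥ chProj s v = chProj s w ⬝ᵥ chProj s v := by
  rcases hs with rfl | rfl <;> simp [chProj, dotProduct, Fin.sum_univ_succ] <;> ring

theorem chProj_dotProduct_self_le {s : ℝ} (hs : s = 1 ∨ s = -1) (v : Fin 3 → ℝ) :
    chProj s v ⬝ᵥ chProj s v ≤ v ⬝ᵥ v := by
  rcases hs with rfl | rfl <;> simp [chProj, dotProduct, Fin.sum_univ_succ] <;>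
    nlinarith [sq_nonneg (v 1 + v 2), sq_nonneg (v 1 - v 2), sq_nonneg (v 0)]

/-- The row `M₁ a + M₂ c` of the Maxwell operator for given values of the derivatives. -/
noncomputable def maxwellRow (a c : Fin 3 → ℝ) : Fin 4 → ℝ := maxwellM₁ *ᵥ a + maxwellM₂ *ᵥ c

theorem maxwellRow_eq (a c : Fin 3 → ℝ) :
    maxwellRow a c = ![c 0, a 0, a 1 + c 2, a 2 + c 1] := by
  ext i
  fin_cases i <;>
    simp [maxwellRow, maxwellM₁, maxwellM₂, dotProduct, Fin.sum_univ_succ]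

theorem maxwellOp_eq (u : ℝ × ℝ → Fin 3 → ℝ) (z : ℝ × ℝ) :
    maxwellOp u z = maxwellRow (timeDeriv u z) (spaceDeriv u z) := rfl

/-- The reason for the doubled entry in `ĝ`: it adds the rows `∂ₓE₁` and `∂ₜE₁` into a transport of
speed `1`. For `s = -1` the first component of `v` is zero, so `E₁` drops out. -/
theorem maxwellRow_dotProduct_hatVec {s : ℝ} (hs : s = 1 ∨ s = -1) (a c v : Fin 3 → ℝ)
    (hv : chProj s v = v) : maxwellRow a c ⬝ᵥ hatVec v = a ⬝ᵥ v + s * (c ⬝ᵥ v) := by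
  rw [← hv, maxwellRow_eq]
  rcases hs with rfl | rfl <;> simp [chProj, hatVec, dotProduct, Fin.sum_univ_succ] <;> ring

/-- The Maxwell operator sends the ranges of the two projections into orthogonal subspaces of `ℝ⁴`,
so a test function of speed `s` sees only the part of speed `s`. -/
theorem maxwellRow_dotProduct_chProj {s : ℝ} (hs : s = 1 ∨ s = -1) (a c a' c' : Fin 3 → ℝ)
    (ha' : chProj s a' = a') (hc' : chProj s c' = c') :
    maxwellRow a c ⬝ᵥ maxwellRow a' c' =
      maxwellRow (chProj s a) (chProj s c) ⬝ᵥ maxwellRow a' c' := by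
  rw [← ha', ← hc']
  simp only [maxwellRow_eq]
  rcases hs with rfl | rfl <;> simp [chProj, dotProduct, Fin.sum_univ_succ] <;> ring

theorem maxwellRow_dotProduct_hatVec_chProj {s : ℝ} (hs : s = 1 ∨ s = -1) (a c v : Fin 3 → ℝ)
    (hv : chProj s v = v) :
    maxwellRow a c ⬝ᵥ hatVec v = maxwellRow (chProj s a) (chProj s c) ⬝ᵥ hatVec v := by
  rw [maxwellRow_dotProduct_hatVec hs _ _ _ hv, maxwellRow_dotProduct_hatVec hs _ _ _ hv]
  rw [← hv, ← dotProduct_chProj hs, ← dotProduct_chProj hs]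

/-- Pythagoras for the same orthogonal splitting. -/
theorem maxwellRow_chProj_le {s : ℝ} (hs : s = 1 ∨ s = -1) (a c : Fin 3 → ℝ) :
    maxwellRow (chProj s a) (chProj s c) ⬝ᵥ maxwellRow (chProj s a) (chProj s c) ≤
      maxwellRow a c ⬝ᵥ maxwellRow a c := by
  simp only [maxwellRow_eq]
  rcases hs with rfl | rfl <;> simp [chProj, dotProduct, Fin.sum_univ_succ] <;>
    nlinarith [sq_nonneg (a 1 + c 2 + (a 2 + c 1)), sq_nonneg (a 1 + c 2 - (a 2 + c 1)),
      sq_nonneg (c 0), sq_nonneg (a 0)]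

theorem hatVec_dotProduct_self_le (v : Fin 3 → ℝ) : hatVec v ⬝ᵥ hatVec v ≤ 2 * (v ⬝ᵥ v) := by
  simp [hatVec, dotProduct, Fin.sum_univ_succ]
  nlinarith [mul_self_nonneg (v 1), mul_self_nonneg (v 2)]

theorem maxwellRow_dotProduct_self_le (a c : Fin 3 → ℝ) :
    maxwellRow a c ⬝ᵥ maxwellRow a c ≤ 2 * (a ⬝ᵥ a) + 2 * (c ⬝ᵥ c) := by
  rw [maxwellRow_eq]
  simp [dotProduct, Fin.sum_univ_succ]
  nlinarith [sq_nonneg (a 1 - c 2), sq_nonneg (a 2 - c 1), mul_self_nonneg (a 0),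
    mul_self_nonneg (c 0)]

theorem hatVec_sub (v w : Fin 3 → ℝ) : hatVec (v - w) = hatVec v - hatVec w := by
  ext i; fin_cases i <;> simp [hatVec]

theorem hatVec_add (v w : Fin 3 → ℝ) : hatVec (v + w) = hatVec v + hatVec w := by
  ext i; fin_cases i <;> simp [hatVec]

theorem hatVec_zero : hatVec 0 = 0 := by
  ext i; fin_cases i <;> simp [hatVec]

theorem dotProduct_self_nonneg' {n : ℕ} (v : Fin n → ℝ) : 0 ≤ v ⬝ᵥ v :=
  Finset.sum_nonneg fun _ _ => mul_self_nonneg _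

/-- Young's inequality for the dot product. -/
theorem dotProduct_le_young {n : ℕ} (v w : Fin n → ℝ) {c : ℝ} (hc : 0 < c) :
    v ⬝ᵥ w ≤ (c * (v ⬝ᵥ v) + c⁻¹ * (w ⬝ᵥ w)) / 2 := by
  simp only [dotProduct, Finset.mul_sum]
  rw [← Finset.sum_add_distrib, Finset.sum_div]
  refine Finset.sum_le_sum fun i _ => ?_
  have h : 0 ≤ c⁻¹ * (c * v i - w i) ^ 2 := by positivity
  have h2 : c⁻¹ * (c * v i - w i) ^ 2 = c * (v i * v i) - 2 * (v i * w i) + c⁻¹ * (w i * w i) := by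
    field_simp; ring
  linarith

theorem add_dotProduct_self_le {n : ℕ} (v w : Fin n → ℝ) :
    (v + w) ⬝ᵥ (v + w) ≤ 2 * (v ⬝ᵥ v) + 2 * (w ⬝ᵥ w) := by
  simp only [dotProduct, Finset.mul_sum]
  rw [← Finset.sum_add_distrib]
  refine Finset.sum_le_sum fun i _ => ?_
  simp only [Pi.add_apply]
  nlinarith [sq_nonneg (v i - w i)]

/-! Partial derivatives of smooth functions of `(t, x)`. -/

section Smooth

variable {n : ℕ} {u v : ℝ × ℝ → Fin n → ℝ}

theorem hasDerivAt_timeDeriv (hu : ContDiff ℝ ∞ u) (z : ℝ × ℝ) :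
    HasDerivAt (fun s => u (s, z.2)) (fderiv ℝ u z (1, 0)) z.1 := by
  have h1 : HasFDerivAt u (fderiv ℝ u z) (z.1, z.2) :=
    (hu.differentiable (by simp) z).hasFDerivAt
  exact h1.comp_hasDerivAt z.1 ((hasDerivAt_id z.1).prodMk (hasDerivAt_const z.1 z.2))

theorem hasDerivAt_spaceDeriv (hu : ContDiff ℝ ∞ u) (z : ℝ × ℝ) :
    HasDerivAt (fun y => u (z.1, y)) (fderiv ℝ u z (0, 1)) z.2 := by
  have h1 : HasFDerivAt u (fderiv ℝ u z) (z.1, z.2) :=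
    (hu.differentiable (by simp) z).hasFDerivAt
  exact h1.comp_hasDerivAt z.2 ((hasDerivAt_const z.2 z.1).prodMk (hasDerivAt_id z.2))

theorem timeDeriv_eq (hu : ContDiff ℝ ∞ u) (z : ℝ × ℝ) :
    timeDeriv u z = fderiv ℝ u z (1, 0) := (hasDerivAt_timeDeriv hu z).deriv

theorem spaceDeriv_eq (hu : ContDiff ℝ ∞ u) (z : ℝ × ℝ) :
    spaceDeriv u z = fderiv ℝ u z (0, 1) := (hasDerivAt_spaceDeriv hu z).deriv

theorem contDiff_timeDeriv (hu : ContDiff ℝ ∞ u) : ContDiff ℝ ∞ (timeDeriv u) := by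
  rw [show timeDeriv u = fun z => fderiv ℝ u z (1, 0) from funext (timeDeriv_eq hu)]
  exact (hu.fderiv_right (m := ∞) (by simp)).clm_apply contDiff_const

theorem contDiff_spaceDeriv (hu : ContDiff ℝ ∞ u) : ContDiff ℝ ∞ (spaceDeriv u) := by
  rw [show spaceDeriv u = fun z => fderiv ℝ u z (0, 1) from funext (spaceDeriv_eq hu)]
  exact (hu.fderiv_right (m := ∞) (by simp)).clm_apply contDiff_const

theorem hasDerivAt_time_apply (hu : ContDiff ℝ ∞ u) (t x : ℝ) (i : Fin n) :
    HasDerivAt (fun s => u (s, x) i) (timeDeriv u (t, x) i) t := by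
  rw [timeDeriv_eq hu]
  exact hasDerivAt_pi.1 (hasDerivAt_timeDeriv hu (t, x)) i

theorem hasDerivAt_space_apply (hu : ContDiff ℝ ∞ u) (t x : ℝ) (i : Fin n) :
    HasDerivAt (fun y => u (t, y) i) (spaceDeriv u (t, x) i) x := by
  rw [spaceDeriv_eq hu]
  exact hasDerivAt_pi.1 (hasDerivAt_spaceDeriv hu (t, x)) i

theorem timeDeriv_eq_of_hasDerivAt {z : ℝ × ℝ} {w : Fin n → ℝ}
    (h : ∀ i, HasDerivAt (fun s => u (s, z.2) i) (w i) z.1) : timeDeriv u z = w :=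
  (hasDerivAt_pi.2 h).deriv

theorem spaceDeriv_eq_of_hasDerivAt {z : ℝ × ℝ} {w : Fin n → ℝ}
    (h : ∀ i, HasDerivAt (fun y => u (z.1, y) i) (w i) z.2) : spaceDeriv u z = w :=
  (hasDerivAt_pi.2 h).deriv

theorem contDiff_apply_of (hu : ContDiff ℝ ∞ u) (i : Fin n) : ContDiff ℝ ∞ fun z => u z i :=
  contDiff_pi.1 hu i

theorem contDiff_dotProduct (hu : ContDiff ℝ ∞ u) (hv : ContDiff ℝ ∞ v) :
    ContDiff ℝ ∞ fun z => u z ⬝ᵥ v z := by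
  simp only [dotProduct]
  exact ContDiff.sum fun i _ => (contDiff_apply_of hu i).mul (contDiff_apply_of hv i)

theorem hasDerivAt_time_dotProduct (hu : ContDiff ℝ ∞ u) (hv : ContDiff ℝ ∞ v) (t x : ℝ) :
    HasDerivAt (fun s => u (s, x) ⬝ᵥ v (s, x))
      (timeDeriv u (t, x) ⬝ᵥ v (t, x) + u (t, x) ⬝ᵥ timeDeriv v (t, x)) t := by
  simp only [dotProduct, ← Finset.sum_add_distrib]
  exact HasDerivAt.fun_sum fun i _ =>
    (hasDerivAt_time_apply hu t x i).fun_mul (hasDerivAt_time_apply hv t x i)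

theorem hasDerivAt_space_dotProduct (hu : ContDiff ℝ ∞ u) (hv : ContDiff ℝ ∞ v) (t x : ℝ) :
    HasDerivAt (fun y => u (t, y) ⬝ᵥ v (t, y))
      (spaceDeriv u (t, x) ⬝ᵥ v (t, x) + u (t, x) ⬝ᵥ spaceDeriv v (t, x)) x := by
  simp only [dotProduct, ← Finset.sum_add_distrib]
  exact HasDerivAt.fun_sum fun i _ =>
    (hasDerivAt_space_apply hu t x i).fun_mul (hasDerivAt_space_apply hv t x i)

end Smooth

theorem contDiff_chProj {u : ℝ × ℝ → Fin 3 → ℝ} (s : ℝ) (hu : ContDiff ℝ ∞ u) :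
    ContDiff ℝ ∞ fun z => chProj s (u z) := by
  refine contDiff_pi.2 fun i => ?_
  have h := fun i => contDiff_apply_of hu i
  fin_cases i <;> simp only [chProj]
  · exact contDiff_const.mul (h 0)
  · exact ((h 1).add (contDiff_const.mul (h 2))).div_const 2
  · exact ((h 2).add (contDiff_const.mul (h 1))).div_const 2

theorem timeDeriv_chProj {u : ℝ × ℝ → Fin 3 → ℝ} (s : ℝ) (hu : ContDiff ℝ ∞ u) (z : ℝ × ℝ) :
    timeDeriv (fun z => chProj s (u z)) z = chProj s (timeDeriv u z) := by
  refine timeDeriv_eq_of_hasDerivAt fun i => ?_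
  have h := fun i => hasDerivAt_time_apply hu z.1 z.2 i
  fin_cases i <;> simp only [chProj]
  · exact (h 0).const_mul _
  · exact ((h 1).add ((h 2).const_mul s)).div_const 2
  · exact ((h 2).add ((h 1).const_mul s)).div_const 2

theorem spaceDeriv_chProj {u : ℝ × ℝ → Fin 3 → ℝ} (s : ℝ) (hu : ContDiff ℝ ∞ u) (z : ℝ × ℝ) :
    spaceDeriv (fun z => chProj s (u z)) z = chProj s (spaceDeriv u z) := by
  refine spaceDeriv_eq_of_hasDerivAt fun i => ?_
  have h := fun i => hasDerivAt_space_apply hu z.1 z.2 i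
  fin_cases i <;> simp only [chProj]
  · exact (h 0).const_mul _
  · exact ((h 1).add ((h 2).const_mul s)).div_const 2
  · exact ((h 2).add ((h 1).const_mul s)).div_const 2

theorem contDiff_hatVec {u : ℝ × ℝ → Fin 3 → ℝ} (hu : ContDiff ℝ ∞ u) :
    ContDiff ℝ ∞ fun z => hatVec (u z) := by
  refine contDiff_pi.2 fun i => ?_
  have h := fun i => contDiff_apply_of hu i
  fin_cases i <;> simp only [hatVec]
  · exact h 0
  · exact h 0
  · exact h 1
  · exact h 2

theorem contDiff_maxwellOp {u : ℝ × ℝ → Fin 3 → ℝ} (hu : ContDiff ℝ ∞ u) :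
    ContDiff ℝ ∞ (maxwellOp u) := by
  rw [show maxwellOp u = fun z => maxwellRow (timeDeriv u z) (spaceDeriv u z) from rfl]
  simp only [maxwellRow_eq]
  have h := fun i => contDiff_apply_of (contDiff_timeDeriv hu) i
  have h' := fun i => contDiff_apply_of (contDiff_spaceDeriv hu) i
  refine contDiff_pi.2 fun i => ?_
  fin_cases i
  · exact h' 0
  · exact h 0
  · exact (h 1).add (h' 2)
  · exact (h 2).add (h' 1)

theorem continuous_dotProduct' {α : Type*} [TopologicalSpace α] {n : ℕ} {u v : α → Fin n → ℝ}
    (hu : Continuous u) (hv : Continuous v) : Continuous fun z => u z ⬝ᵥ v z := by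
  simp only [dotProduct]
  fun_prop

theorem continuous_hatVec {α : Type*} [TopologicalSpace α] {u : α → Fin 3 → ℝ}
    (hu : Continuous u) : Continuous fun z => hatVec (u z) := by
  refine continuous_pi fun i => ?_
  fin_cases i <;> simp only [hatVec] <;> simp <;> fun_prop

/-! Integrals over rectangles. -/

theorem HasFDerivAt.hasDerivAt_fst {F : ℝ × ℝ → ℝ} {F' : ℝ × ℝ →L[ℝ] ℝ} {t x : ℝ}
    (h : HasFDerivAt F F' (t, x)) : HasDerivAt (fun r => F (r, x)) (F' (1, 0)) t :=
  h.comp_hasDerivAt t ((hasDerivAt_id t).prodMk (hasDerivAt_const t x))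

theorem HasFDerivAt.hasDerivAt_snd {F : ℝ × ℝ → ℝ} {F' : ℝ × ℝ →L[ℝ] ℝ} {t x : ℝ}
    (h : HasFDerivAt F F' (t, x)) : HasDerivAt (fun y => F (t, y)) (F' (0, 1)) x :=
  h.comp_hasDerivAt x ((hasDerivAt_const x t).prodMk (hasDerivAt_id x))

theorem Continuous.integrableOn_rect {F : ℝ × ℝ → ℝ} (hF : Continuous F) (a b c d : ℝ) :
    IntegrableOn F (Set.Ioo a b ×ˢ Set.Ioo c d) :=
  (hF.continuousOn.integrableOn_compact (isCompact_Icc.prod isCompact_Icc)).mono_set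
    (Set.prod_mono Set.Ioo_subset_Icc_self Set.Ioo_subset_Icc_self)

theorem Continuous.integrableOn_Ioo' {F : ℝ → ℝ} (hF : Continuous F) (a b : ℝ) :
    IntegrableOn F (Set.Ioo a b) :=
  (hF.continuousOn.integrableOn_compact isCompact_Icc).mono_set Set.Ioo_subset_Icc_self

theorem setIntegral_Ioo_eq {a b : ℝ} (hab : a ≤ b) (f : ℝ → ℝ) :
    ∫ y in Set.Ioo a b, f y = ∫ y in a..b, f y := by
  rw [intervalIntegral.integral_of_le hab, integral_Ioc_eq_integral_Ioo]

theorem setIntegral_rect_eq {F : ℝ × ℝ → ℝ} (hF : Continuous F) (a b c d : ℝ) :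
    ∫ z in Set.Ioo a b ×ˢ Set.Ioo c d, F z =
      ∫ t in Set.Ioo a b, ∫ y in Set.Ioo c d, F (t, y) := by
  have := hF.integrableOn_rect a b c d
  rw [Measure.volume_eq_prod] at this ⊢
  exact setIntegral_prod _ this

theorem setIntegral_divergence_rect {F G : ℝ × ℝ → ℝ} (hF : ContDiff ℝ ∞ F) (hG : ContDiff ℝ ∞ G)
    {a b c d : ℝ} (hab : a ≤ b) (hcd : c ≤ d) :
    ∫ z in Set.Ioo a b ×ˢ Set.Ioo c d, (fderiv ℝ F z (1, 0) + fderiv ℝ G z (0, 1)) =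
      (∫ y in Set.Ioo c d, (F (b, y) - F (a, y))) +
        ∫ t in Set.Ioo a b, (G (t, d) - G (t, c)) := by
  have hF' : Continuous fun z => fderiv ℝ F z (1, 0) :=
    (hF.continuous_fderiv (by simp)).clm_apply continuous_const
  have hG' : Continuous fun z => fderiv ℝ G z (0, 1) :=
    (hG.continuous_fderiv (by simp)).clm_apply continuous_const
  have hc : Continuous fun z => fderiv ℝ F z (1, 0) + fderiv ℝ G z (0, 1) := hF'.add hG'
  rw [setIntegral_rect_eq hc, setIntegral_Ioo_eq hab, setIntegral_Ioo_eq hab,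
    setIntegral_Ioo_eq hcd]
  simp only [setIntegral_Ioo_eq hcd]
  have := integral2_divergence_prod_of_hasFDerivAt F G (fderiv ℝ F) (fderiv ℝ G) a c b d
    hF.continuous.continuousOn hG.continuous.continuousOn
    (fun z _ => (hF.differentiable (by simp) z).hasFDerivAt)
    (fun z _ => (hG.differentiable (by simp) z).hasFDerivAt)
    (hc.continuousOn.integrableOn_compact (isCompact_uIcc.prod isCompact_uIcc))
  have hFc := hF.continuous
  have hGc := hG.continuous
  rw [this, intervalIntegral.integral_sub, intervalIntegral.integral_sub]
  · ring
  all_goals exact Continuous.intervalIntegrable (by fun_prop) _ _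

/-- Integration by parts for the Maxwell operator against a characteristic field. -/
theorem setIntegral_maxwellOp_green {s : ℝ} (hs : s = 1 ∨ s = -1) {p v : ℝ × ℝ → Fin 3 → ℝ}
    (hp : ContDiff ℝ ∞ p) (hv : ContDiff ℝ ∞ v) (hPv : ∀ z, chProj s (v z) = v z)
    {a b c d : ℝ} (hab : a ≤ b) (hcd : c ≤ d) :
    ∫ z in Set.Ioo a b ×ˢ Set.Ioo c d,
        (maxwellOp p z ⬝ᵥ hatVec (v z) + p z ⬝ᵥ (timeDeriv v z + s • spaceDeriv v z)) =
      (∫ y in Set.Ioo c d, (p (b, y) ⬝ᵥ v (b, y) - p (a, y) ⬝ᵥ v (a, y))) +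
        s * ∫ t in Set.Ioo a b, (p (t, d) ⬝ᵥ v (t, d) - p (t, c) ⬝ᵥ v (t, c)) := by
  have hF := contDiff_dotProduct hp hv
  have hG : ContDiff ℝ ∞ fun z => s * (p z ⬝ᵥ v z) := contDiff_const.mul hF
  have key := setIntegral_divergence_rect hF hG hab hcd
  simp only [← mul_sub, integral_const_mul] at key
  rw [← key]
  refine integral_congr_ae (Filter.Eventually.of_forall fun z => ?_)
  have hFd : HasFDerivAt (fun z => p z ⬝ᵥ v z) (fderiv ℝ (fun z => p z ⬝ᵥ v z) z) (z.1, z.2) :=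
    (hF.differentiable (by simp) z).hasFDerivAt
  have e1 : HasDerivAt (fun r => p (r, z.2) ⬝ᵥ v (r, z.2))
      (fderiv ℝ (fun z => p z ⬝ᵥ v z) z (1, 0)) z.1 :=
    hFd.hasDerivAt_fst
  have e2 : HasDerivAt (fun y => p (z.1, y) ⬝ᵥ v (z.1, y))
      (fderiv ℝ (fun z => p z ⬝ᵥ v z) z (0, 1)) z.2 :=
    hFd.hasDerivAt_snd
  have h1 := e1.unique (hasDerivAt_time_dotProduct hp hv z.1 z.2)
  have h2 := e2.unique (hasDerivAt_space_dotProduct hp hv z.1 z.2)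
  have h3 : fderiv ℝ (fun z => s * (p z ⬝ᵥ v z)) z (0, 1) =
      s * fderiv ℝ (fun z => p z ⬝ᵥ v z) z (0, 1) := by
    rw [fderiv_const_mul (hF.differentiable (by simp) z)]; simp
  simp only [h1, h2, h3, maxwellOp_eq, maxwellRow_dotProduct_hatVec hs _ _ _ (hPv z),
    dotProduct_add, dotProduct_smul, smul_eq_mul]
  ring

/-! Free-space solutions of the transport equation. -/

/-- Cauchy-Schwarz on an interval. -/
theorem sq_setIntegral_Ioo_le {h : ℝ → ℝ} {a b : ℝ} (hab : a < b)
    (h1 : IntegrableOn h (Set.Ioo a b)) (h2 : IntegrableOn (fun x => h x ^ 2) (Set.Ioo a b)) :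
    (∫ x in Set.Ioo a b, h x) ^ 2 ≤ (b - a) * ∫ x in Set.Ioo a b, h x ^ 2 := by
  set I := ∫ x in Set.Ioo a b, h x with hI
  have hl : 0 < b - a := sub_pos.2 hab
  have key : 0 ≤ ∫ x in Set.Ioo a b, (h x - I / (b - a)) ^ 2 :=
    integral_nonneg fun x => sq_nonneg _
  have h3 : ∫ x in Set.Ioo a b, (h x - I / (b - a)) ^ 2 =
      (∫ x in Set.Ioo a b, h x ^ 2) - I ^ 2 / (b - a) := by
    have e : ∀ x, (h x - I / (b - a)) ^ 2 =
        h x ^ 2 - (2 * (I / (b - a))) * h x + (I / (b - a)) ^ 2 := fun x => by ring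
    simp only [e]
    have hc : IntegrableOn (fun _ : ℝ => (I / (b - a)) ^ 2) (Set.Ioo a b) := by
      simp [integrableOn_const_iff]
    have hi : IntegrableOn (fun x => h x ^ 2 - 2 * (I / (b - a)) * h x) (Set.Ioo a b) :=
      h2.sub (h1.const_mul _)
    rw [integral_add hi hc, integral_sub h2 (h1.const_mul _), integral_const_mul, ← hI]
    simp only [integral_const, MeasurableSet.univ, measureReal_restrict_apply, Set.univ_inter,
      Real.volume_real_Ioo_of_le hab.le, smul_eq_mul]
    field_simp
    ring
  rw [h3, sub_nonneg, div_le_iff₀ hl] at key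
  linarith

/-- The integral of `f` along the forward characteristic of speed `s`. -/
noncomputable def charIntegral (s : ℝ) (f : ℝ × ℝ → ℝ) (z : ℝ × ℝ) : ℝ :=
  ∫ r in Set.Ioi 0, f (z.1 + r, z.2 + s * r)

theorem charIntegral_const_mul (s c : ℝ) (f : ℝ × ℝ → ℝ) (z : ℝ × ℝ) :
    charIntegral s (fun z => c * f z) z = c * charIntegral s f z :=
  integral_const_mul _ _

theorem charIntegral_eq_zero {s : ℝ} {f : ℝ × ℝ → ℝ} {z : ℝ × ℝ}
    (h : ∀ r > 0, f (z.1 + r, z.2 + s * r) = 0) : charIntegral s f z = 0 := by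
  unfold charIntegral
  rw [setIntegral_congr_fun (g := fun _ => 0) measurableSet_Ioi fun r hr => h r hr]
  simp

section

variable {T s : ℝ} {f : ℝ × ℝ → ℝ}

/-- In the coordinates `(x - s t, t)` the integral is a convolution in time with the indicator of
`(-∞, 0]`, the characteristic being a parameter. The kernel is only locally integrable; smoothness
comes from `f`, whose support is bounded in time uniformly in the parameter. -/
theorem contDiff_charIntegral (hf : ContDiff ℝ ∞ f)
    (hT : ∀ z : ℝ × ℝ, z.1 ∉ Set.Icc 0 T → f z = 0) : ContDiff ℝ ∞ (charIntegral s f) := by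
  set k : ℝ → ℝ := (Set.Iic 0).indicator 1
  set g : ℝ → ℝ → ℝ := fun y t => f (t, y + s * t)
  have hk : LocallyIntegrable k volume :=
    (locallyIntegrable_const (1 : ℝ)).indicator measurableSet_Iic
  have hg : ContDiff ℝ ∞ ↿g := by
    have : ContDiff ℝ ∞ fun q : ℝ × ℝ => f (q.2, q.1 + s * q.2) :=
      hf.comp (contDiff_snd.prodMk (contDiff_fst.add (contDiff_const.mul contDiff_snd)))
    exact this
  have h1 := contDiffOn_convolution_right_with_param (n := ⊤) (μ := volume)
    (ContinuousLinearMap.mul ℝ ℝ) (f := k) (g := g) (s := Set.univ) (k := Set.Icc 0 T)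
    isOpen_univ isCompact_Icc (fun p x _ hx => hT (x, p + s * x) hx) hk hg.contDiffOn
  rw [Set.univ_prod_univ, contDiffOn_univ] at h1
  have h2 : ContDiff ℝ ∞ fun z : ℝ × ℝ => (z.2 - s * z.1, z.1) :=
    (contDiff_snd.sub (contDiff_const.mul contDiff_fst)).prodMk contDiff_fst
  have h3 := h1.comp h2
  convert h3 using 1
  ext z
  simp only [Function.comp_apply, convolution_def, ContinuousLinearMap.mul_apply', k, g]
  have : ∀ t : ℝ, (Set.Iic (0 : ℝ)).indicator (1 : ℝ → ℝ) t *
      f (z.1 - t, z.2 - s * z.1 + s * (z.1 - t)) =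
      (Set.Iic (0 : ℝ)).indicator (fun t => f (z.1 - t, z.2 - s * t)) t := by
    intro t
    by_cases ht : t ∈ Set.Iic (0 : ℝ)
    · simp only [Set.indicator_of_mem ht, Pi.one_apply, one_mul]
      congr 2; ring
    · simp [Set.indicator_of_notMem ht]
  simp only [this]
  rw [integral_indicator measurableSet_Iic]
  have h4 := integral_comp_neg_Ioi (0 : ℝ) (fun t => f (z.1 - t, z.2 - s * t))
  rw [neg_zero] at h4
  rw [← h4]
  simp [charIntegral]

theorem charIntegral_integrable (hf : Continuous f)
    (hT : ∀ z : ℝ × ℝ, z.1 ∉ Set.Icc 0 T → f z = 0) (z : ℝ × ℝ) :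
    Integrable fun r => f (z.1 + r, z.2 + s * r) := by
  refine Continuous.integrable_of_hasCompactSupport (by fun_prop)
    (HasCompactSupport.intro (isCompact_Icc (a := -z.1) (b := T - z.1)) fun r hr => hT _ ?_)
  simp only [Set.mem_Icc, not_and_or, not_le] at hr ⊢
  rcases hr with hr | hr
  · left; linarith
  · right; linarith

/-- `-(∂ₜ + s ∂ₓ)` inverts the integration along characteristics. -/
theorem timeDeriv_add_spaceDeriv_charIntegral (hf : ContDiff ℝ ∞ f)
    (hT : ∀ z : ℝ × ℝ, z.1 ∉ Set.Icc 0 T → f z = 0) (z : ℝ × ℝ) :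
    fderiv ℝ (charIntegral s f) z (1, 0) + s * fderiv ℝ (charIntegral s f) z (0, 1) = -f z := by
  have hd : HasFDerivAt (charIntegral s f) (fderiv ℝ (charIntegral s f) z) (z.1 + 0, z.2 + s * 0) := by
    simpa using ((contDiff_charIntegral hf hT).differentiable (by simp) z).hasFDerivAt
  have h1 : HasDerivAt (fun τ : ℝ => (z.1 + τ, z.2 + s * τ)) (1, s) 0 := by
    refine HasDerivAt.prodMk ?_ ?_
    · simpa using (hasDerivAt_id (0 : ℝ)).const_add z.1
    · simpa using ((hasDerivAt_id (0 : ℝ)).const_mul s).const_add z.2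
  have h2 := hd.comp_hasDerivAt (0 : ℝ) h1
  have hfc := hf.continuous
  have hint := charIntegral_integrable (s := s) hfc hT z
  -- Moving the starting point along the characteristic only removes an initial piece of the
  -- integral, so the directional derivative is minus the integrand at the starting point.
  have h3 : (charIntegral s f ∘ fun τ : ℝ => (z.1 + τ, z.2 + s * τ)) = fun τ =>
      (∫ r in Set.Ioi 0, f (z.1 + r, z.2 + s * r)) -
        ∫ r in (0 : ℝ)..τ, f (z.1 + r, z.2 + s * r) := by
    ext τ
    have e1 : charIntegral s f (z.1 + τ, z.2 + s * τ) =
        ∫ r in Set.Ioi τ, f (z.1 + r, z.2 + s * r) := by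
      have := (measurePreserving_add_right volume τ).setIntegral_preimage_emb
        (measurableEmbedding_addRight τ) (fun r => f (z.1 + r, z.2 + s * r)) (Set.Ioi τ)
      rw [← this, Set.preimage_add_const_Ioi, sub_self]
      simp only [charIntegral]
      congr 1 with r
      congr 2 <;> ring
    simp only [Function.comp_apply, e1]
    rw [← intervalIntegral.integral_Ioi_sub_Ioi' hint.integrableOn hint.integrableOn]
    ring
  rw [h3] at h2
  have h4 : HasDerivAt (fun τ => (∫ r in Set.Ioi 0, f (z.1 + r, z.2 + s * r)) -
        ∫ r in (0 : ℝ)..τ, f (z.1 + r, z.2 + s * r)) (-f (z.1 + 0, z.2 + s * 0)) 0 :=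
    (intervalIntegral.integral_hasDerivAt_right (by simp)
      ((Continuous.stronglyMeasurable (by fun_prop)).stronglyMeasurableAtFilter)
      (Continuous.continuousAt (by fun_prop))).const_sub _
  have h5 := h2.unique h4
  have h6 : ((1 : ℝ), s) = (1, 0) + s • (0, 1) := by simp
  rw [h6, map_add, map_smul] at h5
  simpa using h5

/-- Differentiation under the integral sign. It makes `∂ₓφ` again an integral along characteristics,
so that one `L₂` bound serves for `φ` and for `∂ₓφ`. -/
theorem hasDerivAt_charIntegral_space {f' : ℝ × ℝ → ℝ} (hf : Continuous f) (hf' : Continuous f')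
    (hff' : ∀ t x, HasDerivAt (fun y => f (t, y)) (f' (t, x)) x)
    (hb : ∃ C, ∀ z, ‖f' z‖ ≤ C)
    (hT : ∀ z : ℝ × ℝ, z.1 ∉ Set.Icc 0 T → f z = 0)
    (hT' : ∀ z : ℝ × ℝ, z.1 ∉ Set.Icc 0 T → f' z = 0) (t x : ℝ) :
    HasDerivAt (fun y => charIntegral s f (t, y)) (charIntegral s f' (t, x)) x := by
  obtain ⟨C, hC⟩ := hb
  refine (hasDerivAt_integral_of_dominated_loc_of_deriv_le (s := Set.univ)
    (bound := (Set.Icc (-t) (T - t)).indicator fun _ => C)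
    (F := fun y r => f (t + r, y + s * r)) (F' := fun y r => f' (t + r, y + s * r))
    Filter.univ_mem ?_ ?_ ?_ ?_ ?_ ?_).2
  · exact Filter.Eventually.of_forall fun y =>
      (Continuous.aestronglyMeasurable (by fun_prop))
  · exact (charIntegral_integrable hf hT (t, x)).integrableOn
  · exact (Continuous.aestronglyMeasurable (by fun_prop))
  · refine Filter.Eventually.of_forall fun r y _ => ?_
    by_cases hr : r ∈ Set.Icc (-t) (T - t)
    · rw [Set.indicator_of_mem hr]; exact hC _
    · rw [Set.indicator_of_notMem hr, hT' _ ?_, norm_zero]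
      simp only [Set.mem_Icc, not_and_or, not_le] at hr ⊢
      rcases hr with hr | hr
      · left; linarith
      · right; linarith
  · refine Integrable.integrableOn ?_
    rw [integrable_indicator_iff measurableSet_Icc]
    simp [integrableOn_const_iff]
  · refine Filter.Eventually.of_forall fun r y _ => ?_
    exact (hff' (t + r) (y + s * r)).comp_add_const y (s * r)

/-- The `L₂` norm at a fixed time of an integral along characteristics. -/
theorem setIntegral_sq_charIntegral_le {xL xR : ℝ} (hT0 : 0 < T) (hf : Continuous f)
    (hsupp : ∀ z, z ∉ spaceTimeDomain T xL xR → f z = 0)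
    (hΦ : Continuous (charIntegral s f)) (t : ℝ) :
    ∫ x in Set.Ioo xL xR, charIntegral s f (t, x) ^ 2 ≤
      T * ∫ z in spaceTimeDomain T xL xR, f z ^ 2 := by
  have hT : ∀ z : ℝ × ℝ, z.1 ∉ Set.Icc 0 T → f z = 0 := fun z hz => hsupp z fun h =>
    hz (Set.Ioo_subset_Icc_self h.1)
  -- With `ρ = t + r` the support of `f` confines `ρ` to `(0, T)`; extending the integral of `|f|`
  -- to all `ρ` only increases it. Cauchy-Schwarz then costs the factor `T`, for every `t`.
  have h1 : ∀ x, charIntegral s f (t, x) ^ 2 ≤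
      T * ∫ ρ in Set.Ioo 0 T, f (ρ, x + s * (ρ - t)) ^ 2 := by
    intro x
    have e1 : |charIntegral s f (t, x)| ≤ ∫ ρ in Set.Ioo 0 T, |f (ρ, x + s * (ρ - t))| := by
      have hi := (charIntegral_integrable (s := s) hf hT (t, x)).abs
      calc |charIntegral s f (t, x)| ≤ ∫ r in Set.Ioi 0, |f (t + r, x + s * r)| :=
            abs_integral_le_integral_abs
        _ ≤ ∫ r, |f (t + r, x + s * r)| :=
            setIntegral_le_integral hi (Filter.Eventually.of_forall fun r => abs_nonneg _)
        _ = ∫ ρ, |f (ρ, x + s * (ρ - t))| := by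
            rw [← integral_add_left_eq_self (fun ρ => |f (ρ, x + s * (ρ - t))|) t]
            simp
        _ = ∫ ρ in Set.Ioo 0 T, |f (ρ, x + s * (ρ - t))| := by
            rw [setIntegral_eq_integral_of_forall_compl_eq_zero]
            intro ρ hρ
            rw [hsupp _ fun h => hρ h.1, abs_zero]
    have e2 := sq_setIntegral_Ioo_le (h := fun ρ => |f (ρ, x + s * (ρ - t))|) hT0
      (Continuous.integrableOn_Ioo' (by fun_prop) _ _)
      (Continuous.integrableOn_Ioo' (by fun_prop) _ _)
    simp only [sq_abs, sub_zero] at e2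
    calc charIntegral s f (t, x) ^ 2 = |charIntegral s f (t, x)| ^ 2 := (sq_abs _).symm
      _ ≤ (∫ ρ in Set.Ioo 0 T, |f (ρ, x + s * (ρ - t))|) ^ 2 := by gcongr
      _ ≤ _ := e2
  have hF : Continuous fun q : ℝ × ℝ => f (q.1, q.2 + s * (q.1 - t)) ^ 2 := by fun_prop
  have hFi := hF.integrableOn_rect 0 T xL xR
  rw [Measure.volume_eq_prod] at hFi
  have hFi' : Integrable (fun q : ℝ × ℝ => f (q.1, q.2 + s * (q.1 - t)) ^ 2)
      ((volume.restrict (Set.Ioo 0 T)).prod (volume.restrict (Set.Ioo xL xR))) := by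
    rw [Measure.prod_restrict]; exact hFi
  -- At a fixed time the characteristic map is a translation in `x`; a translate of a function
  -- supported in `(xL, xR)` can only lose mass there.
  have hsec : ∀ ρ c, ∫ x in Set.Ioo xL xR, f (ρ, x + c) ^ 2 ≤
      ∫ x in Set.Ioo xL xR, f (ρ, x) ^ 2 := by
    intro ρ c
    have hcs : Integrable fun x => f (ρ, x) ^ 2 := by
      refine Continuous.integrable_of_hasCompactSupport (by fun_prop)
        (HasCompactSupport.intro (isCompact_Icc (a := xL) (b := xR)) fun x hx => ?_)
      rw [hsupp _ fun h => hx (Set.Ioo_subset_Icc_self h.2)]; simp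
    calc ∫ x in Set.Ioo xL xR, f (ρ, x + c) ^ 2 ≤ ∫ x, f (ρ, x + c) ^ 2 :=
          setIntegral_le_integral (hcs.comp_add_right c)
            (Filter.Eventually.of_forall fun x => sq_nonneg _)
      _ = ∫ x, f (ρ, x) ^ 2 := integral_add_right_eq_self (fun x => f (ρ, x) ^ 2) c
      _ = ∫ x in Set.Ioo xL xR, f (ρ, x) ^ 2 := by
          rw [setIntegral_eq_integral_of_forall_compl_eq_zero]
          intro x hx
          rw [hsupp _ fun h => hx h.2]; simp
  have hfin := (Continuous.integrableOn_rect (F := fun z => f z ^ 2) (by fun_prop) 0 T xL xR)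
  rw [Measure.volume_eq_prod, IntegrableOn, ← Measure.prod_restrict] at hfin
  calc ∫ x in Set.Ioo xL xR, charIntegral s f (t, x) ^ 2
      ≤ ∫ x in Set.Ioo xL xR, T * ∫ ρ in Set.Ioo 0 T, f (ρ, x + s * (ρ - t)) ^ 2 := by
        refine integral_mono ?_ (hFi'.integral_prod_right.const_mul T) h1
        exact Continuous.integrableOn_Ioo' (by fun_prop) _ _
    _ = T * ∫ ρ in Set.Ioo 0 T, ∫ x in Set.Ioo xL xR, f (ρ, x + s * (ρ - t)) ^ 2 := by
        rw [integral_const_mul, ← integral_integral_swap hFi']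
    _ ≤ T * ∫ ρ in Set.Ioo 0 T, ∫ x in Set.Ioo xL xR, f (ρ, x) ^ 2 := by
        refine mul_le_mul_of_nonneg_left ?_ hT0.le
        exact integral_mono hFi'.integral_prod_left hfin.integral_prod_left fun ρ => hsec ρ _
    _ = T * ∫ z in spaceTimeDomain T xL xR, f z ^ 2 := by
        rw [spaceTimeDomain, setIntegral_rect_eq (by fun_prop)]

end

theorem IsCompact.exists_subset_Icc_of_subset_Ioo {K : Set ℝ} (hK : IsCompact K) {a b : ℝ}
    (hab : K ⊆ Set.Ioo a b) : ∃ ε > 0, K ⊆ Set.Icc (a + ε) (b - ε) := by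
  rcases K.eq_empty_or_nonempty with rfl | hne
  · exact ⟨1, one_pos, Set.empty_subset _⟩
  · have h1 := hab (hK.sInf_mem hne)
    have h2 := hab (hK.sSup_mem hne)
    refine ⟨min (sInf K - a) (b - sSup K), lt_min (sub_pos.2 h1.1) (sub_pos.2 h2.2), fun x hx => ?_⟩
    have h3 := csInf_le hK.bddBelow hx
    have h4 := le_csSup hK.bddAbove hx
    constructor
    · linarith [min_le_left (sInf K - a) (b - sSup K)]
    · linarith [min_le_right (sInf K - a) (b - sSup K)]

/-- The square of the `H¹` norm. -/
noncomputable def h1Sq (D : Set (ℝ × ℝ)) (ψ : ℝ × ℝ → Fin 3 → ℝ) : ℝ :=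
  ∫ z in D, (ψ z ⬝ᵥ ψ z + timeDeriv ψ z ⬝ᵥ timeDeriv ψ z + spaceDeriv ψ z ⬝ᵥ spaceDeriv ψ z)

theorem h1Sq_nonneg (D : Set (ℝ × ℝ)) (ψ : ℝ × ℝ → Fin 3 → ℝ) : 0 ≤ h1Sq D ψ :=
  integral_nonneg fun _ => add_nonneg (add_nonneg (dotProduct_self_nonneg' _)
    (dotProduct_self_nonneg' _)) (dotProduct_self_nonneg' _)

/-- `φ` is a characteristic component, of speed `s`, of the free-space solution of the dual
problem with right-hand side `ψ`; `B` controls its size. -/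
structure IsDualField (T xL xR s B : ℝ) (ψ φ : ℝ × ℝ → Fin 3 → ℝ) : Prop where
  contDiff : ContDiff ℝ ∞ φ
  chProj_eq : ∀ z, chProj s (φ z) = φ z
  transport : ∀ z, timeDeriv φ z + s • spaceDeriv φ z = -chProj s (ψ z)
  final : ∃ T' < T, ∀ z : ℝ × ℝ, T' ≤ z.1 → φ z = 0
  initial : ∃ t₀, ∀ z : ℝ × ℝ, z.1 ≤ t₀ → z.2 ∈ Set.Icc xL xR → φ z = 0
  outflow_right : s = 1 → ∀ z : ℝ × ℝ, xR ≤ z.2 → φ z = 0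
  outflow_left : s = -1 → ∀ z : ℝ × ℝ, z.2 ≤ xL → φ z = 0
  sq_le : ∀ t, ∫ x in Set.Ioo xL xR, φ (t, x) ⬝ᵥ φ (t, x) ≤ T * B
  space_sq_le : ∀ t, ∫ x in Set.Ioo xL xR, spaceDeriv φ (t, x) ⬝ᵥ spaceDeriv φ (t, x) ≤ T * B
  time_sq_le : ∫ z in spaceTimeDomain T xL xR, timeDeriv φ z ⬝ᵥ timeDeriv φ z ≤
    (2 + 2 * T ^ 2) * B

theorem setIntegral_dotProduct_eq_sum {α : Type*} [MeasurableSpace α] {μ : Measure α} {n : ℕ}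
    {u v : α → Fin n → ℝ} (h : ∀ i, Integrable (fun z => u z i * v z i) μ) :
    ∫ z, u z ⬝ᵥ v z ∂μ = ∑ i, ∫ z, u z i * v z i ∂μ := by
  simp only [dotProduct]
  exact integral_finsetSum _ fun i _ => h i

/-- The field is `P_s ψ` integrated along the characteristics. Its support properties say where a
characteristic can still meet the support of `ψ`. -/
theorem exists_isDualField {T xL xR s : ℝ} (hT : 0 < T) (hs : s = 1 ∨ s = -1)
    {ψ : ℝ × ℝ → Fin 3 → ℝ} (hψ : ContDiff ℝ ∞ ψ) (hc : HasCompactSupport ψ)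
    (hsupp : tsupport ψ ⊆ spaceTimeDomain T xL xR) :
    ∃ φ, IsDualField T xL xR s (h1Sq (spaceTimeDomain T xL xR) ψ) ψ φ := by
  set Q := spaceTimeDomain T xL xR with hQ
  set f : ℝ × ℝ → Fin 3 → ℝ := fun z => chProj s (ψ z) with hf
  have hfs : ContDiff ℝ ∞ f := contDiff_chProj s hψ
  have hfx : ContDiff ℝ ∞ (spaceDeriv f) := contDiff_spaceDeriv hfs
  have hψ0 : ∀ z, z ∉ tsupport ψ → ψ z = 0 := fun z hz => image_eq_zero_of_notMem_tsupport hz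
  have hf0 : ∀ z, z ∉ tsupport ψ → f z = 0 := fun z hz => by
    simp only [hf, hψ0 z hz, chProj_zero]
  have hfx0 : ∀ z, z ∉ tsupport ψ → spaceDeriv f z = 0 := by
    intro z hz
    have : f =ᶠ[nhds z] fun _ => 0 := by
      filter_upwards [(isClosed_tsupport ψ).isOpen_compl.mem_nhds hz] with w hw using hf0 w hw
    rw [spaceDeriv_eq hfs, this.fderiv_eq]
    simp
  have hT0 : ∀ i, ∀ z : ℝ × ℝ, z.1 ∉ Set.Icc 0 T → f z i = 0 := fun i z hz => by
    rw [hf0 z fun h => hz (Set.Ioo_subset_Icc_self (hsupp h).1)]; rfl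
  have hTx0 : ∀ i, ∀ z : ℝ × ℝ, z.1 ∉ Set.Icc 0 T → spaceDeriv f z i = 0 := fun i z hz => by
    rw [hfx0 z fun h => hz (Set.Ioo_subset_Icc_self (hsupp h).1)]; rfl
  have hfi := fun i => contDiff_apply_of hfs i
  have hfxi := fun i => contDiff_apply_of hfx i
  set φ : ℝ × ℝ → Fin 3 → ℝ := fun z i => charIntegral s (fun z => f z i) z with hφ
  have hφi : ∀ i, ContDiff ℝ ∞ fun z => φ z i := fun i => contDiff_charIntegral (hfi i) (hT0 i)
  have hφs : ContDiff ℝ ∞ φ := contDiff_pi.2 hφi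
  have hφx : ∀ z, spaceDeriv φ z = fun i => charIntegral s (fun z => spaceDeriv f z i) z := by
    intro z
    refine spaceDeriv_eq_of_hasDerivAt fun i => ?_
    refine hasDerivAt_charIntegral_space (T := T) (hfi i).continuous (hfxi i).continuous
      (fun t x => hasDerivAt_space_apply hfs t x i) ?_ (hT0 i) (hTx0 i) z.1 z.2
    refine Continuous.bounded_above_of_compact_support (hfxi i).continuous
      (HasCompactSupport.intro hc fun z hz => by rw [hfx0 z hz]; rfl)
  have hsφ := contDiff_spaceDeriv hφs
  have htφ := contDiff_timeDeriv hφs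
  have hφxi : ∀ i, ContDiff ℝ ∞ (charIntegral s (fun z => spaceDeriv f z i)) :=
    fun i => contDiff_charIntegral (hfxi i) (hTx0 i)
  have htr : ∀ z, timeDeriv φ z + s • spaceDeriv φ z = -chProj s (ψ z) := by
    intro z
    ext i
    have h1 := timeDeriv_add_spaceDeriv_charIntegral (s := s) (hfi i) (hT0 i) z
    have h2 : timeDeriv φ z i = fderiv ℝ (fun z => φ z i) z (1, 0) := by
      have hd : HasFDerivAt (fun z => φ z i) (fderiv ℝ (fun z => φ z i) z) (z.1, z.2) :=
        ((hφi i).differentiable (by simp) z).hasFDerivAt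
      exact (hasDerivAt_time_apply hφs z.1 z.2 i).unique hd.hasDerivAt_fst
    have h3 : spaceDeriv φ z i = fderiv ℝ (fun z => φ z i) z (0, 1) := by
      have hd : HasFDerivAt (fun z => φ z i) (fderiv ℝ (fun z => φ z i) z) (z.1, z.2) :=
        ((hφi i).differentiable (by simp) z).hasFDerivAt
      exact (hasDerivAt_space_apply hφs z.1 z.2 i).unique hd.hasDerivAt_snd
    simp only [Pi.add_apply, Pi.smul_apply, smul_eq_mul, Pi.neg_apply, h2, h3]
    exact h1
  have hψi := fun i => (contDiff_apply_of hψ i).continuous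
  have hψc := hψ.continuous
  have hψt := (contDiff_timeDeriv hψ).continuous
  have hψx := (contDiff_spaceDeriv hψ).continuous
  have hB1 : ∫ z in Q, f z ⬝ᵥ f z ≤ h1Sq Q ψ := by
    refine integral_mono ?_ ?_ fun z => ?_
    · exact (continuous_dotProduct' hfs.continuous hfs.continuous).integrableOn_rect _ _ _ _
    · exact (((continuous_dotProduct' hψc hψc).add (continuous_dotProduct' hψt hψt)).add
        (continuous_dotProduct' hψx hψx)).integrableOn_rect _ _ _ _
    · have := chProj_dotProduct_self_le hs (ψ z)
      have h1 := dotProduct_self_nonneg' (timeDeriv ψ z)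
      have h2 := dotProduct_self_nonneg' (spaceDeriv ψ z)
      simp only [hf]; linarith
  have hB2 : ∫ z in Q, spaceDeriv f z ⬝ᵥ spaceDeriv f z ≤ h1Sq Q ψ := by
    refine integral_mono ?_ ?_ fun z => ?_
    · exact (continuous_dotProduct' hfx.continuous hfx.continuous).integrableOn_rect _ _ _ _
    · exact (((continuous_dotProduct' hψc hψc).add (continuous_dotProduct' hψt hψt)).add
        (continuous_dotProduct' hψx hψx)).integrableOn_rect _ _ _ _
    · have := chProj_dotProduct_self_le hs (spaceDeriv ψ z)
      have h1 := dotProduct_self_nonneg' (timeDeriv ψ z)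
      have h2 := dotProduct_self_nonneg' (ψ z)
      simp only [hf, spaceDeriv_chProj s hψ]; linarith
  -- Used for `P_s ψ` and again for its space derivative.
  have hsum : ∀ g : ℝ × ℝ → Fin 3 → ℝ, ContDiff ℝ ∞ g → (∀ z, z ∉ Q → g z = 0) →
      (∀ i, Continuous (charIntegral s fun z => g z i)) → ∀ t,
      ∫ x in Set.Ioo xL xR, (fun i => charIntegral s (fun z => g z i) (t, x)) ⬝ᵥ
        (fun i => charIntegral s (fun z => g z i) (t, x)) ≤ T * ∫ z in Q, g z ⬝ᵥ g z := by
    intro g hg hg0 hgc t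
    have hgi := fun i => (contDiff_apply_of hg i).continuous
    have hgt : ∀ i, Continuous fun x => charIntegral s (fun z => g z i) (t, x) :=
      fun i => (hgc i).comp (by fun_prop)
    rw [setIntegral_dotProduct_eq_sum (fun i => Continuous.integrableOn_Ioo'
        ((hgt i).mul (hgt i)) _ _),
      hQ, spaceTimeDomain, setIntegral_dotProduct_eq_sum (u := g) (v := g) (fun i =>
        Continuous.integrableOn_rect ((hgi i).mul (hgi i)) 0 T xL xR), Finset.mul_sum]
    refine Finset.sum_le_sum fun i _ => ?_
    have := setIntegral_sq_charIntegral_le (s := s) (xL := xL) (xR := xR) hT (hgi i)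
      (fun z hz => by rw [hg0 z hz]; rfl) (hgc i) t
    simpa only [sq, spaceTimeDomain] using this
  have hsx : ∀ t, ∫ x in Set.Ioo xL xR, spaceDeriv φ (t, x) ⬝ᵥ spaceDeriv φ (t, x) ≤
      T * h1Sq Q ψ := by
    intro t
    simp only [hφx]
    exact (hsum (spaceDeriv f) hfx (fun z hz => hfx0 z fun h => hz (hsupp h))
      (fun i => (hφxi i).continuous) t).trans (mul_le_mul_of_nonneg_left hB2 hT.le)
  refine ⟨φ, hφs, ?_, htr, ?_, ?_, ?_, ?_, ?_, hsx, ?_⟩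
  · intro z
    -- Lying in the range of `P_s` amounts to two linear relations between the components, and these
    -- pass through the integral.
    have h0 : ∀ w, f w 0 = (1 + s) / 2 * f w 0 := fun w => by
      rcases hs with rfl | rfl <;> simp [hf, chProj]
    have h1 : ∀ w, f w 1 = s * f w 2 := fun w => by
      rcases hs with rfl | rfl <;> simp [hf, chProj] <;> ring
    have e0 : φ z 0 = (1 + s) / 2 * φ z 0 := by
      have := charIntegral_const_mul s ((1 + s) / 2) (fun z => f z 0) z
      simp only [← h0] at this
      exact this
    have e1 : φ z 1 = s * φ z 2 := by
      have := charIntegral_const_mul s s (fun z => f z 2) z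
      simp only [← h1] at this
      exact this
    ext i
    fin_cases i
    · exact e0.symm
    · show (φ z 1 + s * φ z 2) / 2 = φ z 1
      linarith
    · show (φ z 2 + s * φ z 1) / 2 = φ z 2
      rw [e1]
      rcases hs with rfl | rfl <;> ring
  · have hk : IsCompact (Prod.fst '' tsupport ψ) := IsCompact.image hc continuous_fst
    obtain ⟨ε, hε, hsub⟩ := hk.exists_subset_Icc_of_subset_Ioo (a := 0) (b := T) (by
      rintro _ ⟨z, hz, rfl⟩; exact (hsupp hz).1)
    refine ⟨T - ε / 2, by linarith, fun z hz => ?_⟩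
    ext i
    refine charIntegral_eq_zero fun r hr => ?_
    rw [hf0 _ fun h => ?_]
    · rfl
    · have := (hsub ⟨_, h, rfl⟩).2
      simp only at this
      linarith
  -- A characteristic that starts over `[xL, xR]` this early has moved by more than the width of the
  -- interval before time `0`, when the support of `ψ` begins.
  · refine ⟨-(xR - xL), fun z hz hz2 => ?_⟩
    ext i
    refine charIntegral_eq_zero fun r hr => ?_
    rw [hf0 _ fun h => ?_]
    · rfl
    · have h1 := (hsupp h).1.1
      have h2 := (hsupp h).2.1
      have h3 := (hsupp h).2.2
      simp only at h1 h2 h3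
      have h4 := hz2.1
      have h5 := hz2.2
      rcases hs with rfl | rfl <;> linarith
  · rintro rfl z hz
    ext i
    refine charIntegral_eq_zero fun r hr => ?_
    rw [hf0 _ fun h => ?_]
    · rfl
    · have h3 := (hsupp h).2.2
      simp only at h3
      linarith
  · rintro rfl z hz
    ext i
    refine charIntegral_eq_zero fun r hr => ?_
    rw [hf0 _ fun h => ?_]
    · rfl
    · have h3 := (hsupp h).2.1
      simp only at h3
      linarith
  · intro t
    exact (hsum f hfs (fun z hz => hf0 z fun h => hz (hsupp h))
      (fun i => (hφi i).continuous) t).trans (mul_le_mul_of_nonneg_left hB1 hT.le)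
  · have hcx := continuous_dotProduct' hsφ.continuous hsφ.continuous
    have hct := continuous_dotProduct' htφ.continuous htφ.continuous
    have hcf := continuous_dotProduct' hfs.continuous hfs.continuous
    have h1 : ∫ z in Q, timeDeriv φ z ⬝ᵥ timeDeriv φ z ≤
        ∫ z in Q, (2 * (f z ⬝ᵥ f z) + 2 * (spaceDeriv φ z ⬝ᵥ spaceDeriv φ z)) := by
      refine integral_mono (hct.integrableOn_rect _ _ _ _) (Continuous.integrableOn_rect
        ((continuous_const.mul hcf).add (continuous_const.mul hcx)) _ _ _ _) fun z => ?_
      -- The transport equation trades `∂ₜφ` for `P_s ψ` and `∂ₓφ`. The constant is `2` for the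
      -- first and `2 T · T` for the second, the latter after integrating its bound at each time.
      have e : timeDeriv φ z = -f z + -(s • spaceDeriv φ z) := by
        rw [← htr z]; abel
      have h2 := add_dotProduct_self_le (-f z) (-(s • spaceDeriv φ z))
      have hs2 : s * s = 1 := by rcases hs with rfl | rfl <;> norm_num
      simp only [dotProduct_neg, neg_dotProduct, neg_neg, smul_dotProduct, dotProduct_smul,
        smul_eq_mul, mul_neg] at h2
      rw [← e, ← mul_assoc s s, hs2, one_mul] at h2
      exact h2
    have h2 : ∫ z in Q, spaceDeriv φ z ⬝ᵥ spaceDeriv φ z ≤ T * (T * h1Sq Q ψ) := by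
      change ∫ z in Set.Ioo 0 T ×ˢ Set.Ioo xL xR, spaceDeriv φ z ⬝ᵥ spaceDeriv φ z ≤ _
      rw [setIntegral_rect_eq (F := fun z => spaceDeriv φ z ⬝ᵥ spaceDeriv φ z) hcx 0 T xL xR]
      have hint : IntegrableOn (fun z => spaceDeriv φ z ⬝ᵥ spaceDeriv φ z)
        (Set.Ioo 0 T ×ˢ Set.Ioo xL xR) (volume.prod volume) := hcx.integrableOn_rect 0 T xL xR
      rw [IntegrableOn, ← Measure.prod_restrict] at hint
      refine (integral_mono hint.integral_prod_left (integrable_const _) hsx).trans ?_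
      simp [Real.volume_real_Ioo_of_le hT.le]
    have i1 : IntegrableOn (fun z => 2 * (f z ⬝ᵥ f z)) Q :=
      (continuous_const.mul hcf).integrableOn_rect _ _ _ _
    have i2 : IntegrableOn (fun z => 2 * (spaceDeriv φ z ⬝ᵥ spaceDeriv φ z)) Q :=
      (continuous_const.mul hcx).integrableOn_rect _ _ _ _
    rw [integral_add i1 i2, integral_const_mul, integral_const_mul] at h1
    nlinarith

/-! Inverse inequalities for polynomials in one variable. -/

/-- The integral is a continuous quadratic form in the coefficients, positive because a nonzero
polynomial has finitely many roots. On the unit sphere it attains a positive minimum, and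
homogeneity does the rest. -/
theorem exists_sq_coeff_le_integral (k : ℕ) :
    ∃ C > 0, ∀ (c : Fin (k + 1) → ℝ) (i : Fin (k + 1)),
      c i ^ 2 ≤ C * ∫ s in (0 : ℝ)..1, (∑ p, c p * s ^ (p : ℕ)) ^ 2 := by
  set Q : (Fin (k + 1) → ℝ) → ℝ := fun c => ∫ s in (0 : ℝ)..1, (∑ p, c p * s ^ (p : ℕ)) ^ 2 with hQ
  have hQc : Continuous Q := by
    refine intervalIntegral.continuous_parametric_intervalIntegral_of_continuous' ?_ _ _
    fun_prop
  have hhom : ∀ (r : ℝ) c, Q (r • c) = r ^ 2 * Q c := by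
    intro r c
    simp only [hQ, Pi.smul_apply, smul_eq_mul, mul_assoc, ← Finset.mul_sum, mul_pow]
    exact intervalIntegral.integral_const_mul _ _
  have hnn : ∀ c, 0 ≤ Q c := fun c =>
    intervalIntegral.integral_nonneg zero_le_one fun s _ => sq_nonneg _
  have hpos : ∀ c, c ≠ 0 → 0 < Q c := by
    intro c hc
    refine lt_of_le_of_ne (hnn c) fun h0 => hc ?_
    set P : Polynomial ℝ := ∑ p : Fin (k + 1), Polynomial.C (c p) * Polynomial.X ^ (p : ℕ) with hP
    have hPe : ∀ s, P.eval s = ∑ p, c p * s ^ (p : ℕ) := fun s => by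
      simp [hP, Polynomial.eval_finsetSum]
    have hz : ∀ s ∈ Set.Ioo (0 : ℝ) 1, P.eval s = 0 := by
      intro s hs
      by_contra hne
      have hlt : 0 < ∫ s in (0 : ℝ)..1, (P.eval s) ^ 2 := by
        refine intervalIntegral.integral_pos zero_lt_one (by fun_prop) (fun s _ => sq_nonneg _)
          ⟨s, Set.Ioo_subset_Icc_self hs, by positivity⟩
      simp only [hPe] at hlt
      exact absurd h0 hlt.ne
    have hP0 : P = 0 := Polynomial.eq_zero_of_infinite_isRoot P
      ((Set.Ioo_infinite (zero_lt_one' ℝ)).mono hz)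
    ext i
    have := congrArg (fun P => Polynomial.coeff P i) hP0
    simpa [hP, Polynomial.finsetSum_coeff, Polynomial.coeff_C_mul, Polynomial.coeff_X_pow,
      Fin.val_inj] using this
  have hne : (Metric.sphere (0 : Fin (k + 1) → ℝ) 1).Nonempty :=
    NormedSpace.sphere_nonempty.2 zero_le_one
  obtain ⟨c₀, hc₀, hmin⟩ := (isCompact_sphere (0 : Fin (k + 1) → ℝ) 1).exists_isMinOn hne
    hQc.continuousOn
  have hc₀' : c₀ ≠ 0 := by
    rintro rfl
    simp at hc₀
  have hμ := hpos c₀ hc₀'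
  refine ⟨(Q c₀)⁻¹, inv_pos.2 hμ, fun c i => ?_⟩
  change c i ^ 2 ≤ (Q c₀)⁻¹ * Q c
  rw [← div_eq_inv_mul, le_div_iff₀ hμ]
  by_cases hc : c = 0
  · simp [hc, hnn 0]
  have hn : 0 < ‖c‖ := norm_pos_iff.2 hc
  have h1 : Q c₀ ≤ Q (‖c‖⁻¹ • c) := hmin (by simp [norm_smul, hn.ne'])
  rw [hhom, inv_pow, ← div_eq_inv_mul, le_div_iff₀ (by positivity)] at h1
  have h2 : c i ^ 2 ≤ ‖c‖ ^ 2 := sq_le_sq' (by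
    have := neg_abs_le (c i); have h := norm_le_pi_norm c i; rw [Real.norm_eq_abs] at h; linarith)
    ((le_abs_self _).trans (norm_le_pi_norm c i))
  nlinarith

/-- Rescaling to `[0, 1]` turns the end point value into the zeroth coefficient and the derivative
into a combination of coefficients. The powers of `b - a` come from the change of variables. -/
theorem exists_inverse_inequality (k : ℕ) :
    ∃ C > 0, ∀ P : Polynomial ℝ, P.natDegree ≤ k → ∀ a b : ℝ, a < b →
      (b - a) * P.eval a ^ 2 ≤ C * ∫ t in Set.Ioo a b, P.eval t ^ 2 ∧
      (b - a) ^ 2 * ∫ t in Set.Ioo a b, P.derivative.eval t ^ 2 ≤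
        C * ∫ t in Set.Ioo a b, P.eval t ^ 2 := by
  obtain ⟨C₀, hC₀, h⟩ := exists_sq_coeff_le_integral k
  set D : ℝ := ∑ p : Fin (k + 1), ((p : ℕ) : ℝ) ^ 2 with hD
  have hDn : 0 ≤ D := Finset.sum_nonneg fun _ _ => sq_nonneg _
  refine ⟨C₀ * (1 + D * (k + 1)), by positivity, fun P hP a b hab => ?_⟩
  have hl : 0 < b - a := sub_pos.2 hab
  set l := b - a
  set R : Polynomial ℝ := P.comp (Polynomial.C a + Polynomial.C l * Polynomial.X) with hR
  have hRd : R.natDegree < k + 1 := by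
    refine Nat.lt_succ_of_le (Polynomial.natDegree_comp_le.trans ?_)
    have h1 : (Polynomial.C a + Polynomial.C l * Polynomial.X).natDegree ≤ 1 := by
      compute_degree
    calc _ ≤ P.natDegree * 1 := Nat.mul_le_mul_left _ h1
      _ ≤ k := by simpa using hP
  have hRe : ∀ s, R.eval s = P.eval (a + l * s) := fun s => by simp [hR, Polynomial.eval_comp]
  have hRd' : ∀ s, R.derivative.eval s = l * P.derivative.eval (a + l * s) := fun s => by
    simp [hR, Polynomial.derivative_comp, Polynomial.eval_comp]
  have hsum : ∀ s, R.eval s = ∑ p : Fin (k + 1), R.coeff p * s ^ (p : ℕ) := fun s => by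
    rw [Polynomial.eval_eq_sum_range' hRd, Finset.sum_range]
  -- The truncated exponent at `p = 0` is harmless because of the factor `p`.
  have hsumd : ∀ s, R.derivative.eval s =
      ∑ p : Fin (k + 1), ((p : ℕ) : ℝ) * (R.coeff p * s ^ ((p : ℕ) - 1)) := fun s => by
    rw [Polynomial.derivative_eval, Polynomial.sum_over_range' _ (by simp) _ hRd, Finset.sum_range]
    exact Finset.sum_congr rfl fun p _ => by ring
  set J := ∫ s in (0 : ℝ)..1, R.eval s ^ 2 with hJ
  have hcoef : ∀ p : Fin (k + 1), R.coeff p ^ 2 ≤ C₀ * J := fun p => by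
    have := h (fun p => R.coeff p) p
    simp only [← hsum] at this
    exact this
  have hJ0 : 0 ≤ J := intervalIntegral.integral_nonneg zero_le_one fun s _ => sq_nonneg _
  have hscale : ∀ f : ℝ → ℝ, ∫ t in Set.Ioo a b, f t = l * ∫ s in (0 : ℝ)..1, f (a + l * s) := by
    intro f
    rw [setIntegral_Ioo_eq hab.le]
    have := intervalIntegral.smul_integral_comp_add_mul f l a (a := 0) (b := 1)
    rw [smul_eq_mul] at this
    rw [this]
    congr 1 <;> simp [l]
  have e1 : ∫ t in Set.Ioo a b, P.eval t ^ 2 = l * J := by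
    rw [hscale]; simp only [← hRe, hJ]
  have e2 : l ^ 2 * ∫ t in Set.Ioo a b, P.derivative.eval t ^ 2 =
      l * ∫ s in (0 : ℝ)..1, R.derivative.eval s ^ 2 := by
    rw [hscale, show l ^ 2 * (l * ∫ s in (0 : ℝ)..1, P.derivative.eval (a + l * s) ^ 2) =
      l * (l ^ 2 * ∫ s in (0 : ℝ)..1, P.derivative.eval (a + l * s) ^ 2) by ring,
      ← intervalIntegral.integral_const_mul]
    simp only [hRd', mul_pow]
  have h0 : P.eval a ^ 2 ≤ C₀ * J := by
    have := hcoef 0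
    have e : R.coeff 0 = P.eval a := by
      rw [Polynomial.coeff_zero_eq_eval_zero, hRe]; simp
    simpa [e] using this
  have hdp : ∀ s ∈ Set.Icc (0 : ℝ) 1, R.derivative.eval s ^ 2 ≤ D * ((k + 1) * (C₀ * J)) := by
    intro s hs
    rw [hsumd]
    refine (Finset.sum_mul_sq_le_sq_mul_sq _ _ _).trans ?_
    refine mul_le_mul_of_nonneg_left ?_ hDn
    calc ∑ p : Fin (k + 1), (R.coeff p * s ^ ((p : ℕ) - 1)) ^ 2
        ≤ ∑ _p : Fin (k + 1), C₀ * J := by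
          refine Finset.sum_le_sum fun p _ => ?_
          have h1 : (s ^ ((p : ℕ) - 1)) ^ 2 ≤ 1 := by
            rw [← pow_mul]; exact pow_le_one₀ hs.1 hs.2
          rw [mul_pow]
          exact (mul_le_of_le_one_right (sq_nonneg _) h1).trans (hcoef p)
      _ = (k + 1) * (C₀ * J) := by simp
  have h1 : ∫ s in (0 : ℝ)..1, R.derivative.eval s ^ 2 ≤ D * ((k + 1) * (C₀ * J)) := by
    refine (intervalIntegral.integral_mono_on zero_le_one
      (Continuous.intervalIntegrable (by fun_prop) _ _) intervalIntegrable_const hdp).trans ?_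
    simp
  rw [e1, e2]
  constructor
  · have : 0 ≤ C₀ * (D * (k + 1)) * (l * J) := by positivity
    nlinarith
  · have : 0 ≤ C₀ * (l * J) := by positivity
    have h2 := mul_le_mul_of_nonneg_left h1 hl.le
    nlinarith

/-! Tensor-product polynomials. -/

/-- Polynomials of degree at most `k` in each of the two variables. -/
def IsTensorPoly (k : ℕ) (f : ℝ × ℝ → ℝ) : Prop :=
  ∃ c : Fin (k + 1) → Fin (k + 1) → ℝ,
    ∀ z : ℝ × ℝ, f z = ∑ p, ∑ q, c p q * z.1 ^ (p : ℕ) * z.2 ^ (q : ℕ)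

namespace IsTensorPoly

variable {k : ℕ} {f g : ℝ × ℝ → ℝ}

theorem contDiff (hf : IsTensorPoly k f) : ContDiff ℝ ∞ f := by
  obtain ⟨c, hc⟩ := hf
  rw [show f = fun z : ℝ × ℝ => ∑ p, ∑ q, c p q * z.1 ^ (p : ℕ) * z.2 ^ (q : ℕ) from funext hc]
  fun_prop

theorem zero : IsTensorPoly k fun _ => 0 := ⟨0, fun z => by simp⟩

theorem add (hf : IsTensorPoly k f) (hg : IsTensorPoly k g) :
    IsTensorPoly k fun z => f z + g z := by
  obtain ⟨c, hc⟩ := hf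
  obtain ⟨d, hd⟩ := hg
  refine ⟨c + d, fun z => ?_⟩
  simp only [hc, hd, ← Finset.sum_add_distrib, Pi.add_apply, add_mul]

theorem const_mul (a : ℝ) (hf : IsTensorPoly k f) : IsTensorPoly k fun z => a * f z := by
  obtain ⟨c, hc⟩ := hf
  refine ⟨a • c, fun z => ?_⟩
  simp only [hc, Finset.mul_sum, Pi.smul_apply, smul_eq_mul, mul_assoc]

/-- Freezing `x = y` before multiplying keeps the degree in `x` at one, so for `k ≥ 1` a discrete
function can be switched off linearly without leaving the finite element space. Multiplying the
unfrozen function would raise the degree. -/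
theorem mul_affine (hk : 1 ≤ k) (hf : IsTensorPoly k f) (y α β : ℝ) :
    IsTensorPoly k fun z => (α + β * z.2) * f (z.1, y) := by
  obtain ⟨c, hc⟩ := hf
  obtain ⟨o, ho⟩ : ∃ o : Fin (k + 1), (o : ℕ) = 1 := ⟨⟨1, by omega⟩, rfl⟩
  refine ⟨fun p q => (∑ r, c p r * y ^ (r : ℕ)) * ((if q = 0 then α else 0) + if q = o then β else 0),
    fun z => ?_⟩
  simp only [hc]
  rw [Finset.mul_sum]
  refine Finset.sum_congr rfl fun p _ => ?_
  simp only [mul_add, add_mul, Finset.sum_add_distrib, mul_ite, ite_mul, mul_zero, zero_mul,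
    Finset.sum_ite_eq', Finset.mem_univ, if_true, Fin.val_zero, pow_zero, ho, pow_one]
  simp only [Finset.sum_mul, Finset.mul_sum, ← Finset.sum_add_distrib]
  exact Finset.sum_congr rfl fun q _ => by ring

theorem exists_time_polynomial (hf : IsTensorPoly k f) (y : ℝ) :
    ∃ P : Polynomial ℝ, P.natDegree ≤ k ∧ ∀ t, f (t, y) = P.eval t := by
  obtain ⟨c, hc⟩ := hf
  refine ⟨∑ p : Fin (k + 1), Polynomial.C (∑ q, c p q * y ^ (q : ℕ)) * Polynomial.X ^ (p : ℕ),
    ?_, fun t => ?_⟩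
  · refine Polynomial.natDegree_sum_le_of_forall_le _ _ fun p _ => ?_
    exact (Polynomial.natDegree_C_mul_X_pow_le _ _).trans (Nat.lt_succ_iff.1 p.2)
  · simp only [hc, Polynomial.eval_finsetSum, Polynomial.eval_mul, Polynomial.eval_C,
      Polynomial.eval_pow, Polynomial.eval_X, Finset.sum_mul]
    exact Finset.sum_congr rfl fun p _ => Finset.sum_congr rfl fun q _ => by ring

end IsTensorPoly

/-- Inverse inequalities in time for vector-valued tensor-product polynomials. -/
theorem exists_time_inverse_inequality (k : ℕ) :
    ∃ C > 0, ∀ u : ℝ × ℝ → Fin 3 → ℝ, (∀ j, IsTensorPoly k fun z => u z j) →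
      ∀ y a b : ℝ, a < b →
      (b - a) * (u (a, y) ⬝ᵥ u (a, y)) ≤ C * ∫ t in Set.Ioo a b, u (t, y) ⬝ᵥ u (t, y) ∧
      (b - a) ^ 2 * ∫ t in Set.Ioo a b, timeDeriv u (t, y) ⬝ᵥ timeDeriv u (t, y) ≤
        C * ∫ t in Set.Ioo a b, u (t, y) ⬝ᵥ u (t, y) := by
  obtain ⟨C, hC, h⟩ := exists_inverse_inequality k
  refine ⟨C, hC, fun u hu y a b hab => ?_⟩
  choose P hPd hP using fun j => (hu j).exists_time_polynomial y
  have hus : ContDiff ℝ ∞ u := contDiff_pi.2 fun j => (hu j).contDiff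
  have hd : ∀ t j, timeDeriv u (t, y) j = (P j).derivative.eval t := by
    intro t j
    refine (hasDerivAt_time_apply hus t y j).unique ?_
    simp only [hP]
    exact (P j).hasDerivAt t
  have e1 : ∫ t in Set.Ioo a b, u (t, y) ⬝ᵥ u (t, y) =
      ∑ j, ∫ t in Set.Ioo a b, (P j).eval t ^ 2 := by
    rw [setIntegral_dotProduct_eq_sum (u := fun t => u (t, y)) (v := fun t => u (t, y))]
    · simp only [hP, sq]
    · intro j
      simp only [hP]
      exact Continuous.integrableOn_Ioo' (by fun_prop) _ _
  have e2 : ∫ t in Set.Ioo a b, timeDeriv u (t, y) ⬝ᵥ timeDeriv u (t, y) =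
      ∑ j, ∫ t in Set.Ioo a b, (P j).derivative.eval t ^ 2 := by
    rw [setIntegral_dotProduct_eq_sum (u := fun t => timeDeriv u (t, y))
      (v := fun t => timeDeriv u (t, y))]
    · simp only [hd, sq]
    · intro j
      simp only [hd]
      exact Continuous.integrableOn_Ioo' (by fun_prop) _ _
  rw [e1, e2]
  simp only [dotProduct, Finset.mul_sum]
  constructor
  · refine Finset.sum_le_sum fun j _ => ?_
    have := (h (P j) (hPd j) a b hab).1
    simpa only [hP, sq] using this
  · refine Finset.sum_le_sum fun j _ => ?_
    simpa only [sq] using (h (P j) (hPd j) a b hab).2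

/-! Partitions. -/

theorem Ioo_succ_ae_eq_union {x : ℕ → ℝ} {n : ℕ} (hx : ∀ i < n + 1, x i < x (i + 1)) :
    (Set.Ioo (x 0) (x (n + 1)) : Set ℝ) =ᵐ[volume]
      (Set.Ioo (x 0) (x n) ∪ Set.Ioo (x n) (x (n + 1)) : Set ℝ) := by
  have h0 : ∀ m ≤ n, x 0 ≤ x m := by
    intro m hm
    induction m with
    | zero => exact le_rfl
    | succ m ihm => exact (ihm (by omega)).trans (hx m (by omega)).le
  rw [← Set.Ioc_union_Ioo_eq_Ioo (h0 n le_rfl) (hx n (by omega))]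
  exact (Ioo_ae_eq_Ioc.symm).union (Filter.EventuallyEq.refl _ _)

/-- As an identity of measures, this gives at once that integrability over the whole follows from
integrability over the pieces and that the integral splits. -/
theorem restrict_prod_Ioo_eq_sum {x : ℕ → ℝ} {n : ℕ} (hx : ∀ i < n, x i < x (i + 1))
    {A : Set ℝ} (hA : MeasurableSet A) :
    (volume : Measure (ℝ × ℝ)).restrict (A ×ˢ Set.Ioo (x 0) (x n)) =
      ∑ i ∈ Finset.range n, volume.restrict (A ×ˢ Set.Ioo (x i) (x (i + 1))) := by
  induction n with
  | zero => simp
  | succ n ih =>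
    rw [Finset.sum_range_succ, ← ih fun i hi => hx i (by omega)]
    have hae := Measure.set_prod_ae_eq (μ := volume) (ν := volume) (Filter.EventuallyEq.refl _ A)
      (Ioo_succ_ae_eq_union hx)
    rw [Set.prod_union, ← Measure.volume_eq_prod] at hae
    rw [Measure.restrict_congr_set hae, Measure.restrict_union _ (hA.prod measurableSet_Ioo)]
    rw [Set.disjoint_left]
    rintro z ⟨_, hz⟩ ⟨_, hz'⟩
    exact lt_asymm hz.2 hz'.1

theorem restrict_Ioo_prod_eq_sum {x : ℕ → ℝ} {n : ℕ} (hx : ∀ i < n, x i < x (i + 1))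
    {A : Set ℝ} (hA : MeasurableSet A) :
    (volume : Measure (ℝ × ℝ)).restrict (Set.Ioo (x 0) (x n) ×ˢ A) =
      ∑ i ∈ Finset.range n, volume.restrict (Set.Ioo (x i) (x (i + 1)) ×ˢ A) := by
  induction n with
  | zero => simp
  | succ n ih =>
    rw [Finset.sum_range_succ, ← ih fun i hi => hx i (by omega)]
    have hae := Measure.set_prod_ae_eq (μ := volume) (ν := volume) (Ioo_succ_ae_eq_union hx)
      (Filter.EventuallyEq.refl _ A)
    rw [Set.union_prod, ← Measure.volume_eq_prod] at hae
    rw [Measure.restrict_congr_set hae, Measure.restrict_union _ (measurableSet_Ioo.prod hA)]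
    rw [Set.disjoint_left]
    rintro z ⟨hz, _⟩ ⟨hz', _⟩
    exact lt_asymm hz.2 hz'.1

theorem restrict_Ioo_eq_sum {x : ℕ → ℝ} {n : ℕ} (hx : ∀ i < n, x i < x (i + 1)) :
    (volume : Measure ℝ).restrict (Set.Ioo (x 0) (x n)) =
      ∑ i ∈ Finset.range n, volume.restrict (Set.Ioo (x i) (x (i + 1))) := by
  induction n with
  | zero => simp
  | succ n ih =>
    rw [Finset.sum_range_succ, ← ih fun i hi => hx i (by omega),
      Measure.restrict_congr_set (Ioo_succ_ae_eq_union hx),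
      Measure.restrict_union _ measurableSet_Ioo]
    rw [Set.disjoint_left]
    intro z hz hz'
    exact lt_asymm hz.2 hz'.1

/-! ### The mesh: elements, cells and polynomial pieces. -/

namespace SpaceTimeMesh

variable {T xL xR : ℝ} (𝒯 : SpaceTimeMesh T xL xR)

/-- The length of the `m`-th time step. -/
def dt (m : ℕ) : ℝ := 𝒯.t (m + 1) - 𝒯.t m

/-- The length of the `i`-th space interval. -/
def dx (i : ℕ) : ℝ := 𝒯.x (i + 1) - 𝒯.x i

/-- The open element over the `m`-th time and the `i`-th space interval. -/
def elem (m i : ℕ) : Set (ℝ × ℝ) :=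
  Set.Ioo (𝒯.t m) (𝒯.t (m + 1)) ×ˢ Set.Ioo (𝒯.x i) (𝒯.x (i + 1))

/-- The `i`-th open space interval. -/
def cell (i : ℕ) : Set ℝ := Set.Ioo (𝒯.x i) (𝒯.x (i + 1))

theorem dt_pos {m : ℕ} (hm : m < 𝒯.M) : 0 < 𝒯.dt m := sub_pos.2 (𝒯.t_lt m hm)

theorem dx_pos {i : ℕ} (hi : i < 𝒯.N) : 0 < 𝒯.dx i := sub_pos.2 (𝒯.x_lt i hi)

theorem M_pos (hT : 0 < T) : 0 < 𝒯.M := by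
  rcases Nat.eq_zero_or_pos 𝒯.M with h | h
  · have := 𝒯.t_last
    rw [h, 𝒯.t_zero] at this
    exact absurd this hT.ne
  · exact h

theorem N_pos (hx : xL < xR) : 0 < 𝒯.N := by
  rcases Nat.eq_zero_or_pos 𝒯.N with h | h
  · have := 𝒯.x_last
    rw [h, 𝒯.x_zero] at this
    exact absurd this hx.ne
  · exact h

theorem t_mono {m n : ℕ} (hmn : m ≤ n) (hn : n ≤ 𝒯.M) : 𝒯.t m ≤ 𝒯.t n := by
  induction n, hmn using Nat.le_induction with
  | base => exact le_rfl
  | succ n _ ih => exact (ih (by omega)).trans (𝒯.t_lt n (by omega)).le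

theorem x_mono {m n : ℕ} (hmn : m ≤ n) (hn : n ≤ 𝒯.N) : 𝒯.x m ≤ 𝒯.x n := by
  induction n, hmn using Nat.le_induction with
  | base => exact le_rfl
  | succ n _ ih => exact (ih (by omega)).trans (𝒯.x_lt n (by omega)).le

theorem t_nonneg {m : ℕ} (hm : m ≤ 𝒯.M) : 0 ≤ 𝒯.t m := by
  rw [← 𝒯.t_zero]; exact 𝒯.t_mono (Nat.zero_le m) hm

theorem t_le {m : ℕ} (hm : m ≤ 𝒯.M) : 𝒯.t m ≤ T := by
  conv_rhs => rw [← 𝒯.t_last]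
  exact 𝒯.t_mono hm le_rfl

theorem le_x {i : ℕ} (hi : i ≤ 𝒯.N) : xL ≤ 𝒯.x i := by
  conv_lhs => rw [← 𝒯.x_zero]
  exact 𝒯.x_mono (Nat.zero_le i) hi

theorem x_le {i : ℕ} (hi : i ≤ 𝒯.N) : 𝒯.x i ≤ xR := by
  conv_rhs => rw [← 𝒯.x_last]
  exact 𝒯.x_mono hi le_rfl

theorem diam_le_h {m i : ℕ} (hm : m < 𝒯.M) (hi : i < 𝒯.N) :
    Real.sqrt (𝒯.dt m ^ 2 + 𝒯.dx i ^ 2) ≤ 𝒯.h := by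
  refine le_trans ?_ (le_ciSup (Set.finite_range _).bddAbove (⟨m, hm⟩ : Fin 𝒯.M))
  exact le_ciSup (f := fun j : Fin 𝒯.N =>
    Real.sqrt ((𝒯.t (m + 1) - 𝒯.t m) ^ 2 + (𝒯.x (j + 1) - 𝒯.x j) ^ 2))
    (Set.finite_range _).bddAbove ⟨i, hi⟩

theorem dt_le_h (hx : xL < xR) {m : ℕ} (hm : m < 𝒯.M) : 𝒯.dt m ≤ 𝒯.h :=
  (Real.le_sqrt_of_sq_le (by nlinarith [sq_nonneg (𝒯.dx 0)])).trans
    (𝒯.diam_le_h hm (𝒯.N_pos hx))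

theorem dx_le_h (hT : 0 < T) {i : ℕ} (hi : i < 𝒯.N) : 𝒯.dx i ≤ 𝒯.h :=
  (Real.le_sqrt_of_sq_le (by nlinarith [sq_nonneg (𝒯.dt 0)])).trans
    (𝒯.diam_le_h (𝒯.M_pos hT) hi)

theorem h_pos (hT : 0 < T) (hx : xL < xR) : 0 < 𝒯.h :=
  (𝒯.dt_pos (𝒯.M_pos hT)).trans_le (𝒯.dt_le_h hx (𝒯.M_pos hT))

theorem sum_dt : ∑ m ∈ Finset.range 𝒯.M, 𝒯.dt m = T := by
  simp only [dt]
  rw [Finset.sum_range_sub, 𝒯.t_last, 𝒯.t_zero, sub_zero]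

theorem M_mul_h_le {σ : ℝ} (hσ : 𝒯.TimeStepsComparable σ) : 𝒯.M * (σ * 𝒯.h) ≤ T := by
  calc 𝒯.M * (σ * 𝒯.h) = ∑ _m ∈ Finset.range 𝒯.M, σ * 𝒯.h := by simp
    _ ≤ ∑ m ∈ Finset.range 𝒯.M, 𝒯.dt m :=
        Finset.sum_le_sum fun m hm => hσ m (Finset.mem_range.1 hm)
    _ = T := 𝒯.sum_dt

theorem restrict_slab (m : ℕ) :
    (volume : Measure (ℝ × ℝ)).restrict (𝒯.slab m) =
      ∑ i ∈ Finset.range 𝒯.N, volume.restrict (𝒯.elem m i) := by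
  have h1 : (𝒯.slab m : Set (ℝ × ℝ)) =ᵐ[volume]
      (Set.Ioo (𝒯.t m) (𝒯.t (m + 1)) ×ˢ Set.Ioo (𝒯.x 0) (𝒯.x 𝒯.N) : Set (ℝ × ℝ)) := by
    rw [𝒯.x_zero, 𝒯.x_last]
    exact Measure.set_prod_ae_eq Ioo_ae_eq_Ioc.symm (Filter.EventuallyEq.refl _ _)
  rw [Measure.restrict_congr_set h1, restrict_prod_Ioo_eq_sum 𝒯.x_lt measurableSet_Ioo]
  rfl

theorem restrict_domain :
    (volume : Measure (ℝ × ℝ)).restrict (spaceTimeDomain T xL xR) =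
      ∑ m ∈ Finset.range 𝒯.M, volume.restrict (𝒯.slab m) := by
  have h1 : spaceTimeDomain T xL xR = Set.Ioo (𝒯.t 0) (𝒯.t 𝒯.M) ×ˢ Set.Ioo xL xR := by
    rw [𝒯.t_zero, 𝒯.t_last]; rfl
  rw [h1, restrict_Ioo_prod_eq_sum 𝒯.t_lt measurableSet_Ioo]
  refine Finset.sum_congr rfl fun m _ => ?_
  refine Measure.restrict_congr_set ?_
  exact Measure.set_prod_ae_eq Ioo_ae_eq_Ioc (Filter.EventuallyEq.refl _ _)

theorem restrict_space :
    (volume : Measure ℝ).restrict (Set.Ioo xL xR) =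
      ∑ i ∈ Finset.range 𝒯.N, volume.restrict (𝒯.cell i) := by
  have h1 : Set.Ioo xL xR = Set.Ioo (𝒯.x 0) (𝒯.x 𝒯.N) := by rw [𝒯.x_zero, 𝒯.x_last]
  rw [h1, restrict_Ioo_eq_sum 𝒯.x_lt]
  rfl

theorem setIntegral_slab {m : ℕ} {F : ℝ × ℝ → ℝ}
    (hF : ∀ i < 𝒯.N, IntegrableOn F (𝒯.elem m i)) :
    ∫ z in 𝒯.slab m, F z = ∑ i ∈ Finset.range 𝒯.N, ∫ z in 𝒯.elem m i, F z := by
  rw [𝒯.restrict_slab, integral_finsetSum_measure]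
  exact fun i hi => hF i (Finset.mem_range.1 hi)

theorem setIntegral_space {f : ℝ → ℝ} (hf : ∀ i < 𝒯.N, IntegrableOn f (𝒯.cell i)) :
    ∫ y in Set.Ioo xL xR, f y = ∑ i ∈ Finset.range 𝒯.N, ∫ y in 𝒯.cell i, f y := by
  rw [𝒯.restrict_space, integral_finsetSum_measure]
  exact fun i hi => hf i (Finset.mem_range.1 hi)

theorem integrableOn_slab {m : ℕ} {F : ℝ × ℝ → ℝ}
    (hF : ∀ i < 𝒯.N, IntegrableOn F (𝒯.elem m i)) : IntegrableOn F (𝒯.slab m) := by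
  rw [IntegrableOn, 𝒯.restrict_slab, integrable_finsetSum_measure]
  exact fun i hi => hF i (Finset.mem_range.1 hi)

theorem setIntegral_domain {F : ℝ × ℝ → ℝ} (hF : ∀ m < 𝒯.M, IntegrableOn F (𝒯.slab m)) :
    ∫ z in spaceTimeDomain T xL xR, F z = ∑ m ∈ Finset.range 𝒯.M, ∫ z in 𝒯.slab m, F z := by
  rw [𝒯.restrict_domain, integral_finsetSum_measure]
  exact fun i hi => hF i (Finset.mem_range.1 hi)

theorem elem_subset_slab {m i : ℕ} (hi : i < 𝒯.N) : 𝒯.elem m i ⊆ 𝒯.slab m :=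
  Set.prod_mono Set.Ioo_subset_Ioc_self
    (Set.Ioo_subset_Ioo (𝒯.le_x hi.le) (𝒯.x_le hi))

theorem elem_subset_domain {m i : ℕ} (hm : m < 𝒯.M) (hi : i < 𝒯.N) :
    𝒯.elem m i ⊆ spaceTimeDomain T xL xR :=
  Set.prod_mono (Set.Ioo_subset_Ioo (𝒯.t_nonneg hm.le) (𝒯.t_le hm))
    (Set.Ioo_subset_Ioo (𝒯.le_x hi.le) (𝒯.x_le hi))

theorem cell_subset {i : ℕ} (hi : i < 𝒯.N) : 𝒯.cell i ⊆ Set.Ioo xL xR :=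
  Set.Ioo_subset_Ioo (𝒯.le_x hi.le) (𝒯.x_le hi)

theorem measurableSet_elem (m i : ℕ) : MeasurableSet (𝒯.elem m i) :=
  measurableSet_Ioo.prod measurableSet_Ioo

theorem measurableSet_cell (i : ℕ) : MeasurableSet (𝒯.cell i) := measurableSet_Ioo

theorem glue_eq {n : ℕ} (w : ℕ → ℝ × ℝ → Fin n → ℝ) {m : ℕ} (hm : m < 𝒯.M) {z : ℝ × ℝ}
    (hz : z ∈ 𝒯.slab m) : 𝒯.glue w z = w m z := by
  unfold glue
  rw [Finset.sum_eq_single m, Set.indicator_of_mem hz]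
  · intro l hl hlm
    refine Set.indicator_of_notMem (fun hz' => ?_) _
    have hl' := Finset.mem_range.1 hl
    rcases lt_or_gt_of_ne hlm with h | h
    · exact absurd ((hz'.1.2).trans (𝒯.t_mono (by omega : l + 1 ≤ m) hm.le)) (not_le.2 hz.1.1)
    · exact absurd ((hz.1.2).trans (𝒯.t_mono (by omega : m + 1 ≤ l) hl'.le)) (not_le.2 hz'.1.1)
  · intro h
    exact absurd (Finset.mem_range.2 hm) h

/-- Smooth representatives on the elements of a finite element function. -/
structure IsPieces (k : ℕ) (g : ℕ → ℝ × ℝ → Fin 3 → ℝ) (p : ℕ → ℕ → ℝ × ℝ → Fin 3 → ℝ) :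
    Prop where
  tensor : ∀ m < 𝒯.M, ∀ i < 𝒯.N, ∀ j, IsTensorPoly k fun z => p m i z j
  eq : ∀ m < 𝒯.M, ∀ i < 𝒯.N, ∀ z ∈ Set.Icc (𝒯.t m) (𝒯.t (m + 1)) ×ˢ
    Set.Icc (𝒯.x i) (𝒯.x (i + 1)), g m z = p m i z
  left : ∀ m < 𝒯.M, ∀ s ∈ Set.Icc (𝒯.t m) (𝒯.t (m + 1)), g m (s, xL) = 0
  right : ∀ m < 𝒯.M, ∀ s ∈ Set.Icc (𝒯.t m) (𝒯.t (m + 1)), g m (s, xR) = 0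

/-- The polynomial of each element is extended to the whole plane, so that calculus on an element
concerns globally smooth functions. The zero function is a default for indices outside the mesh. -/
theorem IsFiniteElement.exists_pieces {k : ℕ} {g : ℕ → ℝ × ℝ → Fin 3 → ℝ}
    (hg : 𝒯.IsFiniteElement k g) : ∃ p, 𝒯.IsPieces k g p := by
  have h : ∀ m i, ∃ q : ℝ × ℝ → Fin 3 → ℝ, m < 𝒯.M → i < 𝒯.N →
      (∀ j, IsTensorPoly k fun z => q z j) ∧ ∀ z ∈ Set.Icc (𝒯.t m) (𝒯.t (m + 1)) ×ˢ
        Set.Icc (𝒯.x i) (𝒯.x (i + 1)), g m z = q z := by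
    intro m i
    by_cases hm : m < 𝒯.M
    · by_cases hi : i < 𝒯.N
      · choose c hc using fun j => (hg m hm).1 i hi j
        refine ⟨fun z j => ∑ p, ∑ q, c j p q * z.1 ^ (p : ℕ) * z.2 ^ (q : ℕ), fun _ _ =>
          ⟨fun j => ⟨c j, fun z => rfl⟩, fun z hz => funext fun j => hc j z hz⟩⟩
      · exact ⟨0, fun _ h => absurd h hi⟩
    · exact ⟨0, fun h => absurd h hm⟩
  choose p hp using h
  exact ⟨p, fun m hm i hi => (hp m i hm hi).1, fun m hm i hi => (hp m i hm hi).2,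
    fun m hm s hs => ((hg m hm).2 s hs).1, fun m hm s hs => ((hg m hm).2 s hs).2⟩

namespace IsPieces

variable {𝒯} {k : ℕ} {g : ℕ → ℝ × ℝ → Fin 3 → ℝ} {p : ℕ → ℕ → ℝ × ℝ → Fin 3 → ℝ}

theorem isFiniteElement (h : 𝒯.IsPieces k g p) : 𝒯.IsFiniteElement k g := by
  intro m hm
  refine ⟨fun i hi j => ?_, fun s hs => ⟨h.left m hm s hs, h.right m hm s hs⟩⟩
  obtain ⟨c, hc⟩ := h.tensor m hm i hi j
  exact ⟨c, fun z hz => by rw [h.eq m hm i hi z hz]; exact hc z⟩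

theorem contDiff (h : 𝒯.IsPieces k g p) {m i : ℕ} (hm : m < 𝒯.M) (hi : i < 𝒯.N) :
    ContDiff ℝ ∞ (p m i) :=
  contDiff_pi.2 fun j => (h.tensor m hm i hi j).contDiff

theorem eq_of_mem_elem (h : 𝒯.IsPieces k g p) {m i : ℕ} (hm : m < 𝒯.M) (hi : i < 𝒯.N)
    {z : ℝ × ℝ} (hz : z ∈ 𝒯.elem m i) : g m z = p m i z :=
  h.eq m hm i hi z ⟨Set.Ioo_subset_Icc_self hz.1, Set.Ioo_subset_Icc_self hz.2⟩

theorem eventuallyEq (h : 𝒯.IsPieces k g p) {m i : ℕ} (hm : m < 𝒯.M) (hi : i < 𝒯.N)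
    {z : ℝ × ℝ} (hz : z ∈ 𝒯.elem m i) : g m =ᶠ[nhds z] p m i := by
  filter_upwards [(isOpen_Ioo.prod isOpen_Ioo).mem_nhds hz] with w hw
  exact h.eq_of_mem_elem hm hi hw

theorem maxwellOp_eq (h : 𝒯.IsPieces k g p) {m i : ℕ} (hm : m < 𝒯.M) (hi : i < 𝒯.N)
    {z : ℝ × ℝ} (hz : z ∈ 𝒯.elem m i) : maxwellOp (g m) z = maxwellOp (p m i) z := by
  have h1 : timeDeriv (g m) z = timeDeriv (p m i) z := by
    refine Filter.EventuallyEq.deriv_eq ?_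
    have hc : Filter.Tendsto (fun s : ℝ => (s, z.2)) (nhds z.1) (nhds z) :=
      Continuous.tendsto' (by fun_prop) _ _ rfl
    exact hc.eventually (h.eventuallyEq hm hi hz)
  have h2 : spaceDeriv (g m) z = spaceDeriv (p m i) z := by
    refine Filter.EventuallyEq.deriv_eq ?_
    have hc : Filter.Tendsto (fun s : ℝ => (z.1, s)) (nhds z.2) (nhds z) :=
      Continuous.tendsto' (by fun_prop) _ _ rfl
    exact hc.eventually (h.eventuallyEq hm hi hz)
  simp only [maxwellOp, h1, h2]

end IsPieces

end SpaceTimeMesh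

/-! Square-integrable vector functions. -/

theorem Continuous.memLp_restrict {α E : Type*} [TopologicalSpace α] [T2Space α]
    [MeasurableSpace α] [OpensMeasurableSpace α] [NormedAddCommGroup E]
    [SecondCountableTopologyEither α E]
    {μ : Measure α} [IsFiniteMeasureOnCompacts μ] {u : α → E} (hu : Continuous u) {K s : Set α}
    (hK : IsCompact K) (hs : MeasurableSet s) (hsK : s ⊆ K) {q : ℝ≥0∞} :
    MemLp u q (μ.restrict s) := by
  obtain ⟨C, hC⟩ := hK.exists_bound_of_continuousOn hu.continuousOn
  have : IsFiniteMeasure (μ.restrict s) :=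
    ⟨by rw [Measure.restrict_apply_univ]; exact (measure_mono hsK).trans_lt hK.measure_lt_top⟩
  refine MemLp.of_bound hu.aestronglyMeasurable C ?_
  filter_upwards [ae_restrict_mem hs] with z hz using hC z (hsK hz)

theorem MeasureTheory.MemLp.integrable_dotProduct {α : Type*} [MeasurableSpace α] {μ : Measure α} {n : ℕ}
    {u v : α → Fin n → ℝ} (hu : MemLp u 2 μ) (hv : MemLp v 2 μ) :
    Integrable (fun z => u z ⬝ᵥ v z) μ := by
  simp only [dotProduct]
  exact integrable_finsetSum _ fun i _ => (hu.eval i).integrable_mul (hv.eval i)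

/-! ### Discretizations, Galerkin orthogonality and the residual functional. -/

namespace SpaceTimeMesh

variable {T xL xR : ℝ} (𝒯 : SpaceTimeMesh T xL xR)

theorem memLp_elem {E : Type*} [NormedAddCommGroup E]
    {u : ℝ × ℝ → E} (hu : Continuous u) (m i : ℕ) :
    MemLp u 2 (volume.restrict (𝒯.elem m i)) :=
  hu.memLp_restrict (isCompact_Icc.prod isCompact_Icc) (𝒯.measurableSet_elem m i)
    (Set.prod_mono Set.Ioo_subset_Icc_self Set.Ioo_subset_Icc_self)

theorem memLp_cell {E : Type*} [NormedAddCommGroup E]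
    {u : ℝ → E} (hu : Continuous u) (i : ℕ) :
    MemLp u 2 (volume.restrict (𝒯.cell i)) :=
  hu.memLp_restrict isCompact_Icc measurableSet_Ioo Set.Ioo_subset_Icc_self

/-- The jump of `Wh` at the initial time of the slab `m`. -/
def jump (W₀ : ℝ → Fin 3 → ℝ) (Wh : ℕ → ℝ × ℝ → Fin 3 → ℝ) (m : ℕ) (y : ℝ) : Fin 3 → ℝ :=
  𝒯.traceAbove Wh m y - 𝒯.traceBelow W₀ Wh m y

/-- `Wh` is a streamline diffusion approximation for square-integrable data, with smooth
representatives `p` on the elements. -/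
structure IsDiscretization (k : ℕ) (δ : ℝ) (b : ℝ × ℝ → Fin 4 → ℝ) (W₀ : ℝ → Fin 3 → ℝ)
    (Wh : ℕ → ℝ × ℝ → Fin 3 → ℝ) (p : ℕ → ℕ → ℝ × ℝ → Fin 3 → ℝ) : Prop where
  memLp_b : MemLp b 2 (volume.restrict (spaceTimeDomain T xL xR))
  memLp_init : MemLp W₀ 2 (volume.restrict (Set.Ioo xL xR))
  solution : 𝒯.IsStreamlineDiffusionSolution k δ b W₀ Wh
  pieces : 𝒯.IsPieces k Wh p

variable {𝒯} {k : ℕ} {δ : ℝ} {b : ℝ × ℝ → Fin 4 → ℝ} {W₀ : ℝ → Fin 3 → ℝ}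
  {Wh : ℕ → ℝ × ℝ → Fin 3 → ℝ} {p : ℕ → ℕ → ℝ × ℝ → Fin 3 → ℝ}

theorem IsPieces.traceAbove_eq (h : 𝒯.IsPieces k Wh p) {m i : ℕ} (hm : m < 𝒯.M) (hi : i < 𝒯.N)
    {y : ℝ} (hy : y ∈ 𝒯.cell i) : 𝒯.traceAbove Wh m y = p m i (𝒯.t m, y) :=
  h.eq m hm i hi _ ⟨⟨le_rfl, (𝒯.t_lt m hm).le⟩, Set.Ioo_subset_Icc_self hy⟩

theorem IsPieces.traceBelow_eq (h : 𝒯.IsPieces k Wh p) (W₀ : ℝ → Fin 3 → ℝ) {m i : ℕ}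
    (hm : m < 𝒯.M) (hi : i < 𝒯.N) {y : ℝ} (hy : y ∈ 𝒯.cell i) :
    𝒯.traceBelow W₀ Wh (m + 1) y = p m i (𝒯.t (m + 1), y) :=
  h.eq m hm i hi _ ⟨⟨(𝒯.t_lt m hm).le, le_rfl⟩, Set.Ioo_subset_Icc_self hy⟩

namespace IsDiscretization

theorem memLp_b_elem (h : 𝒯.IsDiscretization k δ b W₀ Wh p) {m i : ℕ} (hm : m < 𝒯.M)
    (hi : i < 𝒯.N) : MemLp b 2 (volume.restrict (𝒯.elem m i)) :=
  h.memLp_b.mono_measure (Measure.restrict_mono (𝒯.elem_subset_domain hm hi) le_rfl)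

theorem memLp_residual (h : 𝒯.IsDiscretization k δ b W₀ Wh p) {m i : ℕ} (hm : m < 𝒯.M)
    (hi : i < 𝒯.N) :
    MemLp (fun z => b z - maxwellOp (p m i) z) 2 (volume.restrict (𝒯.elem m i)) :=
  (h.memLp_b_elem hm hi).sub
    (𝒯.memLp_elem (contDiff_maxwellOp (h.pieces.contDiff hm hi)).continuous m i)

theorem memLp_traceAbove (h : 𝒯.IsDiscretization k δ b W₀ Wh p) {m i : ℕ} (hm : m < 𝒯.M)
    (hi : i < 𝒯.N) : MemLp (𝒯.traceAbove Wh m) 2 (volume.restrict (𝒯.cell i)) := by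
  have hc := (h.pieces.contDiff hm hi).continuous
  refine (memLp_congr_ae ?_).1 (𝒯.memLp_cell (u := fun y => p m i (𝒯.t m, y)) (by fun_prop) i)
  filter_upwards [ae_restrict_mem measurableSet_Ioo] with y hy
  exact (h.pieces.traceAbove_eq hm hi hy).symm

theorem memLp_traceBelow (h : 𝒯.IsDiscretization k δ b W₀ Wh p) {m i : ℕ} (hm : m ≤ 𝒯.M)
    (hi : i < 𝒯.N) : MemLp (𝒯.traceBelow W₀ Wh m) 2 (volume.restrict (𝒯.cell i)) := by
  cases m with
  | zero => exact h.memLp_init.mono_measure (Measure.restrict_mono (𝒯.cell_subset hi) le_rfl)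
  | succ m =>
    have hc := (h.pieces.contDiff hm hi).continuous
    refine (memLp_congr_ae ?_).1
      (𝒯.memLp_cell (u := fun y => p m i (𝒯.t (m + 1), y)) (by fun_prop) i)
    filter_upwards [ae_restrict_mem measurableSet_Ioo] with y hy
    exact (h.pieces.traceBelow_eq W₀ hm hi hy).symm

theorem memLp_jump (h : 𝒯.IsDiscretization k δ b W₀ Wh p) {m i : ℕ} (hm : m < 𝒯.M)
    (hi : i < 𝒯.N) : MemLp (𝒯.jump W₀ Wh m) 2 (volume.restrict (𝒯.cell i)) :=
  (h.memLp_traceAbove hm hi).sub (h.memLp_traceBelow hm.le hi)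

/-- The Galerkin orthogonality, element by element. -/
theorem galerkin (h : 𝒯.IsDiscretization k δ b W₀ Wh p) {g : ℕ → ℝ × ℝ → Fin 3 → ℝ}
    {q : ℕ → ℕ → ℝ × ℝ → Fin 3 → ℝ} (hq : 𝒯.IsPieces k g q) {m : ℕ} (hm : m < 𝒯.M) :
    ∑ i ∈ Finset.range 𝒯.N, ∫ z in 𝒯.elem m i,
        (b z - maxwellOp (p m i) z) ⬝ᵥ (hatVec (q m i z) + δ • maxwellOp (q m i) z) =
      ∑ i ∈ Finset.range 𝒯.N, ∫ y in 𝒯.cell i, 𝒯.jump W₀ Wh m y ⬝ᵥ q m i (𝒯.t m, y) := by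
  have hsol := h.solution.2 m hm g hq.isFiniteElement
  have hp := h.pieces
  have hX : ∀ i < 𝒯.N, MemLp (fun z => hatVec (q m i z) + δ • maxwellOp (q m i) z) 2
      (volume.restrict (𝒯.elem m i)) := fun i hi => by
    have h1 := (contDiff_hatVec (hq.contDiff hm hi)).continuous
    have h2 := (contDiff_maxwellOp (hq.contDiff hm hi)).continuous
    exact 𝒯.memLp_elem (h1.add (h2.const_smul δ)) m i
  have hL : ∀ i < 𝒯.N, MemLp (maxwellOp (p m i)) 2 (volume.restrict (𝒯.elem m i)) :=
    fun i hi => 𝒯.memLp_elem (contDiff_maxwellOp (hp.contDiff hm hi)).continuous m i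
  have hY : ∀ i < 𝒯.N, MemLp (fun y => q m i (𝒯.t m, y)) 2 (volume.restrict (𝒯.cell i)) :=
    fun i hi => 𝒯.memLp_cell ((hq.contDiff hm hi).continuous.comp (by fun_prop)) i
  -- On the open elements a finite element function agrees with its piece together with the
  -- derivatives. What is left of the slab is a null set.
  have cE1 : ∀ i < 𝒯.N, Set.EqOn
      (fun z => maxwellOp (p m i) z ⬝ᵥ (hatVec (q m i z) + δ • maxwellOp (q m i) z))
      (fun z => maxwellOp (Wh m) z ⬝ᵥ (hatVec (g m z) + δ • maxwellOp (g m) z))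
      (𝒯.elem m i) := fun i hi z hz => by
    simp only [hp.maxwellOp_eq hm hi hz, hq.maxwellOp_eq hm hi hz, hq.eq_of_mem_elem hm hi hz]
  have cE2 : ∀ i < 𝒯.N, Set.EqOn
      (fun z => b z ⬝ᵥ (hatVec (q m i z) + δ • maxwellOp (q m i) z))
      (fun z => b z ⬝ᵥ (hatVec (g m z) + δ • maxwellOp (g m) z))
      (𝒯.elem m i) := fun i hi z hz => by
    simp only [hq.maxwellOp_eq hm hi hz, hq.eq_of_mem_elem hm hi hz]
  have cC1 : ∀ i < 𝒯.N, Set.EqOn (fun y => 𝒯.traceAbove Wh m y ⬝ᵥ q m i (𝒯.t m, y))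
      (fun y => 𝒯.traceAbove Wh m y ⬝ᵥ 𝒯.traceAbove g m y) (𝒯.cell i) := fun i hi y hy => by
    simp only [hq.traceAbove_eq hm hi hy]
  have cC2 : ∀ i < 𝒯.N, Set.EqOn (fun y => 𝒯.traceBelow W₀ Wh m y ⬝ᵥ q m i (𝒯.t m, y))
      (fun y => 𝒯.traceBelow W₀ Wh m y ⬝ᵥ 𝒯.traceAbove g m y) (𝒯.cell i) := fun i hi y hy => by
    simp only [hq.traceAbove_eq hm hi hy]
  have i1 := fun i hi => MemLp.integrable_dotProduct (hL i hi) (hX i hi)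
  have i2 := fun i hi => MemLp.integrable_dotProduct (h.memLp_b_elem hm hi) (hX i hi)
  have i3 := fun i hi => MemLp.integrable_dotProduct (h.memLp_traceAbove hm hi) (hY i hi)
  have i4 := fun i hi => MemLp.integrable_dotProduct (h.memLp_traceBelow hm.le hi) (hY i hi)
  rw [𝒯.setIntegral_slab fun i hi =>
      IntegrableOn.congr_fun (i1 i hi) (cE1 i hi) (𝒯.measurableSet_elem m i),
    𝒯.setIntegral_slab fun i hi =>
      IntegrableOn.congr_fun (i2 i hi) (cE2 i hi) (𝒯.measurableSet_elem m i),
    𝒯.setIntegral_space fun i hi =>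
      IntegrableOn.congr_fun (i3 i hi) (cC1 i hi) measurableSet_Ioo,
    𝒯.setIntegral_space fun i hi =>
      IntegrableOn.congr_fun (i4 i hi) (cC2 i hi) measurableSet_Ioo] at hsol
  have e1 : ∀ i ∈ Finset.range 𝒯.N, ∫ z in 𝒯.elem m i,
        (b z - maxwellOp (p m i) z) ⬝ᵥ (hatVec (q m i z) + δ • maxwellOp (q m i) z) =
      (∫ z in 𝒯.elem m i, b z ⬝ᵥ (hatVec (g m z) + δ • maxwellOp (g m) z)) -
        ∫ z in 𝒯.elem m i, maxwellOp (Wh m) z ⬝ᵥ (hatVec (g m z) + δ • maxwellOp (g m) z) := by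
    intro i hi
    have hi := Finset.mem_range.1 hi
    simp only [sub_dotProduct]
    rw [integral_sub (i2 i hi) (i1 i hi),
      setIntegral_congr_fun (𝒯.measurableSet_elem m i) (cE1 i hi),
      setIntegral_congr_fun (𝒯.measurableSet_elem m i) (cE2 i hi)]
  have e2 : ∀ i ∈ Finset.range 𝒯.N, ∫ y in 𝒯.cell i, 𝒯.jump W₀ Wh m y ⬝ᵥ q m i (𝒯.t m, y) =
      (∫ y in 𝒯.cell i, 𝒯.traceAbove Wh m y ⬝ᵥ 𝒯.traceAbove g m y) -
        ∫ y in 𝒯.cell i, 𝒯.traceBelow W₀ Wh m y ⬝ᵥ 𝒯.traceAbove g m y := by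
    intro i hi
    have hi := Finset.mem_range.1 hi
    simp only [jump, sub_dotProduct]
    rw [integral_sub (i3 i hi) (i4 i hi),
      setIntegral_congr_fun (𝒯.measurableSet_cell i) (cC1 i hi),
      setIntegral_congr_fun (𝒯.measurableSet_cell i) (cC2 i hi)]
  rw [Finset.sum_congr rfl e1, Finset.sum_congr rfl e2, Finset.sum_sub_distrib,
    Finset.sum_sub_distrib]
  linarith

end IsDiscretization

/-- The residual functional of a discretization. -/
noncomputable def errorFunctional (𝒯 : SpaceTimeMesh T xL xR) (b : ℝ × ℝ → Fin 4 → ℝ)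
    (W₀ : ℝ → Fin 3 → ℝ) (Wh : ℕ → ℝ × ℝ → Fin 3 → ℝ) (p : ℕ → ℕ → ℝ × ℝ → Fin 3 → ℝ)
    (v : ℝ × ℝ → Fin 3 → ℝ) : ℝ :=
  ∑ m ∈ Finset.range 𝒯.M, ∑ i ∈ Finset.range 𝒯.N,
    ((∫ z in 𝒯.elem m i, (b z - maxwellOp (p m i) z) ⬝ᵥ hatVec (v z)) -
      ∫ y in 𝒯.cell i, 𝒯.jump W₀ Wh m y ⬝ᵥ v (𝒯.t m, y))

/-- The lateral boundary terms of a finite element function cancel. -/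
theorem IsPieces.sum_lateral_eq_zero (h : 𝒯.IsPieces k Wh p) (v : ℝ × ℝ → Fin 3 → ℝ) {m : ℕ}
    (hm : m < 𝒯.M) (hp : ∀ i < 𝒯.N, ∀ y, IntegrableOn
      (fun t => p m i (t, y) ⬝ᵥ v (t, y)) (Set.Ioo (𝒯.t m) (𝒯.t (m + 1)))) :
    ∑ i ∈ Finset.range 𝒯.N, ∫ t in Set.Ioo (𝒯.t m) (𝒯.t (m + 1)),
      (p m i (t, 𝒯.x (i + 1)) ⬝ᵥ v (t, 𝒯.x (i + 1)) - p m i (t, 𝒯.x i) ⬝ᵥ v (t, 𝒯.x i)) = 0 := by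
  -- The flux through `x = xᵢ`, computed from `Wh` itself: both neighbouring pieces have this trace,
  -- so the sum over the cells telescopes to the two outer fluxes, where `Wh = 0`.
  set a : ℕ → ℝ := fun i => ∫ t in Set.Ioo (𝒯.t m) (𝒯.t (m + 1)),
    Wh m (t, 𝒯.x i) ⬝ᵥ v (t, 𝒯.x i) with ha
  have h1 : ∀ i ∈ Finset.range 𝒯.N, ∫ t in Set.Ioo (𝒯.t m) (𝒯.t (m + 1)),
      (p m i (t, 𝒯.x (i + 1)) ⬝ᵥ v (t, 𝒯.x (i + 1)) - p m i (t, 𝒯.x i) ⬝ᵥ v (t, 𝒯.x i)) =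
        a (i + 1) - a i := by
    intro i hi
    have hi := Finset.mem_range.1 hi
    rw [integral_sub (hp i hi _) (hp i hi _)]
    have hx := (𝒯.x_lt i hi).le
    congr 1 <;> refine setIntegral_congr_fun measurableSet_Ioo fun t ht => ?_
    · simp only [h.eq m hm i hi (t, 𝒯.x (i + 1)) ⟨Set.Ioo_subset_Icc_self ht, hx, le_rfl⟩]
    · simp only [h.eq m hm i hi (t, 𝒯.x i) ⟨Set.Ioo_subset_Icc_self ht, le_rfl, hx⟩]
  rw [Finset.sum_congr rfl h1, Finset.sum_range_sub]
  have hN : a 𝒯.N = 0 := by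
    simp only [ha, 𝒯.x_last]
    rw [setIntegral_congr_fun (g := fun _ => 0) measurableSet_Ioo fun t ht => ?_]
    · simp
    · simp only [h.right m hm t (Set.Ioo_subset_Icc_self ht), zero_dotProduct]
  have h0 : a 0 = 0 := by
    simp only [ha, 𝒯.x_zero]
    rw [setIntegral_congr_fun (g := fun _ => 0) measurableSet_Ioo fun t ht => ?_]
    · simp
    · simp only [h.left m hm t (Set.Ioo_subset_Icc_self ht), zero_dotProduct]
  rw [hN, h0, sub_zero]

/-- The pairing of the discrete solution with the right-hand side of the dual problem. -/
theorem IsDiscretization.sum_pairing_eq (h : 𝒯.IsDiscretization k δ b W₀ Wh p) {s B : ℝ}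
    (hs : s = 1 ∨ s = -1) {ψ v : ℝ × ℝ → Fin 3 → ℝ} (hv : IsDualField T xL xR s B ψ v) :
    ∑ m ∈ Finset.range 𝒯.M, ∑ i ∈ Finset.range 𝒯.N,
        ∫ z in 𝒯.elem m i, p m i z ⬝ᵥ chProj s (ψ z) =
      (∑ m ∈ Finset.range 𝒯.M, ∑ i ∈ Finset.range 𝒯.N,
        ∫ z in 𝒯.elem m i, b z ⬝ᵥ hatVec (v z)) + (∫ y in Set.Ioo xL xR, W₀ y ⬝ᵥ v (0, y)) -
        𝒯.errorFunctional b W₀ Wh p v := by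
  have hvc := hv.contDiff.continuous
  have hvy : ∀ t, Continuous fun y => v (t, y) := fun t => hvc.comp (by fun_prop)
  -- The jump replaces the trace from above at `tₘ` by the trace from below, and only then do the
  -- time boundary terms of consecutive slabs telescope.
  set c : ℕ → ℝ := fun m => ∑ i ∈ Finset.range 𝒯.N,
    ∫ y in 𝒯.cell i, 𝒯.traceBelow W₀ Wh m y ⬝ᵥ v (𝒯.t m, y) with hc
  have key : ∀ m ∈ Finset.range 𝒯.M, ∑ i ∈ Finset.range 𝒯.N,
        ∫ z in 𝒯.elem m i, p m i z ⬝ᵥ chProj s (ψ z) =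
      (∑ i ∈ Finset.range 𝒯.N, ∫ z in 𝒯.elem m i, b z ⬝ᵥ hatVec (v z)) -
      (∑ i ∈ Finset.range 𝒯.N,
        ((∫ z in 𝒯.elem m i, (b z - maxwellOp (p m i) z) ⬝ᵥ hatVec (v z)) -
          ∫ y in 𝒯.cell i, 𝒯.jump W₀ Wh m y ⬝ᵥ v (𝒯.t m, y))) - (c (m + 1) - c m) := by
    intro m hm
    have hm := Finset.mem_range.1 hm
    have hlat := h.pieces.sum_lateral_eq_zero v hm fun i hi y =>
      Continuous.integrableOn_Ioo' (continuous_dotProduct'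
        ((h.pieces.contDiff hm hi).continuous.comp (by fun_prop)) (hvc.comp (by fun_prop))) _ _
    have hel : ∀ i ∈ Finset.range 𝒯.N, ∫ z in 𝒯.elem m i, p m i z ⬝ᵥ chProj s (ψ z) =
        (∫ z in 𝒯.elem m i, b z ⬝ᵥ hatVec (v z)) -
        ((∫ z in 𝒯.elem m i, (b z - maxwellOp (p m i) z) ⬝ᵥ hatVec (v z)) -
          ∫ y in 𝒯.cell i, 𝒯.jump W₀ Wh m y ⬝ᵥ v (𝒯.t m, y)) -
        ((∫ y in 𝒯.cell i, 𝒯.traceBelow W₀ Wh (m + 1) y ⬝ᵥ v (𝒯.t (m + 1), y)) -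
          ∫ y in 𝒯.cell i, 𝒯.traceBelow W₀ Wh m y ⬝ᵥ v (𝒯.t m, y)) -
        s * ∫ t in Set.Ioo (𝒯.t m) (𝒯.t (m + 1)),
          (p m i (t, 𝒯.x (i + 1)) ⬝ᵥ v (t, 𝒯.x (i + 1)) - p m i (t, 𝒯.x i) ⬝ᵥ v (t, 𝒯.x i)) := by
      intro i hi
      have hi := Finset.mem_range.1 hi
      have hps := h.pieces.contDiff hm hi
      have hpc := hps.continuous
      have green := setIntegral_maxwellOp_green hs hps hv.contDiff hv.chProj_eq
        (𝒯.t_lt m hm).le (𝒯.x_lt i hi).le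
      have mL := 𝒯.memLp_elem (contDiff_maxwellOp hps).continuous m i
      have mv := 𝒯.memLp_elem (continuous_hatVec hvc) m i
      have mp := 𝒯.memLp_elem hpc m i
      have mψ : MemLp (fun z => chProj s (ψ z)) 2 (volume.restrict (𝒯.elem m i)) := by
        have e : (fun z => chProj s (ψ z)) = fun z => -(timeDeriv v z + s • spaceDeriv v z) := by
          ext1 z; rw [hv.transport z, neg_neg]
        rw [e]
        exact 𝒯.memLp_elem ((contDiff_timeDeriv hv.contDiff).continuous.add
          ((contDiff_spaceDeriv hv.contDiff).continuous.const_smul s)).neg m i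
      -- Green's formula becomes a statement about `P_s ψ` through the transport equation of the
      -- dual field.
      simp only [hv.transport, dotProduct_neg, ← sub_eq_add_neg] at green
      have e1 : ∫ z in 𝒯.elem m i, (maxwellOp (p m i) z ⬝ᵥ hatVec (v z) -
          p m i z ⬝ᵥ chProj s (ψ z)) = (∫ z in 𝒯.elem m i, maxwellOp (p m i) z ⬝ᵥ hatVec (v z)) -
          ∫ z in 𝒯.elem m i, p m i z ⬝ᵥ chProj s (ψ z) :=
        integral_sub (MemLp.integrable_dotProduct mL mv) (MemLp.integrable_dotProduct mp mψ)
      have e2 : ∫ z in 𝒯.elem m i, (b z - maxwellOp (p m i) z) ⬝ᵥ hatVec (v z) =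
          (∫ z in 𝒯.elem m i, b z ⬝ᵥ hatVec (v z)) -
            ∫ z in 𝒯.elem m i, maxwellOp (p m i) z ⬝ᵥ hatVec (v z) := by
        simp only [sub_dotProduct]
        exact integral_sub (MemLp.integrable_dotProduct (h.memLp_b_elem hm hi) mv)
          (MemLp.integrable_dotProduct mL mv)
      have mvy := fun t => 𝒯.memLp_cell (hvy t) i
      have e3 : ∫ y in 𝒯.cell i, 𝒯.jump W₀ Wh m y ⬝ᵥ v (𝒯.t m, y) =
          (∫ y in 𝒯.cell i, 𝒯.traceAbove Wh m y ⬝ᵥ v (𝒯.t m, y)) -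
            ∫ y in 𝒯.cell i, 𝒯.traceBelow W₀ Wh m y ⬝ᵥ v (𝒯.t m, y) := by
        simp only [jump, sub_dotProduct]
        exact integral_sub (MemLp.integrable_dotProduct (h.memLp_traceAbove hm hi) (mvy _))
          (MemLp.integrable_dotProduct (h.memLp_traceBelow hm.le hi) (mvy _))
      have e4 : ∫ y in 𝒯.cell i, (p m i (𝒯.t (m + 1), y) ⬝ᵥ v (𝒯.t (m + 1), y) -
          p m i (𝒯.t m, y) ⬝ᵥ v (𝒯.t m, y)) =
          (∫ y in 𝒯.cell i, 𝒯.traceBelow W₀ Wh (m + 1) y ⬝ᵥ v (𝒯.t (m + 1), y)) -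
            ∫ y in 𝒯.cell i, 𝒯.traceAbove Wh m y ⬝ᵥ v (𝒯.t m, y) := by
        rw [← integral_sub (MemLp.integrable_dotProduct (h.memLp_traceBelow hm hi) (mvy _))
          (MemLp.integrable_dotProduct (h.memLp_traceAbove hm hi) (mvy _))]
        refine setIntegral_congr_fun measurableSet_Ioo fun y hy => ?_
        simp only [h.pieces.traceAbove_eq hm hi hy, h.pieces.traceBelow_eq W₀ hm hi hy]
      change ∫ z in 𝒯.elem m i, (maxwellOp (p m i) z ⬝ᵥ hatVec (v z) -
          p m i z ⬝ᵥ chProj s (ψ z)) = (∫ y in 𝒯.cell i, _) + _ at green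
      rw [e1, e4] at green
      rw [e2, e3]
      linarith
    rw [Finset.sum_congr rfl hel]
    simp only [Finset.sum_sub_distrib, ← Finset.mul_sum, hc] at hlat ⊢
    rw [hlat]
    ring
  have hcM : c 𝒯.M = 0 := by
    obtain ⟨T', hT', hv0⟩ := hv.final
    simp only [hc, 𝒯.t_last]
    refine Finset.sum_eq_zero fun i _ => ?_
    simp [hv0 _ (show T' ≤ ((T, _) : ℝ × ℝ).1 from hT'.le)]
  have hc0 : c 0 = ∫ y in Set.Ioo xL xR, W₀ y ⬝ᵥ v (0, y) := by
    rw [𝒯.setIntegral_space fun i hi => ?_]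
    · simp only [hc, 𝒯.t_zero, traceBelow]
    · exact MemLp.integrable_dotProduct (h.memLp_traceBelow (Nat.zero_le _) hi)
        (𝒯.memLp_cell (hvy 0) i)
  rw [Finset.sum_congr rfl key, Finset.sum_sub_distrib, Finset.sum_sub_distrib,
    Finset.sum_range_sub, hcM, ← hc0]
  simp only [errorFunctional]
  ring

end SpaceTimeMesh

/-! ### The weak solution against dual fields, and the error representation. -/

theorem transpose_maxwellM₁_hatVec (a : Fin 3 → ℝ) : maxwellM₁ᵀ *ᵥ hatVec a = a := by
  ext i
  fin_cases i <;> simp [maxwellM₁, hatVec, Matrix.mulVec, dotProduct, Fin.sum_univ_succ]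

theorem transpose_maxwellM₂_hatVec {s : ℝ} (hs : s = 1 ∨ s = -1) (c : Fin 3 → ℝ)
    (hc : chProj s c = c) : maxwellM₂ᵀ *ᵥ hatVec c = s • c := by
  rw [← hc]
  ext i
  rcases hs with rfl | rfl <;> fin_cases i <;>
    simp [maxwellM₂, hatVec, chProj, Matrix.mulVec, dotProduct, Fin.sum_univ_succ] <;> ring

theorem maxwellM₁_mulVec_dotProduct_hatVec (a v : Fin 3 → ℝ) :
    (maxwellM₁ *ᵥ a) ⬝ᵥ hatVec v = a ⬝ᵥ v := by
  simp [maxwellM₁, hatVec, Matrix.mulVec, dotProduct, Fin.sum_univ_succ]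

theorem maxwellM₁_mulVec_eq (a : Fin 3 → ℝ) : maxwellM₁ *ᵥ a = ![0, a 0, a 1, a 2] := by
  ext i
  fin_cases i <;> simp [maxwellM₁, Matrix.mulVec, dotProduct, Fin.sum_univ_succ]

theorem timeDeriv_hatVec {u : ℝ × ℝ → Fin 3 → ℝ} (hu : ContDiff ℝ ∞ u) (z : ℝ × ℝ) :
    timeDeriv (fun z => hatVec (u z)) z = hatVec (timeDeriv u z) := by
  refine timeDeriv_eq_of_hasDerivAt fun i => ?_
  have h := fun i => hasDerivAt_time_apply hu z.1 z.2 i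
  fin_cases i <;> simp only [hatVec]
  · exact h 0
  · exact h 0
  · exact h 1
  · exact h 2

theorem spaceDeriv_hatVec {u : ℝ × ℝ → Fin 3 → ℝ} (hu : ContDiff ℝ ∞ u) (z : ℝ × ℝ) :
    spaceDeriv (fun z => hatVec (u z)) z = hatVec (spaceDeriv u z) := by
  refine spaceDeriv_eq_of_hasDerivAt fun i => ?_
  have h := fun i => hasDerivAt_space_apply hu z.1 z.2 i
  fin_cases i <;> simp only [hatVec]
  · exact h 0
  · exact h 0
  · exact h 1
  · exact h 2

theorem IsDualField.chProj_spaceDeriv {T xL xR s B : ℝ} {ψ v : ℝ × ℝ → Fin 3 → ℝ}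
    (hv : IsDualField T xL xR s B ψ v) (z : ℝ × ℝ) :
    chProj s (spaceDeriv v z) = spaceDeriv v z := by
  rw [← spaceDeriv_chProj s hv.contDiff, funext hv.chProj_eq]

theorem memLp_domain {E : Type*} [NormedAddCommGroup E] {T xL xR : ℝ}
    {u : ℝ × ℝ → E} (hu : Continuous u) :
    MemLp u 2 (volume.restrict (spaceTimeDomain T xL xR)) :=
  hu.memLp_restrict (isCompact_Icc.prod isCompact_Icc) (measurableSet_Ioo.prod measurableSet_Ioo)
    (Set.prod_mono Set.Ioo_subset_Icc_self Set.Ioo_subset_Icc_self)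

theorem isFiniteMeasure_domain (T xL xR : ℝ) :
    IsFiniteMeasure ((volume : Measure (ℝ × ℝ)).restrict (spaceTimeDomain T xL xR)) :=
  ⟨by
    rw [Measure.restrict_apply_univ]
    exact (measure_mono (Set.prod_mono Set.Ioo_subset_Icc_self Set.Ioo_subset_Icc_self)).trans_lt
      (isCompact_Icc.prod isCompact_Icc).measure_lt_top⟩

section

variable {T xL xR : ℝ} {K : Set ℝ} {b : ℝ × ℝ → Fin 4 → ℝ} {W₀ : ℝ → Fin 3 → ℝ}
  {W : ℝ × ℝ → Fin 3 → ℝ}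

/-- If a weak solution vanishes off `K`, then its data are orthogonal to the test functions
which are supported off `K`. -/
theorem IsWeakMaxwellSolution.data_orthogonal (hW : IsWeakMaxwellSolution T xL xR b W₀ W)
    (hWK : ∀ᵐ z ∂(volume.restrict (spaceTimeDomain T xL xR)), z.2 ∉ K → W z = 0)
    {Φ : ℝ × ℝ → Fin 4 → ℝ} (hΦ : ContDiff ℝ ∞ Φ) (hc : HasCompactSupport Φ)
    (hsupp : tsupport Φ ⊆ Set.Iio T ×ˢ (Set.Ioo xL xR \ K)) :
    (∫ z in spaceTimeDomain T xL xR, b z ⬝ᵥ Φ z) +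
      ∫ y in Set.Ioo xL xR, (maxwellM₁ *ᵥ W₀ y) ⬝ᵥ Φ (0, y) = 0 := by
  rw [← hW.2 Φ hΦ hc (hsupp.trans (Set.prod_mono le_rfl Set.sdiff_subset))]
  rw [integral_congr_ae (g := fun _ => 0) ?_, integral_zero]
  filter_upwards [hWK] with z hz
  by_cases hzK : z.2 ∈ K
  · have hz' : z ∉ tsupport Φ := fun h => (hsupp h).2.2 hzK
    rw [timeDeriv_eq hΦ, spaceDeriv_eq hΦ, fderiv_of_notMem_tsupport ℝ hz']
    simp
  · rw [hz hzK, zero_dotProduct]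

theorem dotProduct_single_smul {n : ℕ} (v : Fin n → ℝ) (i : Fin n) (a : ℝ) :
    (v ⬝ᵥ fun j => if j = i then a else 0) = a * v i := by
  simp [dotProduct, mul_comm]

/-- Test functions supported in `(0, T) × (Ωₓ \ K)` meet neither `W` nor the initial term. Taking
them with one nonzero component at a time, the fundamental lemma of the calculus of variations
applies to each component of `b`. -/
theorem IsWeakMaxwellSolution.source_ae_eq_zero (hK : IsCompact K)
    (hb : MemLp b 2 (volume.restrict (spaceTimeDomain T xL xR)))
    (hW : IsWeakMaxwellSolution T xL xR b W₀ W)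
    (hWK : ∀ᵐ z ∂(volume.restrict (spaceTimeDomain T xL xR)), z.2 ∉ K → W z = 0) :
    ∀ᵐ z ∂(volume.restrict (spaceTimeDomain T xL xR)), z.2 ∉ K → b z = 0 := by
  have := isFiniteMeasure_domain T xL xR
  have hU : IsOpen (Set.Ioo 0 T ×ˢ (Set.Ioo xL xR \ K)) :=
    isOpen_Ioo.prod (isOpen_Ioo.sdiff hK.isClosed)
  have key : ∀ i, ∀ᵐ z ∂(volume.restrict (spaceTimeDomain T xL xR)),
      z ∈ Set.Ioo 0 T ×ˢ (Set.Ioo xL xR \ K) → b z i = 0 := by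
    intro i
    refine hU.ae_eq_zero_of_integral_contDiff_smul_eq_zero
      (((hb.eval i).integrable (by norm_num)).locallyIntegrable.locallyIntegrableOn _)
      fun f hf hfc hfs => ?_
    set Φ : ℝ × ℝ → Fin 4 → ℝ := fun z j => if j = i then f z else 0 with hΦ
    have hΦ0 : ∀ z, f z = 0 → Φ z = 0 := fun z hz => by ext j; simp [hΦ, hz]
    have hΦs : ContDiff ℝ ∞ Φ := contDiff_pi.2 fun j => by
      by_cases h : j = i
      · simpa [hΦ, h] using hf
      · simpa [hΦ, h] using contDiff_const
    have hts : tsupport Φ ⊆ tsupport f := closure_mono fun z hz hz' => hz (hΦ0 z hz')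
    have h1 := hW.data_orthogonal hWK hΦs (hfc.mono' (subset_trans subset_closure hts))
      (hts.trans (hfs.trans (Set.prod_mono (fun t ht => ht.2) le_rfl)))
    have h2 : ∀ y, Φ (0, y) = 0 := fun y => hΦ0 _ (image_eq_zero_of_notMem_tsupport fun h =>
      lt_irrefl _ (hfs h).1.1)
    simp only [h2, dotProduct_zero, integral_zero, add_zero] at h1
    simp only [hΦ, dotProduct_single_smul] at h1
    simpa only [smul_eq_mul] using h1
  filter_upwards [ae_all_iff.2 key,
    ae_restrict_mem (measurableSet_Ioo.prod measurableSet_Ioo)] with z hz hzQ hzK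
  ext i
  exact hz i ⟨hzQ.1, hzQ.2, hzK⟩

/-- Once `b` is known to vanish off `K`, test functions `η(t) f(x)` with `η(0) = 1` and `f`
supported off `K` isolate the initial term. -/
theorem IsWeakMaxwellSolution.init_ae_eq_zero (hT : 0 < T) (hK : IsCompact K)
    (hb : MemLp b 2 (volume.restrict (spaceTimeDomain T xL xR)))
    (hW₀ : MemLp W₀ 2 (volume.restrict (Set.Ioo xL xR)))
    (hW : IsWeakMaxwellSolution T xL xR b W₀ W)
    (hWK : ∀ᵐ z ∂(volume.restrict (spaceTimeDomain T xL xR)), z.2 ∉ K → W z = 0) :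
    ∀ᵐ y ∂(volume.restrict (Set.Ioo xL xR)), y ∉ K → W₀ y = 0 := by
  have hbK := hW.source_ae_eq_zero hK hb hWK
  have hU : IsOpen (Set.Ioo xL xR \ K) := isOpen_Ioo.sdiff hK.isClosed
  have key : ∀ i : Fin 3, ∀ᵐ y ∂(volume.restrict (Set.Ioo xL xR)),
      y ∈ Set.Ioo xL xR \ K → W₀ y i = 0 := by
    intro i
    refine hU.ae_eq_zero_of_integral_contDiff_smul_eq_zero
      (((hW₀.eval i).integrable (by norm_num)).locallyIntegrable.locallyIntegrableOn _)
      fun f hf hfc hfs => ?_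
    -- The support stays below `T / 2`, as test functions must vanish near time `T`; negative times
    -- are permitted.
    let η : ContDiffBump (0 : ℝ) := ⟨T / 4, T / 2, by linarith, by linarith⟩
    have hη1 : η 0 = 1 := η.one_of_mem_closedBall (Metric.mem_closedBall_self (by positivity))
    -- The index `i.succ` matches `M₁ W₀ = (0, W₀)`.
    set Φ : ℝ × ℝ → Fin 4 → ℝ := fun z j => if j = i.succ then η z.1 * f z.2 else 0 with hΦ
    have hΦ0 : ∀ z, z ∉ Metric.closedBall (0 : ℝ) (T / 2) ×ˢ tsupport f → Φ z = 0 := by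
      intro z hz
      have : η z.1 * f z.2 = 0 := by
        by_cases h : z.2 ∈ tsupport f
        · have h1 : z.1 ∉ Metric.closedBall (0 : ℝ) (T / 2) := fun h1 => hz ⟨h1, h⟩
          rw [← η.tsupport_eq] at h1
          rw [image_eq_zero_of_notMem_tsupport h1, zero_mul]
        · rw [image_eq_zero_of_notMem_tsupport h, mul_zero]
      ext j; simp [hΦ, this]
    have hsm : ContDiff ℝ ∞ fun z : ℝ × ℝ => η z.1 * f z.2 :=
      (η.contDiff.comp contDiff_fst).mul (hf.comp contDiff_snd)
    have hΦs : ContDiff ℝ ∞ Φ := contDiff_pi.2 fun j => by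
      by_cases h : j = i.succ
      · simpa [hΦ, h] using hsm
      · simpa [hΦ, h] using contDiff_const
    have hcp : IsCompact (Metric.closedBall (0 : ℝ) (T / 2) ×ˢ tsupport f) :=
      (isCompact_closedBall _ _).prod hfc
    have hts : tsupport Φ ⊆ Metric.closedBall (0 : ℝ) (T / 2) ×ˢ tsupport f :=
      closure_minimal (fun z hz => by by_contra h; exact hz (hΦ0 z h)) hcp.isClosed
    have h1 := hW.data_orthogonal hWK hΦs (HasCompactSupport.intro hcp hΦ0)
      (hts.trans (Set.prod_mono (fun t ht => ?_) hfs))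
    · rw [integral_congr_ae (g := fun _ => 0) ?_, integral_zero, zero_add] at h1
      · simp only [hΦ, hη1, one_mul, dotProduct_single_smul, maxwellM₁_mulVec_eq] at h1
        rw [← h1]
        congr 1 with y
        rw [smul_eq_mul]
        fin_cases i <;> rfl
      · filter_upwards [hbK] with z hz
        by_cases hzK : z.2 ∈ K
        · rw [hΦ0 z fun h => (hfs h.2).2 hzK, dotProduct_zero]
        · rw [hz hzK, zero_dotProduct]
    · rw [Metric.mem_closedBall, Real.dist_eq, sub_zero] at ht
      have := le_abs_self t
      simp only [Set.mem_Iio]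
      linarith
  filter_upwards [ae_all_iff.2 key, ae_restrict_mem measurableSet_Ioo] with y hy hyQ hyK
  ext i
  exact hy i ⟨hyQ, hyK⟩

/-- The pairing of the weak solution with the right-hand side of the dual problem. -/
theorem IsWeakMaxwellSolution.pairing_eq (hT : 0 < T) (hK : IsCompact K)
    (hKΩ : K ⊆ Set.Ioo xL xR)
    (hb : MemLp b 2 (volume.restrict (spaceTimeDomain T xL xR)))
    (hW₀ : MemLp W₀ 2 (volume.restrict (Set.Ioo xL xR)))
    (hW : IsWeakMaxwellSolution T xL xR b W₀ W)
    (hWK : ∀ᵐ z ∂(volume.restrict (spaceTimeDomain T xL xR)), z.2 ∉ K → W z = 0)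
    {s B : ℝ} (hs : s = 1 ∨ s = -1) {ψ v : ℝ × ℝ → Fin 3 → ℝ}
    (hv : IsDualField T xL xR s B ψ v) :
    ∫ z in spaceTimeDomain T xL xR, W z ⬝ᵥ chProj s (ψ z) =
      (∫ z in spaceTimeDomain T xL xR, b z ⬝ᵥ hatVec (v z)) +
        ∫ y in Set.Ioo xL xR, W₀ y ⬝ᵥ v (0, y) := by
  obtain ⟨ε, hε, hKε⟩ := hK.exists_subset_Icc_of_subset_Ioo hKΩ
  obtain ⟨t₀, ht₀⟩ := hv.initial
  obtain ⟨T', hT', hvT'⟩ := hv.final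
  -- This cut-off makes `hatVec (v z)` admissible in the weak formulation. It equals one on a
  -- neighbourhood of `K`, and `W`, `b` and `W₀` vanish elsewhere, so it does not show in any of the
  -- integrals.
  set χ : ℝ → ℝ := fun y => Real.smoothTransition ((y - xL - ε / 4) / (ε / 4)) *
    Real.smoothTransition ((xR - ε / 4 - y) / (ε / 4)) with hχ
  have hχs : ContDiff ℝ ∞ χ :=
    (Real.smoothTransition.contDiff.comp
      (((contDiff_id.sub contDiff_const).sub contDiff_const).div_const _)).mul
    (Real.smoothTransition.contDiff.comp ((contDiff_const.sub contDiff_id).div_const _))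
  have hχ0 : ∀ y, y ∉ Set.Icc (xL + ε / 4) (xR - ε / 4) → χ y = 0 := by
    intro y hy
    simp only [Set.mem_Icc, not_and_or, not_le] at hy
    rcases hy with hy | hy
    · simp only [hχ]
      rw [Real.smoothTransition.zero_of_nonpos, zero_mul]
      exact div_nonpos_of_nonpos_of_nonneg (by linarith) (by linarith)
    · simp only [hχ]
      rw [Real.smoothTransition.zero_of_nonpos (x := (xR - ε / 4 - y) / (ε / 4)), mul_zero]
      exact div_nonpos_of_nonpos_of_nonneg (by linarith) (by linarith)
  have hχ1 : ∀ y ∈ Set.Ioo (xL + ε / 2) (xR - ε / 2), χ y = 1 := by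
    intro y hy
    simp only [hχ]
    rw [Real.smoothTransition.one_of_one_le, Real.smoothTransition.one_of_one_le, mul_one]
    · rw [le_div_iff₀ (by linarith)]; linarith [hy.2]
    · rw [le_div_iff₀ (by linarith)]; linarith [hy.1]
  have hKI : K ⊆ Set.Ioo (xL + ε / 2) (xR - ε / 2) := fun y hy =>
    ⟨by linarith [(hKε hy).1], by linarith [(hKε hy).2]⟩
  set Φ : ℝ × ℝ → Fin 4 → ℝ := fun z => χ z.2 • hatVec (v z) with hΦ
  have hΦs : ContDiff ℝ ∞ Φ := (hχs.comp contDiff_snd).smul (contDiff_hatVec hv.contDiff)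
  -- The support is also bounded in the direction of negative times, because the dual field vanishes
  -- over `[xL, xR]` before `t₀`.
  have hΦ0 : ∀ z, z ∉ Set.Icc t₀ T' ×ˢ Set.Icc (xL + ε / 4) (xR - ε / 4) → Φ z = 0 := by
    intro z hz
    by_cases h2 : z.2 ∈ Set.Icc (xL + ε / 4) (xR - ε / 4)
    · have h1 : z.1 ∉ Set.Icc t₀ T' := fun h1 => hz ⟨h1, h2⟩
      have : v z = 0 := by
        simp only [Set.mem_Icc, not_and_or, not_le] at h1
        rcases h1 with h1 | h1
        · exact ht₀ z h1.le ⟨by linarith [h2.1], by linarith [h2.2]⟩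
        · exact hvT' z h1.le
      simp [hΦ, this, hatVec_zero]
    · simp [hΦ, hχ0 _ h2]
  have hcp : IsCompact (Set.Icc t₀ T' ×ˢ Set.Icc (xL + ε / 4) (xR - ε / 4)) :=
    isCompact_Icc.prod isCompact_Icc
  have hts : tsupport Φ ⊆ Set.Icc t₀ T' ×ˢ Set.Icc (xL + ε / 4) (xR - ε / 4) :=
    closure_minimal (fun z hz => by by_contra h; exact hz (hΦ0 z h)) hcp.isClosed
  have hweak := hW.2 Φ hΦs (HasCompactSupport.intro hcp hΦ0)
    (hts.trans (Set.prod_mono (fun t ht => ht.2.trans_lt hT')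
      (fun y hy => ⟨by linarith [hy.1], by linarith [hy.2]⟩)))
  have e1 : ∫ z in spaceTimeDomain T xL xR,
        W z ⬝ᵥ (-(maxwellM₁ᵀ *ᵥ timeDeriv Φ z) - maxwellM₂ᵀ *ᵥ spaceDeriv Φ z) =
      ∫ z in spaceTimeDomain T xL xR, W z ⬝ᵥ chProj s (ψ z) := by
    refine integral_congr_ae ?_
    filter_upwards [hWK] with z hz
    by_cases hzK : z.2 ∈ K
    · have hev : Φ =ᶠ[nhds z] fun z => hatVec (v z) := by
        have : ∀ᶠ w : ℝ × ℝ in nhds z, w.2 ∈ Set.Ioo (xL + ε / 2) (xR - ε / 2) :=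
          continuous_snd.continuousAt.eventually (isOpen_Ioo.mem_nhds (hKI hzK))
        filter_upwards [this] with w hw
        simp only [hΦ, hχ1 _ hw, one_smul]
      have hh := contDiff_hatVec hv.contDiff
      rw [timeDeriv_eq hΦs, spaceDeriv_eq hΦs, hev.fderiv_eq, ← timeDeriv_eq hh,
        ← spaceDeriv_eq hh, timeDeriv_hatVec hv.contDiff, spaceDeriv_hatVec hv.contDiff,
        transpose_maxwellM₁_hatVec, transpose_maxwellM₂_hatVec hs _ (hv.chProj_spaceDeriv z)]
      have := hv.transport z
      rw [← neg_eq_iff_eq_neg] at this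
      rw [← this]
      congr 1; abel
    · rw [hz hzK, zero_dotProduct, zero_dotProduct]
  have e2 : ∫ z in spaceTimeDomain T xL xR, b z ⬝ᵥ Φ z =
      ∫ z in spaceTimeDomain T xL xR, b z ⬝ᵥ hatVec (v z) := by
    refine integral_congr_ae ?_
    filter_upwards [hW.source_ae_eq_zero hK hb hWK] with z hz
    by_cases hzK : z.2 ∈ K
    · simp only [hΦ, hχ1 _ (hKI hzK), one_smul]
    · rw [hz hzK, zero_dotProduct, zero_dotProduct]
  have e3 : ∫ y in Set.Ioo xL xR, (maxwellM₁ *ᵥ W₀ y) ⬝ᵥ Φ (0, y) =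
      ∫ y in Set.Ioo xL xR, W₀ y ⬝ᵥ v (0, y) := by
    refine integral_congr_ae ?_
    filter_upwards [hW.init_ae_eq_zero hT hK hb hW₀ hWK] with y hy
    by_cases hyK : y ∈ K
    · simp only [hΦ, hχ1 _ (hKI hyK), one_smul, maxwellM₁_mulVec_dotProduct_hatVec]
    · rw [hy hyK, zero_dotProduct, Matrix.mulVec_zero, zero_dotProduct]
  rw [← e1, hweak, e2, e3]

end

/-- The error representation. -/
theorem SpaceTimeMesh.IsDiscretization.error_eq {T xL xR : ℝ} {𝒯 : SpaceTimeMesh T xL xR}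
    {k : ℕ} {δ : ℝ} {b : ℝ × ℝ → Fin 4 → ℝ} {W₀ : ℝ → Fin 3 → ℝ} {W : ℝ × ℝ → Fin 3 → ℝ}
    {Wh : ℕ → ℝ × ℝ → Fin 3 → ℝ} {p : ℕ → ℕ → ℝ × ℝ → Fin 3 → ℝ}
    (h : 𝒯.IsDiscretization k δ b W₀ Wh p) (hT : 0 < T) {K : Set ℝ} (hK : IsCompact K)
    (hKΩ : K ⊆ Set.Ioo xL xR) (hW : IsWeakMaxwellSolution T xL xR b W₀ W)
    (hWK : ∀ᵐ z ∂(volume.restrict (spaceTimeDomain T xL xR)), z.2 ∉ K → W z = 0)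
    {B : ℝ} {ψ v₁ v₂ : ℝ × ℝ → Fin 3 → ℝ}
    (hv₁ : IsDualField T xL xR 1 B ψ v₁) (hv₂ : IsDualField T xL xR (-1) B ψ v₂) :
    ∫ z in spaceTimeDomain T xL xR, (W z - 𝒯.glue Wh z) ⬝ᵥ ψ z =
      𝒯.errorFunctional b W₀ Wh p v₁ + 𝒯.errorFunctional b W₀ Wh p v₂ := by
  have main : ∀ s : ℝ, s = 1 ∨ s = -1 → ∀ v, IsDualField T xL xR s B ψ v →
      IntegrableOn (fun z => (W z - 𝒯.glue Wh z) ⬝ᵥ chProj s (ψ z))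
        (spaceTimeDomain T xL xR) ∧
      ∫ z in spaceTimeDomain T xL xR, (W z - 𝒯.glue Wh z) ⬝ᵥ chProj s (ψ z) =
        𝒯.errorFunctional b W₀ Wh p v := by
    intro s hs v hv
    have hvc := hv.contDiff.continuous
    have hψc : Continuous fun z => chProj s (ψ z) := by
      have e : (fun z => chProj s (ψ z)) = fun z => -(timeDeriv v z + s • spaceDeriv v z) := by
        ext1 z; rw [hv.transport z, neg_neg]
      rw [e]
      exact ((contDiff_timeDeriv hv.contDiff).continuous.add
          ((contDiff_spaceDeriv hv.contDiff).continuous.const_smul s)).neg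
    have hg : ∀ m < 𝒯.M, ∀ i < 𝒯.N, Set.EqOn (fun z => p m i z ⬝ᵥ chProj s (ψ z))
        (fun z => 𝒯.glue Wh z ⬝ᵥ chProj s (ψ z)) (𝒯.elem m i) := by
      intro m hm i hi z hz
      simp only [𝒯.glue_eq Wh hm (𝒯.elem_subset_slab hi hz), h.pieces.eq_of_mem_elem hm hi hz]
    have ip : ∀ m < 𝒯.M, ∀ i < 𝒯.N, IntegrableOn (fun z => p m i z ⬝ᵥ chProj s (ψ z))
        (𝒯.elem m i) := fun m hm i hi =>
      Continuous.integrableOn_rect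
        (continuous_dotProduct' (h.pieces.contDiff hm hi).continuous hψc) _ _ _ _
    have ig : ∀ m < 𝒯.M, ∀ i < 𝒯.N, IntegrableOn (fun z => 𝒯.glue Wh z ⬝ᵥ chProj s (ψ z))
        (𝒯.elem m i) := fun m hm i hi =>
      (ip m hm i hi).congr_fun (hg m hm i hi) (𝒯.measurableSet_elem m i)
    have igs : ∀ m < 𝒯.M, IntegrableOn (fun z => 𝒯.glue Wh z ⬝ᵥ chProj s (ψ z))
        (𝒯.slab m) := fun m hm => 𝒯.integrableOn_slab (ig m hm)
    have igQ : IntegrableOn (fun z => 𝒯.glue Wh z ⬝ᵥ chProj s (ψ z))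
        (spaceTimeDomain T xL xR) := by
      rw [IntegrableOn, 𝒯.restrict_domain, integrable_finsetSum_measure]
      exact fun m hm => igs m (Finset.mem_range.1 hm)
    have ibv : ∀ m < 𝒯.M, ∀ i < 𝒯.N, IntegrableOn (fun z => b z ⬝ᵥ hatVec (v z))
        (𝒯.elem m i) := fun m hm i hi => MemLp.integrable_dotProduct (h.memLp_b_elem hm hi)
          (𝒯.memLp_elem (continuous_hatVec hvc) m i)
    have hglue : ∫ z in spaceTimeDomain T xL xR, 𝒯.glue Wh z ⬝ᵥ chProj s (ψ z) =
        ∑ m ∈ Finset.range 𝒯.M, ∑ i ∈ Finset.range 𝒯.N,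
          ∫ z in 𝒯.elem m i, p m i z ⬝ᵥ chProj s (ψ z) := by
      rw [𝒯.setIntegral_domain igs]
      refine Finset.sum_congr rfl fun m hm => ?_
      have hm := Finset.mem_range.1 hm
      rw [𝒯.setIntegral_slab (ig m hm)]
      refine Finset.sum_congr rfl fun i hi => ?_
      exact (setIntegral_congr_fun (𝒯.measurableSet_elem m i)
        (hg m hm i (Finset.mem_range.1 hi))).symm
    have hbsum : ∫ z in spaceTimeDomain T xL xR, b z ⬝ᵥ hatVec (v z) =
        ∑ m ∈ Finset.range 𝒯.M, ∑ i ∈ Finset.range 𝒯.N,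
          ∫ z in 𝒯.elem m i, b z ⬝ᵥ hatVec (v z) := by
      rw [𝒯.setIntegral_domain fun m hm => 𝒯.integrableOn_slab (ibv m hm)]
      refine Finset.sum_congr rfl fun m hm => ?_
      rw [𝒯.setIntegral_slab (ibv m (Finset.mem_range.1 hm))]
    have iW := MemLp.integrable_dotProduct hW.1 (memLp_domain (T := T) (xL := xL) (xR := xR) hψc)
    simp only [sub_dotProduct]
    refine ⟨iW.sub igQ, ?_⟩
    rw [integral_sub iW igQ, hglue,
      h.sum_pairing_eq hs hv, hW.pairing_eq hT hK hKΩ h.memLp_b h.memLp_init hWK hs hv, hbsum]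
    ring
  have m₁ := main 1 (Or.inl rfl) v₁ hv₁
  have m₂ := main (-1) (Or.inr rfl) v₂ hv₂
  rw [← m₁.2, ← m₂.2, ← integral_add m₁.1 m₂.1]
  simp only [← dotProduct_add, chProj_add_chProj]

/-! ### Energy estimates for the projected discrete solution. -/

/-- The energy identity on a rectangle. -/
theorem two_mul_setIntegral_maxwellOp_chProj {s : ℝ} (hs : s = 1 ∨ s = -1)
    {p : ℝ × ℝ → Fin 3 → ℝ} (hp : ContDiff ℝ ∞ p) {a b c d : ℝ} (hab : a ≤ b) (hcd : c ≤ d) :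
    2 * ∫ z in Set.Ioo a b ×ˢ Set.Ioo c d, maxwellOp p z ⬝ᵥ hatVec (chProj s (p z)) =
      (∫ y in Set.Ioo c d, (chProj s (p (b, y)) ⬝ᵥ chProj s (p (b, y)) -
        chProj s (p (a, y)) ⬝ᵥ chProj s (p (a, y)))) +
        s * ∫ t in Set.Ioo a b, (chProj s (p (t, d)) ⬝ᵥ chProj s (p (t, d)) -
          chProj s (p (t, c)) ⬝ᵥ chProj s (p (t, c))) := by
  have hu := contDiff_chProj s hp
  have := setIntegral_maxwellOp_green hs hp hu (fun z => chProj_idem hs _) hab hcd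
  simp only [dotProduct_chProj hs (p _)] at this
  rw [← this, ← integral_const_mul]
  refine integral_congr_ae (Filter.Eventually.of_forall fun z => ?_)
  simp only [timeDeriv_chProj s hp, spaceDeriv_chProj s hp, maxwellOp_eq,
    maxwellRow_dotProduct_hatVec hs _ _ _ (chProj_idem hs _), dotProduct_add, dotProduct_smul,
    dotProduct_chProj hs (p z), dotProduct_chProj hs (timeDeriv p z),
    dotProduct_chProj hs (spaceDeriv p z), smul_eq_mul]
  rw [dotProduct_comm (chProj s (p z)), dotProduct_comm (chProj s (p z))]
  ring

theorem setIntegral_rect_fst {F : ℝ → ℝ} (hF : Continuous F) (a b : ℝ) {c d : ℝ} (hcd : c ≤ d) :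
    ∫ z in Set.Ioo a b ×ˢ Set.Ioo c d, F z.1 = (d - c) * ∫ t in Set.Ioo a b, F t := by
  rw [setIntegral_rect_eq (F := fun z => F z.1) (by fun_prop)]
  simp only [integral_const, MeasurableSet.univ, measureReal_restrict_apply, Set.univ_inter,
    Real.volume_real_Ioo_of_le hcd, smul_eq_mul]
  exact integral_const_mul _ _

/-- The function which equals `w(·, y)` times an affine function of `x`. -/
def ramp (w : ℝ × ℝ → Fin 3 → ℝ) (y α β : ℝ) (z : ℝ × ℝ) : Fin 3 → ℝ :=
  (α + β * z.2) • w (z.1, y)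

theorem contDiff_ramp {w : ℝ × ℝ → Fin 3 → ℝ} (y α β : ℝ)
    (hw : ContDiff ℝ ∞ w) : ContDiff ℝ ∞ (ramp w y α β) :=
  (contDiff_const.add (contDiff_const.mul contDiff_snd)).smul
    (hw.comp (contDiff_fst.prodMk contDiff_const))

theorem timeDeriv_ramp {w : ℝ × ℝ → Fin 3 → ℝ} (y α β : ℝ)
    (hw : ContDiff ℝ ∞ w) (z : ℝ × ℝ) :
    timeDeriv (ramp w y α β) z = (α + β * z.2) • timeDeriv w (z.1, y) :=
  timeDeriv_eq_of_hasDerivAt fun i =>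
    (hasDerivAt_time_apply hw z.1 y i).const_mul (α + β * z.2)

theorem spaceDeriv_ramp (w : ℝ × ℝ → Fin 3 → ℝ) (y α β : ℝ) (z : ℝ × ℝ) :
    spaceDeriv (ramp w y α β) z = β • w (z.1, y) := by
  refine spaceDeriv_eq_of_hasDerivAt fun i => ?_
  have h : HasDerivAt (fun x : ℝ => α + β * x) β z.2 := by
    simpa using ((hasDerivAt_id z.2).const_mul β).const_add α
  exact h.mul_const (w (z.1, y) i)

/-- The affine factor is at most one and its slope at most the inverse cell length. Integration over
the width of the cell turns the slope term `δ² / (d - c)²` into `δ² / (d - c)`; this is the price of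
switching off within one cell. -/
theorem setIntegral_ramp_test_le {w : ℝ × ℝ → Fin 3 → ℝ} (y α β : ℝ)
    (hw : ContDiff ℝ ∞ w) {a b c d : ℝ} (hcd : c < d)
    (hρ : ∀ x ∈ Set.Ioo c d, (α + β * x) ^ 2 ≤ 1) (hβ : β ^ 2 * (d - c) ^ 2 ≤ 1) (δ : ℝ) :
    ∫ z in Set.Ioo a b ×ˢ Set.Ioo c d,
      (hatVec (ramp w y α β z) + δ • maxwellOp (ramp w y α β) z) ⬝ᵥ
        (hatVec (ramp w y α β z) + δ • maxwellOp (ramp w y α β) z) ≤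
      (4 * (d - c) + 4 * δ ^ 2 / (d - c)) * (∫ t in Set.Ioo a b, w (t, y) ⬝ᵥ w (t, y)) +
        4 * δ ^ 2 * (d - c) * ∫ t in Set.Ioo a b, timeDeriv w (t, y) ⬝ᵥ timeDeriv w (t, y) := by
  have hl : 0 < d - c := sub_pos.2 hcd
  have hwc : Continuous fun t => w (t, y) := hw.continuous.comp (by fun_prop)
  have hwtc : Continuous fun t => timeDeriv w (t, y) :=
    (contDiff_timeDeriv hw).continuous.comp (by fun_prop)
  have c1 := continuous_dotProduct' hwc hwc
  have c2 := continuous_dotProduct' hwtc hwtc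
  set F : ℝ → ℝ := fun t => (4 + 4 * δ ^ 2 / (d - c) ^ 2) * (w (t, y) ⬝ᵥ w (t, y)) +
    4 * δ ^ 2 * (timeDeriv w (t, y) ⬝ᵥ timeDeriv w (t, y)) with hF
  have hFc : Continuous F := (continuous_const.mul c1).add (continuous_const.mul c2)
  have hrs := contDiff_ramp y α β hw
  have ht : Continuous fun z => hatVec (ramp w y α β z) + δ • maxwellOp (ramp w y α β) z :=
    (continuous_hatVec hrs.continuous).add ((contDiff_maxwellOp hrs).continuous.const_smul δ)
  have hle : ∀ z ∈ Set.Ioo a b ×ˢ Set.Ioo c d,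
      (hatVec (ramp w y α β z) + δ • maxwellOp (ramp w y α β) z) ⬝ᵥ
        (hatVec (ramp w y α β z) + δ • maxwellOp (ramp w y α β) z) ≤ F z.1 := by
    intro z hz
    have e1 := add_dotProduct_self_le (hatVec (ramp w y α β z)) (δ • maxwellOp (ramp w y α β) z)
    have e3 := maxwellRow_dotProduct_self_le (timeDeriv (ramp w y α β) z)
      (spaceDeriv (ramp w y α β) z)
    rw [← maxwellOp_eq, timeDeriv_ramp y α β hw, spaceDeriv_ramp w y α β] at e3
    simp only [smul_dotProduct, dotProduct_smul, smul_eq_mul, ← mul_assoc] at e1 e3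
    have n1 := dotProduct_self_nonneg' (w (z.1, y))
    have n2 := dotProduct_self_nonneg' (timeDeriv w (z.1, y))
    have r1 := hρ z.2 hz.2
    have b1 : β ^ 2 ≤ 1 / (d - c) ^ 2 := by rw [le_div_iff₀ (by positivity)]; exact hβ
    have f1 : (α + β * z.2) ^ 2 * (w (z.1, y) ⬝ᵥ w (z.1, y)) ≤ w (z.1, y) ⬝ᵥ w (z.1, y) :=
      mul_le_of_le_one_left n1 r1
    have f2 : (α + β * z.2) ^ 2 * (timeDeriv w (z.1, y) ⬝ᵥ timeDeriv w (z.1, y)) ≤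
        timeDeriv w (z.1, y) ⬝ᵥ timeDeriv w (z.1, y) := mul_le_of_le_one_left n2 r1
    have f3 : β ^ 2 * (w (z.1, y) ⬝ᵥ w (z.1, y)) ≤
        1 / (d - c) ^ 2 * (w (z.1, y) ⬝ᵥ w (z.1, y)) := mul_le_mul_of_nonneg_right b1 n1
    have e2 : hatVec (ramp w y α β z) ⬝ᵥ hatVec (ramp w y α β z) ≤
        2 * (w (z.1, y) ⬝ᵥ w (z.1, y)) := by
      refine (hatVec_dotProduct_self_le _).trans ?_
      simp only [ramp, smul_dotProduct, dotProduct_smul, smul_eq_mul]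
      nlinarith
    have e4 : maxwellOp (ramp w y α β) z ⬝ᵥ maxwellOp (ramp w y α β) z ≤
        2 * (timeDeriv w (z.1, y) ⬝ᵥ timeDeriv w (z.1, y)) +
          2 * (1 / (d - c) ^ 2 * (w (z.1, y) ⬝ᵥ w (z.1, y))) := by nlinarith
    have e5 := mul_le_mul_of_nonneg_left e4 (sq_nonneg δ)
    have e6 : F z.1 = 4 * (w (z.1, y) ⬝ᵥ w (z.1, y)) +
        2 * (δ ^ 2 * (2 * (timeDeriv w (z.1, y) ⬝ᵥ timeDeriv w (z.1, y)) +
          2 * (1 / (d - c) ^ 2 * (w (z.1, y) ⬝ᵥ w (z.1, y))))) := by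
      simp only [hF]; ring
    rw [e6]
    nlinarith
  refine (setIntegral_mono_on ((continuous_dotProduct' ht ht).integrableOn_rect _ _ _ _)
    (Continuous.integrableOn_rect (F := fun z => F z.1) (by fun_prop) _ _ _ _)
    (measurableSet_Ioo.prod measurableSet_Ioo) hle).trans (le_of_eq ?_)
  rw [setIntegral_rect_fst hFc a b hcd.le]
  have i1 : IntegrableOn (fun t => (4 + 4 * δ ^ 2 / (d - c) ^ 2) * (w (t, y) ⬝ᵥ w (t, y)))
    (Set.Ioo a b) := Continuous.integrableOn_Ioo' (continuous_const.mul c1) _ _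
  have i2 : IntegrableOn (fun t => 4 * δ ^ 2 * (timeDeriv w (t, y) ⬝ᵥ timeDeriv w (t, y)))
    (Set.Ioo a b) := Continuous.integrableOn_Ioo' (continuous_const.mul c2) _ _
  simp only [hF]
  rw [integral_add i1 i2, integral_const_mul, integral_const_mul]
  field_simp

theorem setIntegral_ramp_trace_le {w : ℝ × ℝ → Fin 3 → ℝ} (y α β : ℝ)
    (hw : ContDiff ℝ ∞ w) {a c d : ℝ} (hcd : c < d)
    (hρ : ∀ x ∈ Set.Ioo c d, (α + β * x) ^ 2 ≤ 1) :
    ∫ x in Set.Ioo c d, ramp w y α β (a, x) ⬝ᵥ ramp w y α β (a, x) ≤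
      (d - c) * (w (a, y) ⬝ᵥ w (a, y)) := by
  have hrs := (contDiff_ramp y α β hw).continuous
  have hrc : Continuous fun x => ramp w y α β (a, x) := hrs.comp (by fun_prop)
  refine (setIntegral_mono_on (g := fun _ => w (a, y) ⬝ᵥ w (a, y))
    (Continuous.integrableOn_Ioo' (continuous_dotProduct' hrc hrc) _ _)
    (Continuous.integrableOn_Ioo' continuous_const _ _) measurableSet_Ioo
    fun x hx => ?_).trans ?_
  · simp only [ramp, smul_dotProduct, dotProduct_smul, smul_eq_mul, ← mul_assoc]
    have n1 := dotProduct_self_nonneg' (w (a, y))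
    have r1 := hρ x hx
    nlinarith
  · simp [Real.volume_real_Ioo_of_le hcd.le]

theorem MeasureTheory.MemLp.chProj {α : Type*} [MeasurableSpace α] {μ : Measure α} {q : ℝ≥0∞}
    {u : α → Fin 3 → ℝ} (hu : MemLp u q μ) (s : ℝ) : MemLp (fun z => chProj s (u z)) q μ := by
  refine MemLp.of_eval fun i => ?_
  have h := fun i => hu.eval i
  fin_cases i
  · exact (h 0).const_mul ((1 + s) / 2)
  · simpa [_root_.chProj, div_eq_inv_mul] using ((h 1).add ((h 2).const_mul s)).const_mul 2⁻¹
  · simpa [_root_.chProj, div_eq_inv_mul] using ((h 2).add ((h 1).const_mul s)).const_mul 2⁻¹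

/-- Young's inequality, integrated. -/
theorem integral_dotProduct_le_young {α : Type*} [MeasurableSpace α] {μ : Measure α} {n : ℕ}
    {u v : α → Fin n → ℝ} (hu : MemLp u 2 μ) (hv : MemLp v 2 μ) {c : ℝ} (hc : 0 < c) :
    ∫ z, u z ⬝ᵥ v z ∂μ ≤ (c * (∫ z, u z ⬝ᵥ u z ∂μ) + c⁻¹ * ∫ z, v z ⬝ᵥ v z ∂μ) / 2 := by
  have i1 := (MemLp.integrable_dotProduct hu hu).const_mul c
  have i2 := (MemLp.integrable_dotProduct hv hv).const_mul c⁻¹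
  rw [← integral_const_mul, ← integral_const_mul, ← integral_add i1 i2, ← integral_div]
  exact integral_mono (MemLp.integrable_dotProduct hu hv) ((i1.add i2).div_const 2)
    fun z => dotProduct_le_young _ _ hc

theorem integral_dotProduct_self_nonneg {α : Type*} [MeasurableSpace α] {μ : Measure α} {n : ℕ}
    (u : α → Fin n → ℝ) : 0 ≤ ∫ z, u z ⬝ᵥ u z ∂μ :=
  integral_nonneg fun _ => dotProduct_self_nonneg' _

namespace SpaceTimeMesh

variable {T xL xR : ℝ} {𝒯 : SpaceTimeMesh T xL xR}

namespace IsDiscretization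

variable {k : ℕ} {δ : ℝ} {b : ℝ × ℝ → Fin 4 → ℝ} {W₀ : ℝ → Fin 3 → ℝ}
  {Wh : ℕ → ℝ × ℝ → Fin 3 → ℝ} {p : ℕ → ℕ → ℝ × ℝ → Fin 3 → ℝ}

/-- The Galerkin equation tested with the projected solution itself, on an element without
sources. -/
theorem interior_energy (h : 𝒯.IsDiscretization k δ b W₀ Wh p) {s : ℝ} (hs : s = 1 ∨ s = -1)
    {m i : ℕ} (hm : m < 𝒯.M) (hi : i < 𝒯.N)
    (hb : ∀ᵐ z ∂(volume.restrict (𝒯.elem m i)), b z = 0) :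
    (∫ z in 𝒯.elem m i, (b z - maxwellOp (p m i) z) ⬝ᵥ
        (hatVec (chProj s (p m i z)) + δ • maxwellOp (fun z => chProj s (p m i z)) z)) -
      ∫ y in 𝒯.cell i, 𝒯.jump W₀ Wh m y ⬝ᵥ chProj s (p m i (𝒯.t m, y)) =
    -((∫ y in 𝒯.cell i, chProj s (𝒯.traceBelow W₀ Wh (m + 1) y) ⬝ᵥ
          chProj s (𝒯.traceBelow W₀ Wh (m + 1) y)) -
        ∫ y in 𝒯.cell i, chProj s (𝒯.traceBelow W₀ Wh m y) ⬝ᵥ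
          chProj s (𝒯.traceBelow W₀ Wh m y)) / 2 -
      (s * ∫ t in Set.Ioo (𝒯.t m) (𝒯.t (m + 1)),
        (chProj s (p m i (t, 𝒯.x (i + 1))) ⬝ᵥ chProj s (p m i (t, 𝒯.x (i + 1))) -
          chProj s (p m i (t, 𝒯.x i)) ⬝ᵥ chProj s (p m i (t, 𝒯.x i)))) / 2 -
      δ * (∫ z in 𝒯.elem m i, maxwellOp (fun z => chProj s (p m i z)) z ⬝ᵥ
        maxwellOp (fun z => chProj s (p m i z)) z) -
      (∫ y in 𝒯.cell i, chProj s (𝒯.jump W₀ Wh m y) ⬝ᵥ chProj s (𝒯.jump W₀ Wh m y)) / 2 := by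
  have hp := h.pieces.contDiff hm hi
  have hu := contDiff_chProj s hp
  have en := two_mul_setIntegral_maxwellOp_chProj hs hp (𝒯.t_lt m hm).le (𝒯.x_lt i hi).le
  have mP := 𝒯.memLp_elem (contDiff_maxwellOp hp).continuous m i
  have mU := 𝒯.memLp_elem (contDiff_maxwellOp hu).continuous m i
  have mH := 𝒯.memLp_elem (continuous_hatVec hu.continuous) m i
  have e1 : ∫ z in 𝒯.elem m i, (b z - maxwellOp (p m i) z) ⬝ᵥ
        (hatVec (chProj s (p m i z)) + δ • maxwellOp (fun z => chProj s (p m i z)) z) =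
      -(∫ z in 𝒯.elem m i, maxwellOp (p m i) z ⬝ᵥ hatVec (chProj s (p m i z))) -
        δ * ∫ z in 𝒯.elem m i, maxwellOp (fun z => chProj s (p m i z)) z ⬝ᵥ
          maxwellOp (fun z => chProj s (p m i z)) z := by
    have iN : Integrable (fun z => -(maxwellOp (p m i) z ⬝ᵥ hatVec (chProj s (p m i z))))
        (volume.restrict (𝒯.elem m i)) := (MemLp.integrable_dotProduct mP mH).neg
    rw [← integral_neg, ← integral_const_mul, ← integral_sub iN
      ((MemLp.integrable_dotProduct mU mU).const_mul δ)]
    refine integral_congr_ae ?_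
    filter_upwards [hb] with z hz
    -- Only the part of speed `s` survives against its own image, so the streamline term is exactly
    -- minus `δ` times a square.
    have e : maxwellOp (p m i) z ⬝ᵥ maxwellOp (fun z => chProj s (p m i z)) z =
        maxwellOp (fun z => chProj s (p m i z)) z ⬝ᵥ maxwellOp (fun z => chProj s (p m i z)) z := by
      simp only [maxwellOp_eq, timeDeriv_chProj s hp, spaceDeriv_chProj s hp]
      exact maxwellRow_dotProduct_chProj hs _ _ _ _ (chProj_idem hs _) (chProj_idem hs _)
    simp only [hz, zero_sub, neg_dotProduct, dotProduct_add, dotProduct_smul, smul_eq_mul, e]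
    ring
  have mA := (h.memLp_traceAbove hm hi).chProj s
  have mB := (h.memLp_traceBelow hm.le hi).chProj s
  have mB' := (h.memLp_traceBelow hm hi).chProj s
  have mJ := (h.memLp_jump hm hi).chProj s
  have iA := MemLp.integrable_dotProduct mA mA
  have iB := MemLp.integrable_dotProduct mB mB
  have iB' := MemLp.integrable_dotProduct mB' mB'
  have iJ := MemLp.integrable_dotProduct mJ mJ
  -- The identity `2 (A - B) · A = |A|² - |B|² + |A - B|²` for the traces from above and below. The
  -- term `|A|²` cancels against the energy identity, leaving traces from below, which telescope in
  -- time.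
  have e2 : ∫ y in 𝒯.cell i, 𝒯.jump W₀ Wh m y ⬝ᵥ chProj s (p m i (𝒯.t m, y)) =
      ((∫ y in 𝒯.cell i, chProj s (𝒯.traceAbove Wh m y) ⬝ᵥ chProj s (𝒯.traceAbove Wh m y)) -
      (∫ y in 𝒯.cell i, chProj s (𝒯.traceBelow W₀ Wh m y) ⬝ᵥ
        chProj s (𝒯.traceBelow W₀ Wh m y)) +
      ∫ y in 𝒯.cell i, chProj s (𝒯.jump W₀ Wh m y) ⬝ᵥ chProj s (𝒯.jump W₀ Wh m y)) / 2 := by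
    have iAB : Integrable (fun y => chProj s (𝒯.traceAbove Wh m y) ⬝ᵥ
        chProj s (𝒯.traceAbove Wh m y) - chProj s (𝒯.traceBelow W₀ Wh m y) ⬝ᵥ
        chProj s (𝒯.traceBelow W₀ Wh m y)) (volume.restrict (𝒯.cell i)) := iA.sub iB
    rw [← integral_sub iA iB, ← integral_add iAB iJ, ← integral_div]
    refine setIntegral_congr_fun (𝒯.measurableSet_cell i) fun y hy => ?_
    simp only [← h.pieces.traceAbove_eq hm hi hy]
    rw [dotProduct_chProj hs]
    simp only [jump, chProj_sub, sub_dotProduct, dotProduct_sub]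
    rw [dotProduct_comm (chProj s (𝒯.traceBelow W₀ Wh m y)) (chProj s (𝒯.traceAbove Wh m y))]
    ring
  have e3 : ∫ y in Set.Ioo (𝒯.x i) (𝒯.x (i + 1)),
        (chProj s (p m i (𝒯.t (m + 1), y)) ⬝ᵥ chProj s (p m i (𝒯.t (m + 1), y)) -
        chProj s (p m i (𝒯.t m, y)) ⬝ᵥ chProj s (p m i (𝒯.t m, y))) =
      (∫ y in 𝒯.cell i, chProj s (𝒯.traceBelow W₀ Wh (m + 1) y) ⬝ᵥ
          chProj s (𝒯.traceBelow W₀ Wh (m + 1) y)) -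
      ∫ y in 𝒯.cell i, chProj s (𝒯.traceAbove Wh m y) ⬝ᵥ chProj s (𝒯.traceAbove Wh m y) := by
    rw [← integral_sub iB' iA]
    refine setIntegral_congr_fun (𝒯.measurableSet_cell i) fun y hy => ?_
    simp only [← h.pieces.traceAbove_eq hm hi hy, ← h.pieces.traceBelow_eq W₀ hm hi hy]
  rw [e3] at en
  rw [e1, e2]
  change 2 * (∫ z in 𝒯.elem m i, maxwellOp (p m i) z ⬝ᵥ hatVec (chProj s (p m i z))) = _ at en
  linarith

/-- The terms of the Galerkin equation on the element on which the test function is cut off. -/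
theorem cutoff_element_le (h : 𝒯.IsDiscretization k δ b W₀ Wh p) {s : ℝ} (hs : s = 1 ∨ s = -1)
    {m i : ℕ} (hm : m < 𝒯.M) (hi : i < 𝒯.N)
    (hb : ∀ᵐ z ∂(volume.restrict (𝒯.elem m i)), b z = 0) {y α β : ℝ}
    (hρ : ∀ x ∈ 𝒯.cell i, (α + β * x) ^ 2 ≤ 1) (hβ : β ^ 2 * 𝒯.dx i ^ 2 ≤ 1)
    {Ci : ℝ} (hinv : ∀ u : ℝ × ℝ → Fin 3 → ℝ, (∀ j, IsTensorPoly k fun z => u z j) →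
      ∀ y a b : ℝ, a < b →
      (b - a) * (u (a, y) ⬝ᵥ u (a, y)) ≤ Ci * ∫ t in Set.Ioo a b, u (t, y) ⬝ᵥ u (t, y) ∧
      (b - a) ^ 2 * ∫ t in Set.Ioo a b, timeDeriv u (t, y) ⬝ᵥ timeDeriv u (t, y) ≤
        Ci * ∫ t in Set.Ioo a b, u (t, y) ⬝ᵥ u (t, y))
    {D D₂ : ℝ} (hD : 0 < D) (hD₂ : 0 < D₂)
    (hD' : 4 * 𝒯.dx i + 4 * δ ^ 2 / 𝒯.dx i + 4 * δ ^ 2 * 𝒯.dx i * (Ci / 𝒯.dt m ^ 2) ≤ D)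
    (hD₂' : 𝒯.dx i * (Ci / 𝒯.dt m) ≤ D₂) :
    (∫ z in 𝒯.elem m i, (b z - maxwellOp (p m i) z) ⬝ᵥ
        (hatVec (ramp (fun z => chProj s (p m i z)) y α β z) +
          δ • maxwellOp (ramp (fun z => chProj s (p m i z)) y α β) z)) -
      ∫ x in 𝒯.cell i, 𝒯.jump W₀ Wh m x ⬝ᵥ
        ramp (fun z => chProj s (p m i z)) y α β (𝒯.t m, x) ≤
    D * (∫ z in 𝒯.elem m i, maxwellOp (fun z => chProj s (p m i z)) z ⬝ᵥ
        maxwellOp (fun z => chProj s (p m i z)) z) +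
      D₂ * (∫ x in 𝒯.cell i, chProj s (𝒯.jump W₀ Wh m x) ⬝ᵥ chProj s (𝒯.jump W₀ Wh m x)) +
      (∫ t in Set.Ioo (𝒯.t m) (𝒯.t (m + 1)), chProj s (p m i (t, y)) ⬝ᵥ
        chProj s (p m i (t, y))) / 2 := by
  have hp := h.pieces.contDiff hm hi
  have hu := contDiff_chProj s hp
  set u : ℝ × ℝ → Fin 3 → ℝ := fun z => chProj s (p m i z) with hudef
  have hr := contDiff_ramp y α β hu
  have hPr : ∀ z, chProj s (ramp u y α β z) = ramp u y α β z := fun z => by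
    simp only [ramp, hudef, chProj_smul, chProj_idem hs]
  have hdx := 𝒯.dx_pos hi
  have hdt := 𝒯.dt_pos hm
  have htensor : ∀ j, IsTensorPoly k fun z => u z j := by
    have ht := h.pieces.tensor m hm i hi
    intro j
    fin_cases j
    · exact (ht 0).const_mul ((1 + s) / 2)
    · have := ((ht 1).add ((ht 2).const_mul s)).const_mul 2⁻¹
      simpa [hudef, chProj, div_eq_inv_mul] using this
    · have := ((ht 2).add ((ht 1).const_mul s)).const_mul 2⁻¹
      simpa [hudef, chProj, div_eq_inv_mul] using this
  obtain ⟨inv1, inv2⟩ := hinv u htensor y _ _ (𝒯.t_lt m hm)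
  set a := ∫ t in Set.Ioo (𝒯.t m) (𝒯.t (m + 1)), u (t, y) ⬝ᵥ u (t, y) with ha
  have ha0 : 0 ≤ a := integral_dotProduct_self_nonneg _
  set X : ℝ × ℝ → Fin 4 → ℝ := fun z =>
    hatVec (ramp u y α β z) + δ • maxwellOp (ramp u y α β) z with hX
  have mX : MemLp X 2 (volume.restrict (𝒯.elem m i)) :=
    𝒯.memLp_elem ((continuous_hatVec hr.continuous).add
      ((contDiff_maxwellOp hr).continuous.const_smul δ)) m i
  have mU := 𝒯.memLp_elem (contDiff_maxwellOp hu).continuous m i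
  -- Without data the residual is `-L W^h`, with `L` the Maxwell operator, and the test function,
  -- lying in the range of `P_s`, sees only `-L (P_s W^h)`.
  have e1 : ∫ z in 𝒯.elem m i, (b z - maxwellOp (p m i) z) ⬝ᵥ X z =
      ∫ z in 𝒯.elem m i, (-maxwellOp u z) ⬝ᵥ X z := by
    refine integral_congr_ae ?_
    filter_upwards [hb] with z hz
    simp only [hX, hz, zero_sub, neg_dotProduct, dotProduct_add, dotProduct_smul]
    have f1 : maxwellOp (p m i) z ⬝ᵥ hatVec (ramp u y α β z) =
        maxwellOp u z ⬝ᵥ hatVec (ramp u y α β z) := by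
      simp only [maxwellOp_eq, hudef, timeDeriv_chProj s hp, spaceDeriv_chProj s hp]
      exact maxwellRow_dotProduct_hatVec_chProj hs _ _ _ (hPr z)
    have f2 : maxwellOp (p m i) z ⬝ᵥ maxwellOp (ramp u y α β) z =
        maxwellOp u z ⬝ᵥ maxwellOp (ramp u y α β) z := by
      have g1 : chProj s (timeDeriv (ramp u y α β) z) = timeDeriv (ramp u y α β) z := by
        rw [← timeDeriv_chProj s hr, funext hPr]
      have g2 : chProj s (spaceDeriv (ramp u y α β) z) = spaceDeriv (ramp u y α β) z := by
        rw [← spaceDeriv_chProj s hr, funext hPr]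
      have g3 := maxwellRow_dotProduct_chProj hs (timeDeriv (p m i) z) (spaceDeriv (p m i) z)
        _ _ g1 g2
      rw [← timeDeriv_chProj s hp, ← spaceDeriv_chProj s hp] at g3
      exact g3
    rw [f1, f2]
  -- The weight `2 D`, like `2 D₂` below, leaves `a / 4` from each of the two terms. Together they
  -- make `a / 2`, which is what the outgoing flux of the energy identity can absorb.
  have y1 := integral_dotProduct_le_young mU.neg mX (c := 2 * D) (by positivity)
  simp only [Pi.neg_apply, neg_dotProduct_neg] at y1
  have t1 := setIntegral_ramp_test_le y α β hu (a := 𝒯.t m) (b := 𝒯.t (m + 1))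
    (𝒯.x_lt i hi) hρ hβ δ
  change ∫ z in 𝒯.elem m i, X z ⬝ᵥ X z ≤
    (4 * 𝒯.dx i + 4 * δ ^ 2 / 𝒯.dx i) * a + 4 * δ ^ 2 * 𝒯.dx i * _ at t1
  have inv2' : ∫ t in Set.Ioo (𝒯.t m) (𝒯.t (m + 1)), timeDeriv u (t, y) ⬝ᵥ timeDeriv u (t, y) ≤
      Ci / 𝒯.dt m ^ 2 * a := by
    rw [div_mul_eq_mul_div, le_div_iff₀ (by positivity), mul_comm]
    exact inv2
  have t2 : ∫ z in 𝒯.elem m i, X z ⬝ᵥ X z ≤ D * a := by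
    have := mul_le_mul_of_nonneg_left inv2' (show 0 ≤ 4 * δ ^ 2 * 𝒯.dx i by positivity)
    have := mul_le_mul_of_nonneg_right hD' ha0
    linarith
  have t3 : (2 * D)⁻¹ * ∫ z in 𝒯.elem m i, X z ⬝ᵥ X z ≤ a / 2 := by
    rw [inv_mul_le_iff₀ (by positivity)]
    linarith
  have hrc : Continuous fun x => ramp u y α β (𝒯.t m, x) := hr.continuous.comp (by fun_prop)
  have mR := 𝒯.memLp_cell hrc i
  have mJ := (h.memLp_jump hm hi).chProj s
  have e2 : ∫ x in 𝒯.cell i, 𝒯.jump W₀ Wh m x ⬝ᵥ ramp u y α β (𝒯.t m, x) =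
      -∫ x in 𝒯.cell i, (-chProj s (𝒯.jump W₀ Wh m x)) ⬝ᵥ ramp u y α β (𝒯.t m, x) := by
    rw [← integral_neg]
    congr 1 with x
    rw [neg_dotProduct, neg_neg, ← hPr, dotProduct_chProj hs]
  have y2 := integral_dotProduct_le_young mJ.neg mR (c := 2 * D₂) (by positivity)
  simp only [Pi.neg_apply, neg_dotProduct_neg] at y2
  have s1 := setIntegral_ramp_trace_le y α β hu (a := 𝒯.t m) (𝒯.x_lt i hi) hρ
  have inv1' : u (𝒯.t m, y) ⬝ᵥ u (𝒯.t m, y) ≤ Ci / 𝒯.dt m * a := by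
    rw [div_mul_eq_mul_div, le_div_iff₀ hdt, mul_comm]
    exact inv1
  have s2 : ∫ x in 𝒯.cell i, ramp u y α β (𝒯.t m, x) ⬝ᵥ ramp u y α β (𝒯.t m, x) ≤ D₂ * a := by
    refine s1.trans ((mul_le_mul_of_nonneg_left inv1' hdx.le).trans ?_)
    have := mul_le_mul_of_nonneg_right hD₂' ha0
    change 𝒯.dx i * _ ≤ _
    linarith
  have s3 : (2 * D₂)⁻¹ * ∫ x in 𝒯.cell i, ramp u y α β (𝒯.t m, x) ⬝ᵥ ramp u y α β (𝒯.t m, x) ≤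
      a / 2 := by
    rw [inv_mul_le_iff₀ (by positivity)]
    linarith
  rw [e1, e2]
  linarith

end IsDiscretization

end SpaceTimeMesh

/-! ### Upstream decay of the residuals across one cell. -/

namespace SpaceTimeMesh

variable {T xL xR : ℝ} {𝒯 : SpaceTimeMesh T xL xR}

/-- The residuals of the characteristic variables of speed `s` over the `i`-th cell. -/
noncomputable def localEnergy (𝒯 : SpaceTimeMesh T xL xR) (W₀ : ℝ → Fin 3 → ℝ)
    (Wh : ℕ → ℝ × ℝ → Fin 3 → ℝ) (p : ℕ → ℕ → ℝ × ℝ → Fin 3 → ℝ) (s : ℝ) (i : ℕ) : ℝ :=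
  ∑ m ∈ Finset.range 𝒯.M,
    (𝒯.h * (∫ z in 𝒯.elem m i, maxwellOp (fun z => chProj s (p m i z)) z ⬝ᵥ
        maxwellOp (fun z => chProj s (p m i z)) z) +
      ∫ x in 𝒯.cell i, chProj s (𝒯.jump W₀ Wh m x) ⬝ᵥ chProj s (𝒯.jump W₀ Wh m x))

theorem localEnergy_nonneg (hT : 0 < T) (hx : xL < xR) (W₀ : ℝ → Fin 3 → ℝ)
    (Wh : ℕ → ℝ × ℝ → Fin 3 → ℝ) (p : ℕ → ℕ → ℝ × ℝ → Fin 3 → ℝ) (s : ℝ) (i : ℕ) :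
    0 ≤ 𝒯.localEnergy W₀ Wh p s i :=
  Finset.sum_nonneg fun _ _ => add_nonneg (mul_nonneg (𝒯.h_pos hT hx).le
    (integral_dotProduct_self_nonneg _)) (integral_dotProduct_self_nonneg _)

/-- The inverse inequalities in time with constant `C`. -/
def TimeInverseInequality (k : ℕ) (C : ℝ) : Prop :=
  ∀ u : ℝ × ℝ → Fin 3 → ℝ, (∀ j, IsTensorPoly k fun z => u z j) →
    ∀ y a b : ℝ, a < b →
    (b - a) * (u (a, y) ⬝ᵥ u (a, y)) ≤ C * ∫ t in Set.Ioo a b, u (t, y) ⬝ᵥ u (t, y) ∧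
    (b - a) ^ 2 * ∫ t in Set.Ioo a b, timeDeriv u (t, y) ⬝ᵥ timeDeriv u (t, y) ≤
      C * ∫ t in Set.Ioo a b, u (t, y) ⬝ᵥ u (t, y)

/-- The constant in the upstream decay of the residuals. -/
noncomputable def decayConst (σ κ Ci : ℝ) : ℝ :=
  (4 + 4 * κ ^ 2 + 4 * κ ^ 2 * Ci / σ ^ 2 + Ci / σ) * (κ⁻¹ + 2)

theorem decayConst_pos {σ κ Ci : ℝ} (hσ : 0 < σ) (hκ : 0 < κ) (hCi : 0 < Ci) :
    0 < decayConst σ κ Ci := by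
  unfold decayConst; positivity

section

variable {k : ℕ} {κ σ Ci : ℝ} {b : ℝ × ℝ → Fin 4 → ℝ} {W₀ : ℝ → Fin 3 → ℝ}
  {Wh : ℕ → ℝ × ℝ → Fin 3 → ℝ} {p : ℕ → ℕ → ℝ × ℝ → Fin 3 → ℝ}

/-- The test function: the projected solution on the elements over the cells in `A`, cut off over
the cell `r`. -/
noncomputable def cutoffPiece (p : ℕ → ℕ → ℝ × ℝ → Fin 3 → ℝ) (s : ℝ) (A : Finset ℕ) (r : ℕ)
    (y α β : ℝ) (m i : ℕ) : ℝ × ℝ → Fin 3 → ℝ :=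
  if i ∈ A then fun z => chProj s (p m i z)
  else if i = r then ramp (fun z => chProj s (p m i z)) y α β else fun _ => 0

theorem maxwellOp_zero (z : ℝ × ℝ) : maxwellOp (fun _ => 0) z = 0 := by
  simp [maxwellOp, timeDeriv, spaceDeriv]

/-- Test with `P_s W^h` over `A`, switched off across the neighbouring cell `r`. Over `A` the energy
identity yields the residuals plus half the flux leaving `A` into `r`, and `hlat` says that no other
lateral flux remains. The switching-off costs residuals in `r` plus at most the same half flux,
which cancels. The time terms telescope, with zero initial energy over `A`. -/
theorem IsDiscretization.dx_mul_sum_localEnergy_le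
    (h : 𝒯.IsDiscretization k (κ * 𝒯.h) b W₀ Wh p) (hT : 0 < T) (hx : xL < xR)
    (hσ : 0 < σ) (hκ : 0 < κ) (hcmp : 𝒯.TimeStepsComparable σ) (hCi : 0 < Ci)
    (hinv : TimeInverseInequality k Ci) {s : ℝ} (hs : s = 1 ∨ s = -1)
    {A : Finset ℕ} {r : ℕ} (hA : A ⊆ Finset.range 𝒯.N) (hr : r < 𝒯.N) (hrA : r ∉ A)
    {y α β : ℝ} (hρ : ∀ x ∈ 𝒯.cell r, (α + β * x) ^ 2 ≤ 1) (hβ : β ^ 2 * 𝒯.dx r ^ 2 ≤ 1)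
    {g : ℕ → ℝ × ℝ → Fin 3 → ℝ} (hg : 𝒯.IsPieces k g (cutoffPiece p s A r y α β))
    (hb : ∀ m < 𝒯.M, ∀ i, i ∈ A ∨ i = r → ∀ᵐ z ∂(volume.restrict (𝒯.elem m i)), b z = 0)
    (hW₀ : ∀ i ∈ A, ∀ᵐ y ∂(volume.restrict (𝒯.cell i)), W₀ y = 0)
    (hlat : ∀ m < 𝒯.M, ∑ i ∈ A, s * ∫ t in Set.Ioo (𝒯.t m) (𝒯.t (m + 1)),
        (chProj s (p m i (t, 𝒯.x (i + 1))) ⬝ᵥ chProj s (p m i (t, 𝒯.x (i + 1))) -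
          chProj s (p m i (t, 𝒯.x i)) ⬝ᵥ chProj s (p m i (t, 𝒯.x i))) =
      ∫ t in Set.Ioo (𝒯.t m) (𝒯.t (m + 1)), chProj s (p m r (t, y)) ⬝ᵥ
        chProj s (p m r (t, y))) :
    𝒯.dx r * ∑ i ∈ A, 𝒯.localEnergy W₀ Wh p s i ≤
      decayConst σ κ Ci * 𝒯.h * 𝒯.localEnergy W₀ Wh p s r := by
  have hH := 𝒯.h_pos hT hx
  set H := 𝒯.h with hHdef
  have hdx := 𝒯.dx_pos hr
  have hdxH : 𝒯.dx r ≤ H := 𝒯.dx_le_h hT hr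
  set l := 𝒯.dx r with hl
  set L : ℕ → ℕ → ℝ := fun m i => ∫ z in 𝒯.elem m i, maxwellOp (fun z => chProj s (p m i z)) z ⬝ᵥ
        maxwellOp (fun z => chProj s (p m i z)) z with hLdef
  set J : ℕ → ℕ → ℝ := fun m i =>
    ∫ x in 𝒯.cell i, chProj s (𝒯.jump W₀ Wh m x) ⬝ᵥ chProj s (𝒯.jump W₀ Wh m x) with hJdef
  set c : ℕ → ℝ := fun m => ∑ i ∈ A, ∫ y in 𝒯.cell i, chProj s (𝒯.traceBelow W₀ Wh m y) ⬝ᵥ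
          chProj s (𝒯.traceBelow W₀ Wh m y) with hc
  have hL0 : ∀ m i, 0 ≤ L m i := fun m i => integral_dotProduct_self_nonneg _
  have hJ0 : ∀ m i, 0 ≤ J m i := fun m i => integral_dotProduct_self_nonneg _
  set D : ℝ := (4 + 4 * κ ^ 2 + 4 * κ ^ 2 * Ci / σ ^ 2) * (H ^ 2 / l) with hDdef
  set D₂ : ℝ := Ci / σ * (H / l) with hD₂def
  have hD : 0 < D := by positivity
  have hD₂ : 0 < D₂ := by positivity
  have hl1 : l ≤ H ^ 2 / l := by
    rw [le_div_iff₀ hdx]; nlinarith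
  have hslab : ∀ m ∈ Finset.range 𝒯.M,
      (∑ i ∈ A, (κ * H * L m i + J m i / 2)) + (c (m + 1) - c m) / 2 ≤
        D * L m r + D₂ * J m r := by
    intro m hm
    have hm := Finset.mem_range.1 hm
    have hdt : σ * H ≤ 𝒯.dt m := hcmp m hm
    have hσH : 0 < σ * H := by positivity
    have hD' : 4 * l + 4 * (κ * H) ^ 2 / l + 4 * (κ * H) ^ 2 * l * (Ci / 𝒯.dt m ^ 2) ≤ D := by
      have e1 : 4 * (κ * H) ^ 2 * l * (Ci / 𝒯.dt m ^ 2) ≤ 4 * κ ^ 2 * Ci / σ ^ 2 * (H ^ 2 / l) := by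
        calc 4 * (κ * H) ^ 2 * l * (Ci / 𝒯.dt m ^ 2)
            ≤ 4 * (κ * H) ^ 2 * l * (Ci / (σ * H) ^ 2) := by gcongr
          _ = 4 * κ ^ 2 * Ci / σ ^ 2 * l := by field_simp
          _ ≤ _ := by gcongr
      have e2 : 4 * (κ * H) ^ 2 / l = 4 * κ ^ 2 * (H ^ 2 / l) := by ring
      rw [e2, hDdef]
      linarith
    have hD₂' : l * (Ci / 𝒯.dt m) ≤ D₂ := by
      calc l * (Ci / 𝒯.dt m) ≤ l * (Ci / (σ * H)) := by gcongr
        _ = Ci / σ * (l / H) := by field_simp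
        _ ≤ Ci / σ * (H / l) := by
          refine mul_le_mul_of_nonneg_left ?_ (by positivity)
          rw [div_le_div_iff₀ hH hdx]; nlinarith
    have gal := h.galerkin hg hm
    have hcut := h.cutoff_element_le hs hm hr (hb m hm r (Or.inr rfl)) hρ hβ hinv hD hD₂ hD' hD₂'
      (y := y)
    have hint := fun i (hi : i ∈ A) => h.interior_energy hs hm (Finset.mem_range.1 (hA hi))
      (hb m hm i (Or.inl hi))
    set G : ℕ → ℝ := fun i => (∫ z in 𝒯.elem m i, (b z - maxwellOp (p m i) z) ⬝ᵥ
        (hatVec (cutoffPiece p s A r y α β m i z) +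
          (κ * H) • maxwellOp (cutoffPiece p s A r y α β m i) z)) -
      ∫ x in 𝒯.cell i, 𝒯.jump W₀ Wh m x ⬝ᵥ cutoffPiece p s A r y α β m i (𝒯.t m, x) with hG
    -- Galerkin orthogonality in the slab. Outside `A` and `r` the test function vanishes.
    have hG0 : ∑ i ∈ Finset.range 𝒯.N, G i = 0 := by
      simp only [hG, Finset.sum_sub_distrib]
      rw [gal, sub_self]
    have hGsplit : ∑ i ∈ Finset.range 𝒯.N, G i = (∑ i ∈ A, G i) + G r := by
      have hins : insert r A ⊆ Finset.range 𝒯.N :=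
        Finset.insert_subset (Finset.mem_range.2 hr) hA
      rw [← Finset.sum_subset hins, Finset.sum_insert hrA, add_comm]
      intro i _ hi
      rw [Finset.mem_insert, not_or] at hi
      simp only [hG, cutoffPiece, if_neg hi.1, if_neg hi.2, hatVec_zero, maxwellOp_zero,
        smul_zero, add_zero, dotProduct_zero, integral_zero, sub_zero]
    have hGr : G r ≤ D * L m r + D₂ * J m r +
      (∫ t in Set.Ioo (𝒯.t m) (𝒯.t (m + 1)), chProj s (p m r (t, y)) ⬝ᵥ
        chProj s (p m r (t, y))) / 2 := by
      simpa only [hG, cutoffPiece, if_neg hrA, if_true] using hcut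
    have hGA : ∑ i ∈ A, G i = -((c (m + 1) - c m) / 2) -
        (∫ t in Set.Ioo (𝒯.t m) (𝒯.t (m + 1)), chProj s (p m r (t, y)) ⬝ᵥ
          chProj s (p m r (t, y))) / 2 - ∑ i ∈ A, (κ * H * L m i + J m i / 2) := by
      rw [← hlat m hm]
      simp only [hc, ← Finset.sum_sub_distrib, Finset.sum_div, ← Finset.sum_neg_distrib]
      refine Finset.sum_congr rfl fun i hi => ?_
      have := hint i hi
      simp only [hG, cutoffPiece, if_pos hi]
      rw [this]
      simp only [hLdef, hJdef]
      ring
    linarith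
  have hsum := Finset.sum_le_sum hslab
  rw [Finset.sum_add_distrib, ← Finset.sum_div, Finset.sum_range_sub] at hsum
  have hcM : 0 ≤ c 𝒯.M := Finset.sum_nonneg fun i _ => integral_dotProduct_self_nonneg _
  have hc0 : c 0 = 0 := by
    refine Finset.sum_eq_zero fun i hi => ?_
    rw [integral_congr_ae (g := fun _ => 0), integral_zero]
    filter_upwards [hW₀ i hi] with y hy
    simp only [traceBelow, hy, chProj_zero, dotProduct_zero]
  -- The factor `κ⁻¹ + 2` undoes the weights `κ` and `1 / 2` that the method gives to the interior
  -- and jump residuals.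
  have hA1 : ∑ i ∈ A, 𝒯.localEnergy W₀ Wh p s i ≤
      (κ⁻¹ + 2) * ∑ m ∈ Finset.range 𝒯.M, ∑ i ∈ A, (κ * H * L m i + J m i / 2) := by
    rw [Finset.sum_comm, Finset.mul_sum]
    refine Finset.sum_le_sum fun i _ => ?_
    rw [Finset.mul_sum]
    refine Finset.sum_le_sum fun m _ => ?_
    change H * L m i + J m i ≤ _
    have e : (κ⁻¹ + 2) * (κ * H * L m i + J m i / 2) =
        H * L m i + J m i + (2 * κ * (H * L m i) + κ⁻¹ * J m i / 2) := by
      field_simp; ring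
    have := hL0 m i
    have := hJ0 m i
    have : 0 ≤ 2 * κ * (H * L m i) + κ⁻¹ * J m i / 2 := by positivity
    linarith
  have hr1 : ∑ m ∈ Finset.range 𝒯.M, (D * L m r + D₂ * J m r) ≤
      (4 + 4 * κ ^ 2 + 4 * κ ^ 2 * Ci / σ ^ 2 + Ci / σ) * (H / l) *
        𝒯.localEnergy W₀ Wh p s r := by
    rw [localEnergy, Finset.mul_sum]
    refine Finset.sum_le_sum fun m _ => ?_
    change _ ≤ _ * (H * L m r + J m r)
    have e : (4 + 4 * κ ^ 2 + 4 * κ ^ 2 * Ci / σ ^ 2 + Ci / σ) * (H / l) * (H * L m r + J m r) =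
        D * L m r + D₂ * J m r + (Ci / σ * (H / l) * (H * L m r) +
          (4 + 4 * κ ^ 2 + 4 * κ ^ 2 * Ci / σ ^ 2) * (H / l) * J m r) := by
      rw [hDdef, hD₂def]; ring
    have := hL0 m r
    have := hJ0 m r
    have : 0 ≤ Ci / σ * (H / l) * (H * L m r) +
          (4 + 4 * κ ^ 2 + 4 * κ ^ 2 * Ci / σ ^ 2) * (H / l) * J m r := by positivity
    linarith
  have hfin : ∑ i ∈ A, 𝒯.localEnergy W₀ Wh p s i ≤ (κ⁻¹ + 2) *
      ((4 + 4 * κ ^ 2 + 4 * κ ^ 2 * Ci / σ ^ 2 + Ci / σ) * (H / l) *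
        𝒯.localEnergy W₀ Wh p s r) := by
    refine hA1.trans (mul_le_mul_of_nonneg_left ?_ (by positivity))
    linarith
  calc l * ∑ i ∈ A, 𝒯.localEnergy W₀ Wh p s i ≤ l * ((κ⁻¹ + 2) *
      ((4 + 4 * κ ^ 2 + 4 * κ ^ 2 * Ci / σ ^ 2 + Ci / σ) * (H / l) *
        𝒯.localEnergy W₀ Wh p s r)) := mul_le_mul_of_nonneg_left hfin hdx.le
    _ = _ := by
      unfold decayConst
      field_simp

/-- The lateral fluxes of the projected solution, element by element. -/
theorem IsPieces.exists_flux (hp : 𝒯.IsPieces k Wh p) (s : ℝ) {m : ℕ} (hm : m < 𝒯.M) :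
    ∃ a : ℕ → ℝ, a 0 = 0 ∧ a 𝒯.N = 0 ∧ ∀ i < 𝒯.N,
      (∫ t in Set.Ioo (𝒯.t m) (𝒯.t (m + 1)),
        (chProj s (p m i (t, 𝒯.x (i + 1))) ⬝ᵥ chProj s (p m i (t, 𝒯.x (i + 1))) -
          chProj s (p m i (t, 𝒯.x i)) ⬝ᵥ chProj s (p m i (t, 𝒯.x i))) = a (i + 1) - a i) ∧
      (∫ t in Set.Ioo (𝒯.t m) (𝒯.t (m + 1)),
        chProj s (p m i (t, 𝒯.x i)) ⬝ᵥ chProj s (p m i (t, 𝒯.x i)) = a i) ∧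
      (∫ t in Set.Ioo (𝒯.t m) (𝒯.t (m + 1)),
        chProj s (p m i (t, 𝒯.x (i + 1))) ⬝ᵥ chProj s (p m i (t, 𝒯.x (i + 1))) = a (i + 1)) := by
  refine ⟨fun i => ∫ t in Set.Ioo (𝒯.t m) (𝒯.t (m + 1)),
    chProj s (Wh m (t, 𝒯.x i)) ⬝ᵥ chProj s (Wh m (t, 𝒯.x i)), ?_, ?_, fun i hi => ?_⟩
  · beta_reduce
    rw [𝒯.x_zero, setIntegral_congr_fun (g := fun _ => 0) measurableSet_Ioo fun t ht => ?_]
    · simp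
    · simp only [hp.left m hm t (Set.Ioo_subset_Icc_self ht), chProj_zero, zero_dotProduct]
  · beta_reduce
    rw [𝒯.x_last, setIntegral_congr_fun (g := fun _ => 0) measurableSet_Ioo fun t ht => ?_]
    · simp
    · simp only [hp.right m hm t (Set.Ioo_subset_Icc_self ht), chProj_zero, zero_dotProduct]
  · have hxi := (𝒯.x_lt i hi).le
    have hu := (contDiff_chProj s (hp.contDiff hm hi)).continuous
    have e1 : ∫ t in Set.Ioo (𝒯.t m) (𝒯.t (m + 1)),
        chProj s (p m i (t, 𝒯.x i)) ⬝ᵥ chProj s (p m i (t, 𝒯.x i)) =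
        ∫ t in Set.Ioo (𝒯.t m) (𝒯.t (m + 1)),
          chProj s (Wh m (t, 𝒯.x i)) ⬝ᵥ chProj s (Wh m (t, 𝒯.x i)) := by
      refine setIntegral_congr_fun measurableSet_Ioo fun t ht => ?_
      simp only [hp.eq m hm i hi (t, 𝒯.x i) ⟨Set.Ioo_subset_Icc_self ht, le_rfl, hxi⟩]
    have e2 : ∫ t in Set.Ioo (𝒯.t m) (𝒯.t (m + 1)),
        chProj s (p m i (t, 𝒯.x (i + 1))) ⬝ᵥ chProj s (p m i (t, 𝒯.x (i + 1))) =
        ∫ t in Set.Ioo (𝒯.t m) (𝒯.t (m + 1)),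
          chProj s (Wh m (t, 𝒯.x (i + 1))) ⬝ᵥ chProj s (Wh m (t, 𝒯.x (i + 1))) := by
      refine setIntegral_congr_fun measurableSet_Ioo fun t ht => ?_
      simp only [hp.eq m hm i hi (t, 𝒯.x (i + 1)) ⟨Set.Ioo_subset_Icc_self ht, hxi, le_rfl⟩]
    refine ⟨?_, e1, e2⟩
    beta_reduce
    rw [← e1, ← e2]
    have hcy : ∀ y, IntegrableOn (fun t => chProj s (p m i (t, y)) ⬝ᵥ chProj s (p m i (t, y)))
        (Set.Ioo (𝒯.t m) (𝒯.t (m + 1))) := fun y => Continuous.integrableOn_Ioo'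
      (continuous_dotProduct' (hu.comp (g := fun z => chProj s (p m i z)) (by fun_prop))
        (hu.comp (g := fun z => chProj s (p m i z)) (by fun_prop))) _ _
    exact integral_sub (hcy _) (hcy _)

theorem IsPieces.isTensorPoly_chProj (hp : 𝒯.IsPieces k Wh p) (s : ℝ) {m i : ℕ} (hm : m < 𝒯.M)
    (hi : i < 𝒯.N) (j : Fin 3) : IsTensorPoly k fun z => chProj s (p m i z) j := by
  have ht := hp.tensor m hm i hi
  fin_cases j
  · exact (ht 0).const_mul ((1 + s) / 2)
  · have := ((ht 1).add ((ht 2).const_mul s)).const_mul 2⁻¹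
    simpa [chProj, div_eq_inv_mul] using this
  · have := ((ht 2).add ((ht 1).const_mul s)).const_mul 2⁻¹
    simpa [chProj, div_eq_inv_mul] using this

theorem IsPieces.isTensorPoly_cutoffPiece (hp : 𝒯.IsPieces k Wh p) (hk : 1 ≤ k) (s : ℝ)
    (A : Finset ℕ) (r : ℕ) (y α β : ℝ) {m i : ℕ} (hm : m < 𝒯.M)
    (hi : i < 𝒯.N) (j : Fin 3) :
    IsTensorPoly k fun z => cutoffPiece p s A r y α β m i z j := by
  have h1 := hp.isTensorPoly_chProj s hm hi j
  unfold cutoffPiece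
  split_ifs
  · exact h1
  · exact h1.mul_affine hk y α β
  · exact IsTensorPoly.zero

/-- The function follows `P_s W^h` up to `x r`; from there its value at `x r` is carried on with a
factor falling from one to zero at `x (r + 1)`. It is continuous, vanishes at both ends of `Ωₓ`, and
keeps the polynomial degree because the value is frozen. -/
theorem IsPieces.cutoff_right (hp : 𝒯.IsPieces k Wh p) (hk : 1 ≤ k) (s : ℝ) {r : ℕ}
    (hr : r < 𝒯.N) :
    𝒯.IsPieces k (fun m z => if z.2 ≤ 𝒯.x r then chProj s (Wh m z) else
      if z.2 ≤ 𝒯.x (r + 1) then ramp (fun z => chProj s (p m r z)) (𝒯.x r)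
        (𝒯.x (r + 1) / 𝒯.dx r) (-1 / 𝒯.dx r) z else 0)
      (cutoffPiece p s (Finset.range r) r (𝒯.x r) (𝒯.x (r + 1) / 𝒯.dx r) (-1 / 𝒯.dx r)) := by
  have hlt := 𝒯.x_lt r hr
  have hdx := 𝒯.dx_pos hr
  have hdx' : 𝒯.x (r + 1) - 𝒯.x r = 𝒯.dx r := rfl
  have hend : ∀ m t, ramp (fun z => chProj s (p m r z)) (𝒯.x r)
        (𝒯.x (r + 1) / 𝒯.dx r) (-1 / 𝒯.dx r) (t, 𝒯.x (r + 1)) = 0 := by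
    intro m t
    have : 𝒯.x (r + 1) / 𝒯.dx r + -1 / 𝒯.dx r * 𝒯.x (r + 1) = 0 := by ring
    simp only [ramp, this, zero_smul]
  refine ⟨fun m hm i hi j => hp.isTensorPoly_cutoffPiece hk s _ _ _ _ _ hm hi j, ?_, ?_, ?_⟩
  · intro m hm i hi z hz
    unfold cutoffPiece
    rcases lt_trichotomy i r with hir | rfl | hir
    · have h1 : z.2 ≤ 𝒯.x r := hz.2.2.trans (𝒯.x_mono hir hr.le)
      simp only [if_pos h1, if_pos (Finset.mem_range.2 hir), hp.eq m hm i hi z hz]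
    · simp only [Finset.mem_range, lt_irrefl, if_false, if_true, if_pos hz.2.2]
      by_cases h1 : z.2 ≤ 𝒯.x i
      · have h2 : z.2 = 𝒯.x i := le_antisymm h1 hz.2.1
        have h3 : 𝒯.x (i + 1) / 𝒯.dx i + -1 / 𝒯.dx i * z.2 = 1 := by
          rw [h2]
          field_simp
          linarith
        rw [if_pos h1, hp.eq m hm i hi z hz]
        simp only [ramp, h3, one_smul]
        rw [← h2]
      · rw [if_neg h1]
    · have h0 : 𝒯.x (r + 1) ≤ z.2 := (𝒯.x_mono hir hi.le).trans hz.2.1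
      have h1 : ¬ z.2 ≤ 𝒯.x r := by linarith
      simp only [if_neg h1, Finset.mem_range, not_lt.2 hir.le, if_false, hir.ne']
      split_ifs with h2
      · have h3 : z = (z.1, 𝒯.x (r + 1)) := Prod.ext rfl (le_antisymm h2 h0)
        rw [h3]
        exact hend m z.1
      · rfl
  · intro m hm t ht
    have h1 : xL ≤ 𝒯.x r := 𝒯.le_x hr.le
    simp only [if_pos h1, hp.left m hm t ht, chProj_zero]
  · intro m hm t ht
    have h0 : 𝒯.x (r + 1) ≤ xR := 𝒯.x_le hr
    have h1 : ¬ xR ≤ 𝒯.x r := by linarith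
    simp only [if_neg h1]
    split_ifs with h2
    · have h3 : ((t, xR) : ℝ × ℝ) = (t, 𝒯.x (r + 1)) := Prod.ext rfl (le_antisymm h2 h0)
      exact (congrArg _ h3).trans (hend m t)
    · rfl

/-- The mirror image, for energy that travels to the left: the factor rises from zero to one across
the cell `r`. -/
theorem IsPieces.cutoff_left (hp : 𝒯.IsPieces k Wh p) (hk : 1 ≤ k) (s : ℝ) {r : ℕ}
    (hr : r < 𝒯.N) :
    𝒯.IsPieces k (fun m z => if 𝒯.x (r + 1) ≤ z.2 then chProj s (Wh m z) else
      if 𝒯.x r ≤ z.2 then ramp (fun z => chProj s (p m r z)) (𝒯.x (r + 1))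
        (-𝒯.x r / 𝒯.dx r) (1 / 𝒯.dx r) z else 0)
      (cutoffPiece p s (Finset.Ico (r + 1) 𝒯.N) r (𝒯.x (r + 1)) (-𝒯.x r / 𝒯.dx r)
        (1 / 𝒯.dx r)) := by
  have hlt := 𝒯.x_lt r hr
  have hdx := 𝒯.dx_pos hr
  have hdx' : 𝒯.x (r + 1) - 𝒯.x r = 𝒯.dx r := rfl
  have hend : ∀ m t, ramp (fun z => chProj s (p m r z)) (𝒯.x (r + 1))
        (-𝒯.x r / 𝒯.dx r) (1 / 𝒯.dx r) (t, 𝒯.x r) = 0 := by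
    intro m t
    have : -𝒯.x r / 𝒯.dx r + 1 / 𝒯.dx r * 𝒯.x r = 0 := by ring
    simp only [ramp, this, zero_smul]
  refine ⟨fun m hm i hi j => hp.isTensorPoly_cutoffPiece hk s _ _ _ _ _ hm hi j, ?_, ?_, ?_⟩
  · intro m hm i hi z hz
    unfold cutoffPiece
    rcases lt_trichotomy i r with hir | rfl | hir
    · have h0 : z.2 ≤ 𝒯.x r := hz.2.2.trans (𝒯.x_mono hir hr.le)
      have h1 : ¬ 𝒯.x (r + 1) ≤ z.2 := by linarith
      have h2 : i ∉ Finset.Ico (r + 1) 𝒯.N := by simp; omega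
      simp only [if_neg h1, if_neg h2, hir.ne, if_false]
      split_ifs with h3
      · have h4 : z = (z.1, 𝒯.x r) := Prod.ext rfl (le_antisymm h0 h3)
        rw [h4]
        exact hend m z.1
      · rfl
    · have h2 : i ∉ Finset.Ico (i + 1) 𝒯.N := by simp
      simp only [if_neg h2, if_true, if_pos hz.2.1]
      by_cases h1 : 𝒯.x (i + 1) ≤ z.2
      · have h2 : z.2 = 𝒯.x (i + 1) := le_antisymm hz.2.2 h1
        have h3 : -𝒯.x i / 𝒯.dx i + 1 / 𝒯.dx i * z.2 = 1 := by
          rw [h2]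
          field_simp
          linarith
        rw [if_pos h1, hp.eq m hm i hi z hz]
        simp only [ramp, h3, one_smul]
        rw [← h2]
      · rw [if_neg h1]
    · have h1 : 𝒯.x (r + 1) ≤ z.2 := (𝒯.x_mono hir hi.le).trans hz.2.1
      have h2 : i ∈ Finset.Ico (r + 1) 𝒯.N := Finset.mem_Ico.2 ⟨hir, hi⟩
      simp only [if_pos h1, if_pos h2, hp.eq m hm i hi z hz]
  · intro m hm t ht
    have h0 : xL ≤ 𝒯.x r := 𝒯.le_x hr.le
    have h1 : ¬ 𝒯.x (r + 1) ≤ xL := by linarith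
    simp only [if_neg h1]
    split_ifs with h2
    · have h3 : ((t, xL) : ℝ × ℝ) = (t, 𝒯.x r) := Prod.ext rfl (le_antisymm h0 h2)
      exact (congrArg _ h3).trans (hend m t)
    · rfl
  · intro m hm t ht
    have h1 : 𝒯.x (r + 1) ≤ xR := 𝒯.x_le hr
    simp only [if_pos h1, hp.right m hm t ht, chProj_zero]

end

end SpaceTimeMesh

/-! ### From one cell to a boundary layer. -/

/-- A discrete form of `S ≤ D S'` with `S` increasing: bound `S` below by its first value and sum
the increments. The gain per strip, `D` over its length, does not depend on how the strip is
subdivided. -/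
theorem sub_mul_le_of_forall_succ {x S : ℕ → ℝ} {D : ℝ} {q n : ℕ} (hq : q ≤ n)
    (hx : ∀ i < n, x i ≤ x (i + 1)) (hS : ∀ i < q, S i ≤ S (i + 1))
    (h : ∀ r < q, (x (r + 1) - x r) * S r ≤ D * (S (r + 1) - S r)) {p : ℕ} (hp : p ≤ q) :
    (x q - x p) * S p ≤ D * (S q - S p) := by
  induction q with
  | zero =>
    obtain rfl : p = 0 := by omega
    simp
  | succ q ih =>
    rcases hp.lt_or_eq with hlt | rfl
    · have h1 := ih (by omega) (fun i hi => hS i (by omega)) (fun r hr => h r (by omega))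
        (by omega)
      have h2 := h q (by omega)
      have h3 : S p ≤ S q := by
        clear h1 h2 ih h
        induction q with
        | zero => obtain rfl : p = 0 := by omega
                  exact le_rfl
        | succ q ih =>
          rcases (Nat.lt_succ_iff.1 hlt).lt_or_eq with h4 | rfl
          · exact (ih (by omega) (fun i hi => hS i (by omega)) (by omega) h4).trans
              (hS q (by omega))
          · exact le_rfl
      have h4 := mul_le_mul_of_nonneg_left h3 (sub_nonneg.2 (hx q (by omega)))
      linarith
    · simp

/-- The same for a decreasing sequence, used for sums taken from the right end. -/
theorem sub_mul_le_of_forall_pred {x S : ℕ → ℝ} {D : ℝ} {q p : ℕ} (hqp : q ≤ p)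
    (hx : ∀ i < p, x i ≤ x (i + 1)) (hS : ∀ i, q ≤ i → i < p → S (i + 1) ≤ S i)
    (h : ∀ r, q ≤ r → r < p → (x (r + 1) - x r) * S (r + 1) ≤ D * (S r - S (r + 1))) :
    (x p - x q) * S p ≤ D * (S q - S p) := by
  induction p, hqp using Nat.le_induction with
  | base => simp
  | succ p hqp ih =>
    have h1 := ih (fun i hi => hx i (by omega)) (fun i hi hi' => hS i hi (by omega))
      (fun r hr hr' => h r hr (by omega))
    have h2 := h p hqp (by omega)
    have h3 := hS p hqp (by omega)
    have h4 : x q ≤ x p := by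
      clear ih h1 h2 h3 h hS
      induction p, hqp using Nat.le_induction with
      | base => exact le_rfl
      | succ p hqp ih => exact (ih fun i hi => hx i (by omega)).trans (hx p (by omega))
    have h5 := mul_le_mul_of_nonneg_left h3 (sub_nonneg.2 h4)
    linarith

namespace SpaceTimeMesh

variable {T xL xR : ℝ} {𝒯 : SpaceTimeMesh T xL xR}

/-- Every point lies in one of the half-open cells. -/
theorem exists_cell (𝒯 : SpaceTimeMesh T xL xR) {a : ℝ} (ha : a ∈ Set.Ico xL xR) :
    ∃ i < 𝒯.N, 𝒯.x i ≤ a ∧ a < 𝒯.x (i + 1) := by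
  have hex : ∃ j, a < 𝒯.x j := ⟨𝒯.N, by rw [𝒯.x_last]; exact ha.2⟩
  classical
  have h1 := Nat.find_spec hex
  have h2 : Nat.find hex ≤ 𝒯.N := Nat.find_min' hex (by rw [𝒯.x_last]; exact ha.2)
  have h3 : Nat.find hex ≠ 0 := by
    intro h0
    rw [h0, 𝒯.x_zero] at h1
    exact absurd h1 (not_lt.2 ha.1)
  obtain ⟨i, hi⟩ := Nat.exists_eq_succ_of_ne_zero h3
  rw [hi] at h1 h2
  exact ⟨i, by omega, not_lt.1 (Nat.find_min hex (by omega)), h1⟩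

/-- The residuals over the `i`-th cell. -/
noncomputable def residualEnergy (𝒯 : SpaceTimeMesh T xL xR) (b : ℝ × ℝ → Fin 4 → ℝ)
    (W₀ : ℝ → Fin 3 → ℝ) (Wh : ℕ → ℝ × ℝ → Fin 3 → ℝ) (p : ℕ → ℕ → ℝ × ℝ → Fin 3 → ℝ)
    (i : ℕ) : ℝ :=
  ∑ m ∈ Finset.range 𝒯.M,
    (𝒯.h * (∫ z in 𝒯.elem m i, (b z - maxwellOp (p m i) z) ⬝ᵥ (b z - maxwellOp (p m i) z)) +
      ∫ x in 𝒯.cell i, 𝒯.jump W₀ Wh m x ⬝ᵥ 𝒯.jump W₀ Wh m x)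

theorem residualEnergy_nonneg (hT : 0 < T) (hx : xL < xR) (b : ℝ × ℝ → Fin 4 → ℝ)
    (W₀ : ℝ → Fin 3 → ℝ)
    (Wh : ℕ → ℝ × ℝ → Fin 3 → ℝ) (p : ℕ → ℕ → ℝ × ℝ → Fin 3 → ℝ) (i : ℕ) :
    0 ≤ 𝒯.residualEnergy b W₀ Wh p i :=
  Finset.sum_nonneg fun _ _ => add_nonneg (mul_nonneg (𝒯.h_pos hT hx).le
    (integral_dotProduct_self_nonneg _)) (integral_dotProduct_self_nonneg _)

namespace IsDiscretization

variable {k : ℕ} {κ σ Ci δ : ℝ} {b : ℝ × ℝ → Fin 4 → ℝ} {W₀ : ℝ → Fin 3 → ℝ}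
  {Wh : ℕ → ℝ × ℝ → Fin 3 → ℝ} {p : ℕ → ℕ → ℝ × ℝ → Fin 3 → ℝ}

/-- Where `b = 0` the interior residual is `-L W^h`, with `L` the Maxwell operator, and passing to
the part of speed `s` increases neither this nor the jumps. -/
theorem localEnergy_le_residualEnergy (h : 𝒯.IsDiscretization k δ b W₀ Wh p) (hT : 0 < T)
    (hx : xL < xR) {s : ℝ} (hs : s = 1 ∨ s = -1) {i : ℕ} (hi : i < 𝒯.N)
    (hb : ∀ m < 𝒯.M, ∀ᵐ z ∂(volume.restrict (𝒯.elem m i)), b z = 0) :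
    𝒯.localEnergy W₀ Wh p s i ≤ 𝒯.residualEnergy b W₀ Wh p i := by
  refine Finset.sum_le_sum fun m hm => ?_
  have hm := Finset.mem_range.1 hm
  have hp := h.pieces.contDiff hm hi
  refine add_le_add (mul_le_mul_of_nonneg_left ?_ (𝒯.h_pos hT hx).le) ?_
  · have mU := 𝒯.memLp_elem (contDiff_maxwellOp (contDiff_chProj s hp)).continuous m i
    have mR := h.memLp_residual hm hi
    refine integral_mono_ae (MemLp.integrable_dotProduct mU mU)
      (MemLp.integrable_dotProduct mR mR) ?_
    filter_upwards [hb m hm] with z hz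
    simp only [hz, zero_sub, neg_dotProduct_neg]
    simp only [maxwellOp_eq, timeDeriv_chProj s hp, spaceDeriv_chProj s hp]
    exact maxwellRow_chProj_le hs _ _
  · have mJ := h.memLp_jump hm hi
    exact integral_mono (MemLp.integrable_dotProduct (mJ.chProj s) (mJ.chProj s))
      (MemLp.integrable_dotProduct mJ mJ) fun y => chProj_dotProduct_self_le hs _

theorem ae_elem_eq_zero {D : Set ℝ}
    (hb : ∀ᵐ z ∂(volume.restrict (spaceTimeDomain T xL xR)), z.2 ∉ D → b z = 0) {m i : ℕ}
    (hm : m < 𝒯.M) (hi : i < 𝒯.N) (hD : Disjoint (𝒯.cell i) D) :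
    ∀ᵐ z ∂(volume.restrict (𝒯.elem m i)), b z = 0 := by
  filter_upwards [ae_restrict_of_ae_restrict_of_subset (𝒯.elem_subset_domain hm hi) hb,
    ae_restrict_mem (𝒯.measurableSet_elem m i)] with z hz hz'
  exact hz (Set.disjoint_left.1 hD hz'.2)

theorem ae_cell_eq_zero {D : Set ℝ}
    (hW₀ : ∀ᵐ y ∂(volume.restrict (Set.Ioo xL xR)), y ∉ D → W₀ y = 0) {i : ℕ}
    (hi : i < 𝒯.N) (hD : Disjoint (𝒯.cell i) D) :
    ∀ᵐ y ∂(volume.restrict (𝒯.cell i)), W₀ y = 0 := by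
  filter_upwards [ae_restrict_of_ae_restrict_of_subset (𝒯.cell_subset hi) hW₀,
    ae_restrict_mem (𝒯.measurableSet_cell i)] with z hz hz'
  exact hz (Set.disjoint_left.1 hD hz')

/-- The decay of the right-going residuals towards the left boundary. -/
theorem dx_mul_sum_range_le (h : 𝒯.IsDiscretization k (κ * 𝒯.h) b W₀ Wh p) (hk : 1 ≤ k)
    (hT : 0 < T) (hx : xL < xR) (hσ : 0 < σ) (hκ : 0 < κ) (hcmp : 𝒯.TimeStepsComparable σ)
    (hCi : 0 < Ci) (hinv : TimeInverseInequality k Ci) {D : Set ℝ}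
    (hb : ∀ᵐ z ∂(volume.restrict (spaceTimeDomain T xL xR)), z.2 ∉ D → b z = 0)
    (hW₀ : ∀ᵐ y ∂(volume.restrict (Set.Ioo xL xR)), y ∉ D → W₀ y = 0) {r : ℕ} (hr : r < 𝒯.N)
    (hD : ∀ i ≤ r, Disjoint (𝒯.cell i) D) :
    𝒯.dx r * ∑ i ∈ Finset.range r, 𝒯.localEnergy W₀ Wh p 1 i ≤
      decayConst σ κ Ci * 𝒯.h * 𝒯.localEnergy W₀ Wh p 1 r := by
  have hdx := 𝒯.dx_pos hr
  have hdx' : 𝒯.x (r + 1) - 𝒯.x r = 𝒯.dx r := rfl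
  refine h.dx_mul_sum_localEnergy_le hT hx hσ hκ hcmp hCi hinv (Or.inl rfl)
    (Finset.range_subset_range.2 hr.le) hr (by simp) (fun y hy => ?_) ?_
    (h.pieces.cutoff_right hk 1 hr) ?_ ?_ ?_
  · have e : 𝒯.x (r + 1) / 𝒯.dx r + -1 / 𝒯.dx r * y = (𝒯.x (r + 1) - y) / 𝒯.dx r := by ring
    rw [e, sq_le_one_iff₀ (div_nonneg (sub_nonneg.2 hy.2.le) hdx.le), div_le_one hdx]
    linarith [hy.1]
  · field_simp; norm_num
  · rintro m hm i hi
    have hir : i ≤ r := hi.elim (fun h => (Finset.mem_range.1 h).le) fun h => h.le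
    exact ae_elem_eq_zero hb hm (hir.trans_lt hr) (hD i hir)
  · intro i hi
    have hir := Finset.mem_range.1 hi
    exact ae_cell_eq_zero hW₀ (hir.trans hr) (hD i hir.le)
  · intro m hm
    -- The fluxes over the cells left of `r` telescope. Nothing enters at `xL`, where `Wh` vanishes,
    -- so what remains is the flux into the cell `r`.
    obtain ⟨a, ha0, haN, ha⟩ := h.pieces.exists_flux 1 hm
    rw [(ha r hr).2.1]
    rw [Finset.sum_congr rfl fun i hi => by
      rw [(ha i ((Finset.mem_range.1 hi).trans hr)).1, one_mul], Finset.sum_range_sub, ha0,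
      sub_zero]

/-- The decay of the left-going residuals towards the right boundary. -/
theorem dx_mul_sum_Ico_le (h : 𝒯.IsDiscretization k (κ * 𝒯.h) b W₀ Wh p) (hk : 1 ≤ k)
    (hT : 0 < T) (hx : xL < xR) (hσ : 0 < σ) (hκ : 0 < κ) (hcmp : 𝒯.TimeStepsComparable σ)
    (hCi : 0 < Ci) (hinv : TimeInverseInequality k Ci) {D : Set ℝ}
    (hb : ∀ᵐ z ∂(volume.restrict (spaceTimeDomain T xL xR)), z.2 ∉ D → b z = 0)
    (hW₀ : ∀ᵐ y ∂(volume.restrict (Set.Ioo xL xR)), y ∉ D → W₀ y = 0) {r : ℕ} (hr : r < 𝒯.N)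
    (hD : ∀ i, r ≤ i → i < 𝒯.N → Disjoint (𝒯.cell i) D) :
    𝒯.dx r * ∑ i ∈ Finset.Ico (r + 1) 𝒯.N, 𝒯.localEnergy W₀ Wh p (-1) i ≤
      decayConst σ κ Ci * 𝒯.h * 𝒯.localEnergy W₀ Wh p (-1) r := by
  have hdx := 𝒯.dx_pos hr
  have hdx' : 𝒯.x (r + 1) - 𝒯.x r = 𝒯.dx r := rfl
  refine h.dx_mul_sum_localEnergy_le hT hx hσ hκ hcmp hCi hinv (Or.inr rfl)
    (fun i hi => Finset.mem_range.2 (Finset.mem_Ico.1 hi).2) hr (by simp) (fun y hy => ?_) ?_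
    (h.pieces.cutoff_left hk (-1) hr) ?_ ?_ ?_
  · have e : -𝒯.x r / 𝒯.dx r + 1 / 𝒯.dx r * y = (y - 𝒯.x r) / 𝒯.dx r := by ring
    rw [e, sq_le_one_iff₀ (div_nonneg (sub_nonneg.2 hy.1.le) hdx.le), div_le_one hdx]
    linarith [hy.2]
  · field_simp; norm_num
  · rintro m hm i hi
    have hir : r ≤ i ∧ i < 𝒯.N := by
      rcases hi with hi | rfl
      · have := Finset.mem_Ico.1 hi; omega
      · exact ⟨le_rfl, hr⟩
    exact ae_elem_eq_zero hb hm hir.2 (hD i hir.1 hir.2)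
  · intro i hi
    have hir := Finset.mem_Ico.1 hi
    exact ae_cell_eq_zero hW₀ hir.2 (hD i (by omega) hir.2)
  · intro m hm
    -- Here the vanishing flux is the one at `xR`, and the sign `s = -1` makes the flux into the
    -- cell `r` positive.
    obtain ⟨a, ha0, haN, ha⟩ := h.pieces.exists_flux (-1) hm
    rw [(ha r hr).2.2]
    rw [Finset.sum_congr rfl fun i hi => by
      rw [(ha i (Finset.mem_Ico.1 hi).2).1], ← Finset.mul_sum, Finset.sum_Ico_sub a hr, haN]
    ring

/-- Each strip of width at least `ε / 8` contributes one factor `H`. Two are needed, since the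
energy is quadratic in the residuals. -/
theorem le_sq_mul_of_two_steps {C H ε x y z d₁ d₂ : ℝ} (hε : 0 < ε) (hC : 0 < C) (hH : 0 < H)
    (hx : 0 ≤ x) (hy : 0 ≤ y) (hd₁ : ε / 8 ≤ d₁) (hd₂ : ε / 8 ≤ d₂)
    (h₁ : d₁ * x ≤ C * H * y) (h₂ : d₂ * y ≤ C * H * z) :
    x ≤ (8 * C / ε) ^ 2 * H ^ 2 * z := by
  have e₁ : x ≤ 8 * C / ε * H * y := by
    have : ε / 8 * x ≤ C * H * y := (mul_le_mul_of_nonneg_right hd₁ hx).trans h₁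
    rw [div_mul_eq_mul_div, div_mul_eq_mul_div, le_div_iff₀ hε]; linarith
  have e₂ : y ≤ 8 * C / ε * H * z := by
    have : ε / 8 * y ≤ C * H * z := (mul_le_mul_of_nonneg_right hd₂ hy).trans h₂
    rw [div_mul_eq_mul_div, div_mul_eq_mul_div, le_div_iff₀ hε]; linarith
  calc x ≤ 8 * C / ε * H * y := e₁
    _ ≤ 8 * C / ε * H * (8 * C / ε * H * z) := mul_le_mul_of_nonneg_left e₂ (by positivity)
    _ = _ := by ring

/-- Near the left boundary the right-going residuals are of higher order. -/
theorem exists_left_layer (h : 𝒯.IsDiscretization k (κ * 𝒯.h) b W₀ Wh p) (hk : 1 ≤ k)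
    (hT : 0 < T) (hx : xL < xR) (hσ : 0 < σ) (hκ : 0 < κ) (hcmp : 𝒯.TimeStepsComparable σ)
    (hCi : 0 < Ci) (hinv : TimeInverseInequality k Ci) {ε : ℝ} (hε : 0 < ε) (hεx : xL + ε ≤ xR)
    (hb : ∀ᵐ z ∂(volume.restrict (spaceTimeDomain T xL xR)),
      z.2 ∉ Set.Icc (xL + ε) (xR - ε) → b z = 0)
    (hW₀ : ∀ᵐ y ∂(volume.restrict (Set.Ioo xL xR)), y ∉ Set.Icc (xL + ε) (xR - ε) → W₀ y = 0)
    (hh : 𝒯.h < ε / 8) :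
    ∃ A ⊆ Finset.range 𝒯.N, (∀ i < 𝒯.N, i ∉ A → xL + ε / 4 ≤ 𝒯.x i) ∧
      (∀ m < 𝒯.M, ∀ i ∈ A, ∀ᵐ z ∂(volume.restrict (𝒯.elem m i)), b z = 0) ∧
      ∑ i ∈ A, 𝒯.localEnergy W₀ Wh p 1 i ≤ (8 * decayConst σ κ Ci / ε) ^ 2 * 𝒯.h ^ 2 *
        ∑ i ∈ Finset.range 𝒯.N, 𝒯.residualEnergy b W₀ Wh p i := by
  have hH := 𝒯.h_pos hT hx
  have hC := decayConst_pos hσ hκ hCi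
  set e := 𝒯.localEnergy W₀ Wh p 1 with he
  have he0 : ∀ i, 0 ≤ e i := 𝒯.localEnergy_nonneg hT hx W₀ Wh p 1
  -- Three cells at distances `ε / 4`, `ε / 2` and `3 ε / 4` from the end. As `h < ε / 8`, their
  -- right end points are at least `ε / 8` apart and all stay left of `xL + ε`, where data may
  -- begin.
  obtain ⟨i₁, hi₁, h1, h1'⟩ := 𝒯.exists_cell (a := xL + ε / 4) ⟨by linarith, by linarith⟩
  obtain ⟨i₂, hi₂, h2, h2'⟩ := 𝒯.exists_cell (a := xL + 2 * ε / 4) ⟨by linarith, by linarith⟩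
  obtain ⟨i₃, hi₃, h3, h3'⟩ := 𝒯.exists_cell (a := xL + 3 * ε / 4) ⟨by linarith, by linarith⟩
  have g1 : 𝒯.x (i₁ + 1) - 𝒯.x i₁ ≤ 𝒯.h := 𝒯.dx_le_h hT hi₁
  have g2 : 𝒯.x (i₂ + 1) - 𝒯.x i₂ ≤ 𝒯.h := 𝒯.dx_le_h hT hi₂
  have g3 : 𝒯.x (i₃ + 1) - 𝒯.x i₃ ≤ 𝒯.h := 𝒯.dx_le_h hT hi₃
  have o12 : i₁ ≤ i₂ := by
    by_contra hlt
    have := 𝒯.x_mono (show i₂ + 1 ≤ i₁ by omega) hi₁.le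
    linarith
  have o23 : i₂ ≤ i₃ := by
    by_contra hlt
    have := 𝒯.x_mono (show i₃ + 1 ≤ i₂ by omega) hi₂.le
    linarith
  have hdisj : ∀ i ≤ i₃, Disjoint (𝒯.cell i) (Set.Icc (xL + ε) (xR - ε)) := by
    intro i hi
    rw [Set.disjoint_left]
    intro y hy hy'
    have := 𝒯.x_mono (show i + 1 ≤ i₃ + 1 by omega) hi₃
    linarith [hy.2, hy'.1]
  have hmono : ∀ i < i₃ + 1, ∑ j ∈ Finset.range i, e j ≤ ∑ j ∈ Finset.range (i + 1), e j := by
    intro i _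
    rw [Finset.sum_range_succ]
    linarith [he0 i]
  have hstep : ∀ r < i₃ + 1, (𝒯.x (r + 1) - 𝒯.x r) * ∑ j ∈ Finset.range r, e j ≤
      decayConst σ κ Ci * 𝒯.h * (∑ j ∈ Finset.range (r + 1), e j - ∑ j ∈ Finset.range r, e j) := by
    intro r hr
    rw [Finset.sum_range_succ, add_sub_cancel_left]
    exact h.dx_mul_sum_range_le hk hT hx hσ hκ hcmp hCi hinv hb hW₀ (by omega)
      fun i hi => hdisj i (by omega)
  have hn : ∀ q, 0 ≤ ∑ j ∈ Finset.range q, e j := fun q => Finset.sum_nonneg fun j _ => he0 j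
  have s1 := sub_mul_le_of_forall_succ (S := fun q => ∑ j ∈ Finset.range q, e j)
    (show i₂ + 1 ≤ 𝒯.N by omega) (fun i hi => (𝒯.x_lt i hi).le)
    (fun i hi => hmono i (by omega)) (fun r hr => hstep r (by omega))
    (show i₁ + 1 ≤ i₂ + 1 by omega)
  have s2 := sub_mul_le_of_forall_succ (S := fun q => ∑ j ∈ Finset.range q, e j)
    (show i₃ + 1 ≤ 𝒯.N by omega) (fun i hi => (𝒯.x_lt i hi).le)
    hmono hstep (show i₂ + 1 ≤ i₃ + 1 by omega)
  have hCH : 0 < decayConst σ κ Ci * 𝒯.h := by positivity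
  have s1' := s1.trans (mul_le_mul_of_nonneg_left (sub_le_self _ (hn _)) hCH.le)
  have s2' := s2.trans (mul_le_mul_of_nonneg_left (sub_le_self _ (hn _)) hCH.le)
  refine ⟨Finset.range (i₁ + 1), Finset.range_subset_range.2 hi₁, fun i hi hiA => ?_,
    fun m hm i hi => ?_, ?_⟩
  · have := 𝒯.x_mono (not_lt.1 (mt Finset.mem_range.2 hiA)) hi.le
    linarith
  · have := Finset.mem_range.1 hi
    exact ae_elem_eq_zero hb hm (by omega) (hdisj i (by omega))
  · refine (le_sq_mul_of_two_steps hε hC hH (hn _) (hn _) (by linarith) (by linarith)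
      s1' s2').trans (mul_le_mul_of_nonneg_left ?_ (by positivity))
    refine (Finset.sum_le_sum fun i hi => ?_).trans (Finset.sum_le_sum_of_subset_of_nonneg
      (Finset.range_subset_range.2 hi₃) fun i _ _ => 𝒯.residualEnergy_nonneg hT hx _ _ _ _ _)
    have := Finset.mem_range.1 hi
    exact h.localEnergy_le_residualEnergy hT hx (Or.inl rfl) (by omega) fun m hm =>
      ae_elem_eq_zero hb hm (by omega) (hdisj i (by omega))

/-- Near the right boundary the left-going residuals are of higher order. -/
theorem exists_right_layer (h : 𝒯.IsDiscretization k (κ * 𝒯.h) b W₀ Wh p) (hk : 1 ≤ k)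
    (hT : 0 < T) (hx : xL < xR) (hσ : 0 < σ) (hκ : 0 < κ) (hcmp : 𝒯.TimeStepsComparable σ)
    (hCi : 0 < Ci) (hinv : TimeInverseInequality k Ci) {ε : ℝ} (hε : 0 < ε) (hεx : xL + ε ≤ xR)
    (hb : ∀ᵐ z ∂(volume.restrict (spaceTimeDomain T xL xR)),
      z.2 ∉ Set.Icc (xL + ε) (xR - ε) → b z = 0)
    (hW₀ : ∀ᵐ y ∂(volume.restrict (Set.Ioo xL xR)), y ∉ Set.Icc (xL + ε) (xR - ε) → W₀ y = 0)
    (hh : 𝒯.h < ε / 8) :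
    ∃ A ⊆ Finset.range 𝒯.N, (∀ i < 𝒯.N, i ∉ A → 𝒯.x (i + 1) ≤ xR - ε / 4) ∧
      (∀ m < 𝒯.M, ∀ i ∈ A, ∀ᵐ z ∂(volume.restrict (𝒯.elem m i)), b z = 0) ∧
      ∑ i ∈ A, 𝒯.localEnergy W₀ Wh p (-1) i ≤ (8 * decayConst σ κ Ci / ε) ^ 2 * 𝒯.h ^ 2 *
        ∑ i ∈ Finset.range 𝒯.N, 𝒯.residualEnergy b W₀ Wh p i := by
  have hH := 𝒯.h_pos hT hx
  have hC := decayConst_pos hσ hκ hCi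
  set e := 𝒯.localEnergy W₀ Wh p (-1) with he
  have he0 : ∀ i, 0 ≤ e i := 𝒯.localEnergy_nonneg hT hx W₀ Wh p (-1)
  -- The same three cells seen from `xR`; now the left end points are separated.
  obtain ⟨i₁, hi₁, h1, h1'⟩ := 𝒯.exists_cell (a := xR - ε / 4) ⟨by linarith, by linarith⟩
  obtain ⟨i₂, hi₂, h2, h2'⟩ := 𝒯.exists_cell (a := xR - 2 * ε / 4) ⟨by linarith, by linarith⟩
  obtain ⟨i₃, hi₃, h3, h3'⟩ := 𝒯.exists_cell (a := xR - 3 * ε / 4) ⟨by linarith, by linarith⟩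
  have g1 : 𝒯.x (i₁ + 1) - 𝒯.x i₁ ≤ 𝒯.h := 𝒯.dx_le_h hT hi₁
  have g2 : 𝒯.x (i₂ + 1) - 𝒯.x i₂ ≤ 𝒯.h := 𝒯.dx_le_h hT hi₂
  have g3 : 𝒯.x (i₃ + 1) - 𝒯.x i₃ ≤ 𝒯.h := 𝒯.dx_le_h hT hi₃
  have o12 : i₂ ≤ i₁ := by
    by_contra hlt
    have := 𝒯.x_mono (show i₁ + 1 ≤ i₂ by omega) hi₂.le
    linarith
  have o23 : i₃ ≤ i₂ := by
    by_contra hlt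
    have := 𝒯.x_mono (show i₂ + 1 ≤ i₃ by omega) hi₃.le
    linarith
  have hdisj : ∀ i, i₃ ≤ i → i < 𝒯.N → Disjoint (𝒯.cell i) (Set.Icc (xL + ε) (xR - ε)) := by
    intro i hi hiN
    rw [Set.disjoint_left]
    intro y hy hy'
    have := 𝒯.x_mono hi hiN.le
    linarith [hy.1, hy'.2]
  have hsplit : ∀ i < 𝒯.N, ∑ j ∈ Finset.Ico i 𝒯.N, e j =
      e i + ∑ j ∈ Finset.Ico (i + 1) 𝒯.N, e j := fun i hi =>
    Finset.sum_eq_sum_Ico_succ_bot hi e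
  have hmono : ∀ i, i₃ ≤ i → i < 𝒯.N →
      ∑ j ∈ Finset.Ico (i + 1) 𝒯.N, e j ≤ ∑ j ∈ Finset.Ico i 𝒯.N, e j := by
    intro i _ hi
    rw [hsplit i hi]
    linarith [he0 i]
  have hstep : ∀ r, i₃ ≤ r → r < 𝒯.N →
      (𝒯.x (r + 1) - 𝒯.x r) * ∑ j ∈ Finset.Ico (r + 1) 𝒯.N, e j ≤
      decayConst σ κ Ci * 𝒯.h *
        (∑ j ∈ Finset.Ico r 𝒯.N, e j - ∑ j ∈ Finset.Ico (r + 1) 𝒯.N, e j) := by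
    intro r hr hrN
    rw [hsplit r hrN, add_sub_cancel_right]
    exact h.dx_mul_sum_Ico_le hk hT hx hσ hκ hcmp hCi hinv hb hW₀ hrN
      fun i hi => hdisj i (by omega)
  have hn : ∀ q, 0 ≤ ∑ j ∈ Finset.Ico q 𝒯.N, e j := fun q => Finset.sum_nonneg fun j _ => he0 j
  have s1 := sub_mul_le_of_forall_pred (S := fun q => ∑ j ∈ Finset.Ico q 𝒯.N, e j) o12
    (fun i hi => (𝒯.x_lt i (by omega)).le)
    (fun i hi hi' => hmono i (by omega) (by omega)) (fun r hr hr' => hstep r (by omega) (by omega))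
  have s2 := sub_mul_le_of_forall_pred (S := fun q => ∑ j ∈ Finset.Ico q 𝒯.N, e j) o23
    (fun i hi => (𝒯.x_lt i (by omega)).le)
    (fun i hi hi' => hmono i (by omega) (by omega)) (fun r hr hr' => hstep r (by omega) (by omega))
  have hCH : 0 < decayConst σ κ Ci * 𝒯.h := by positivity
  have s1' := s1.trans (mul_le_mul_of_nonneg_left (sub_le_self _ (hn _)) hCH.le)
  have s2' := s2.trans (mul_le_mul_of_nonneg_left (sub_le_self _ (hn _)) hCH.le)
  refine ⟨Finset.Ico i₁ 𝒯.N, fun i hi => Finset.mem_range.2 (Finset.mem_Ico.1 hi).2,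
    fun i hi hiA => ?_, fun m hm i hi => ?_, ?_⟩
  · rw [Finset.mem_Ico] at hiA
    have := 𝒯.x_mono (show i + 1 ≤ i₁ by omega) hi₁.le
    linarith
  · have := Finset.mem_Ico.1 hi
    exact ae_elem_eq_zero hb hm (by omega) (hdisj i (by omega) (by omega))
  · refine (le_sq_mul_of_two_steps hε hC hH (hn _) (hn _) (by linarith) (by linarith)
      s1' s2').trans (mul_le_mul_of_nonneg_left ?_ (by positivity))
    refine (Finset.sum_le_sum fun i hi => ?_).trans (Finset.sum_le_sum_of_subset_of_nonneg
      (fun i hi => Finset.mem_range.2 (Finset.mem_Ico.1 hi).2)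
      fun i _ _ => 𝒯.residualEnergy_nonneg hT hx _ _ _ _ _)
    have := Finset.mem_Ico.1 hi
    exact h.localEnergy_le_residualEnergy hT hx (Or.inr rfl) (by omega) fun m hm =>
      ae_elem_eq_zero hb hm (by omega) (hdisj i (by omega) (by omega))

end IsDiscretization

end SpaceTimeMesh

/-! Interpolation. -/

/-- The fundamental theorem of calculus and Cauchy-Schwarz in each component. It serves in `x` for
interpolation and in `t` for freezing the time. -/
theorem sub_dotProduct_self_le {n : ℕ} {v v' : ℝ → Fin n → ℝ}
    (hv : ∀ i x, HasDerivAt (fun y => v y i) (v' x i) x) (hv' : Continuous v') {a b x : ℝ}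
    (hx : x ∈ Set.Icc a b) :
    (v x - v a) ⬝ᵥ (v x - v a) ≤ (b - a) * ∫ y in Set.Ioo a b, v' y ⬝ᵥ v' y := by
  have hi : ∀ i, Continuous fun y => v' y i := fun i => (continuous_apply i).comp hv'
  rw [setIntegral_dotProduct_eq_sum fun i => ((hi i).mul (hi i)).integrableOn_Ioo' _ _,
    Finset.mul_sum]
  refine Finset.sum_le_sum fun i _ => ?_
  simp only [Pi.sub_apply]
  have hnn : 0 ≤ ∫ y in Set.Ioo a b, v' y i * v' y i := integral_nonneg fun y => mul_self_nonneg _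
  rcases hx.1.eq_or_lt with rfl | hax
  · rw [sub_self, mul_zero]
    exact mul_nonneg (sub_nonneg.2 hx.2) hnn
  have ftc : ∫ y in Set.Ioo a x, v' y i = v x i - v a i := by
    rw [setIntegral_Ioo_eq hx.1]
    exact intervalIntegral.integral_eq_sub_of_hasDerivAt (fun y _ => hv i y)
      ((hi i).intervalIntegrable _ _)
  have cs := sq_setIntegral_Ioo_le hax ((hi i).integrableOn_Ioo' _ _)
    (((hi i).pow 2).integrableOn_Ioo' _ _)
  simp only [sq] at cs
  rw [ftc] at cs
  refine cs.trans (mul_le_mul (by linarith [hx.2]) ?_ (integral_nonneg fun y => mul_self_nonneg _)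
    (by linarith [hx.2]))
  exact setIntegral_mono_set (((hi i).mul (hi i)).integrableOn_Ioo' _ _)
    (Filter.Eventually.of_forall fun y => mul_self_nonneg _)
    (Set.Ioo_subset_Ioo_right hx.2).eventuallyLE

/-- The linear interpolant of `v` at `a` and `b`. -/
noncomputable def secant (v : ℝ → Fin 3 → ℝ) (a b x : ℝ) : Fin 3 → ℝ :=
  v a + ((x - a) / (b - a)) • (v b - v a)

theorem secant_left (v : ℝ → Fin 3 → ℝ) (a b : ℝ) : secant v a b a = v a := by
  simp [secant]

theorem secant_right (v : ℝ → Fin 3 → ℝ) {a b : ℝ} (hab : a < b) : secant v a b b = v b := by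
  rw [secant, div_self (sub_pos.2 hab).ne', one_smul, add_sub_cancel]

theorem contDiff_secant (v : ℝ → Fin 3 → ℝ) (a b : ℝ) :
    ContDiff ℝ ∞ fun z : ℝ × ℝ => secant v a b z.2 := by
  unfold secant
  exact contDiff_const.add (((contDiff_snd.sub contDiff_const).div_const _).smul contDiff_const)

theorem maxwellOp_secant (v : ℝ → Fin 3 → ℝ) (a b : ℝ) (z : ℝ × ℝ) :
    maxwellOp (fun z => secant v a b z.2) z = maxwellRow 0 ((b - a)⁻¹ • (v b - v a)) := by
  have h1 : timeDeriv (fun z => secant v a b z.2) z = 0 :=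
    timeDeriv_eq_of_hasDerivAt fun i => hasDerivAt_const z.1 (secant v a b z.2 i)
  have h2 : spaceDeriv (fun z => secant v a b z.2) z = (b - a)⁻¹ • (v b - v a) := by
    refine spaceDeriv_eq_of_hasDerivAt fun i => ?_
    have h : HasDerivAt (fun x : ℝ => (x - a) / (b - a)) (b - a)⁻¹ z.2 := by
      simpa [one_div] using ((hasDerivAt_id z.2).sub_const a).div_const (b - a)
    exact (h.mul_const ((v b - v a) i)).const_add (v a i)
  rw [maxwellOp_eq, h1, h2]

theorem IsTensorPoly.const (k : ℕ) (c : ℝ) : IsTensorPoly k fun _ => c := by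
  refine ⟨fun p q => if p = 0 then if q = 0 then c else 0 else 0, fun z => ?_⟩
  simp [ite_mul]

theorem isTensorPoly_secant {k : ℕ} (hk : 1 ≤ k) (v : ℝ → Fin 3 → ℝ) (a b : ℝ) (j : Fin 3) :
    IsTensorPoly k fun z => secant v a b z.2 j := by
  have h := (IsTensorPoly.const k 1).mul_affine hk 0 (v a j - a / (b - a) * (v b j - v a j))
    ((v b j - v a j) / (b - a))
  refine (congrArg (IsTensorPoly k) (funext fun z => ?_)).mp h
  simp only [secant, Pi.add_apply, Pi.smul_apply, Pi.sub_apply, smul_eq_mul]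
  ring

theorem sub_secant_dotProduct_self_le {v v' : ℝ → Fin 3 → ℝ}
    (hv : ∀ i x, HasDerivAt (fun y => v y i) (v' x i) x)
    (hv' : Continuous v') {a b : ℝ} (hab : a < b) {x : ℝ} (hx : x ∈ Set.Icc a b) :
    (v x - secant v a b x) ⬝ᵥ (v x - secant v a b x) ≤
      4 * (b - a) * ∫ y in Set.Ioo a b, v' y ⬝ᵥ v' y := by
  have h1 := sub_dotProduct_self_le hv hv' hx
  have h2 := sub_dotProduct_self_le hv hv' (Set.right_mem_Icc.2 hab.le)
  have e : v x - secant v a b x = (v x - v a) + (-((x - a) / (b - a))) • (v b - v a) := by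
    rw [secant, neg_smul]; abel
  have h3 := add_dotProduct_self_le (v x - v a) ((-((x - a) / (b - a))) • (v b - v a))
  rw [← e, smul_dotProduct, dotProduct_smul, smul_eq_mul, smul_eq_mul] at h3
  have h4 : 0 ≤ (x - a) / (b - a) := div_nonneg (sub_nonneg.2 hx.1) (sub_pos.2 hab).le
  have h5 : (x - a) / (b - a) ≤ 1 := (div_le_one (sub_pos.2 hab)).2 (by linarith [hx.2])
  have h6 : (x - a) / (b - a) * ((x - a) / (b - a)) ≤ 1 := mul_le_one₀ h5 h4 h5
  have h7 := mul_le_mul_of_nonneg_right h6 (dotProduct_self_nonneg' (v b - v a))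
  linarith

theorem slope_dotProduct_self_le {v v' : ℝ → Fin 3 → ℝ}
    (hv : ∀ i x, HasDerivAt (fun y => v y i) (v' x i) x)
    (hv' : Continuous v') {a b : ℝ} (hab : a < b) :
    ((b - a)⁻¹ • (v b - v a)) ⬝ᵥ ((b - a)⁻¹ • (v b - v a)) ≤
      (b - a)⁻¹ * ∫ y in Set.Ioo a b, v' y ⬝ᵥ v' y := by
  have h2 := sub_dotProduct_self_le hv hv' (Set.right_mem_Icc.2 hab.le)
  have hl := sub_pos.2 hab
  rw [smul_dotProduct, dotProduct_smul, smul_eq_mul, smul_eq_mul]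
  refine mul_le_mul_of_nonneg_left ?_ (inv_nonneg.2 hl.le)
  rw [inv_mul_le_iff₀ hl]
  exact h2

theorem setIntegral_rect_eq_swap {F : ℝ × ℝ → ℝ} (hF : Continuous F) (a b c d : ℝ) :
    ∫ z in Set.Ioo a b ×ˢ Set.Ioo c d, F z =
      ∫ y in Set.Ioo c d, ∫ t in Set.Ioo a b, F (t, y) := by
  have := hF.integrableOn_rect a b c d
  rw [IntegrableOn, Measure.volume_eq_prod, ← Measure.prod_restrict] at this
  rw [Measure.volume_eq_prod, ← Measure.prod_restrict]
  exact integral_prod_symm _ this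

/-- The error of freezing the time variable on a rectangle. -/
theorem setIntegral_sub_frozen_le {w : ℝ × ℝ → Fin 3 → ℝ} (hw : ContDiff ℝ ∞ w) {a b c d : ℝ}
    (hab : a < b) :
    ∫ z in Set.Ioo a b ×ˢ Set.Ioo c d, (w z - w (a, z.2)) ⬝ᵥ (w z - w (a, z.2)) ≤
      (b - a) ^ 2 * ∫ z in Set.Ioo a b ×ˢ Set.Ioo c d, timeDeriv w z ⬝ᵥ timeDeriv w z := by
  have hwc := hw.continuous
  have htc := (contDiff_timeDeriv hw).continuous
  have hF : Continuous fun z => (w z - w (a, z.2)) ⬝ᵥ (w z - w (a, z.2)) :=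
    continuous_dotProduct' (by fun_prop) (by fun_prop)
  have hG := continuous_dotProduct' htc htc
  have hGi := hG.integrableOn_rect a b c d
  rw [IntegrableOn, Measure.volume_eq_prod, ← Measure.prod_restrict] at hGi
  rw [setIntegral_rect_eq_swap hF, setIntegral_rect_eq_swap hG, ← integral_const_mul]
  refine integral_mono_of_nonneg (Filter.Eventually.of_forall fun y =>
    integral_dotProduct_self_nonneg _) (hGi.integral_prod_right.const_mul _)
    (Filter.Eventually.of_forall fun y => ?_)
  have hpt : ∀ t ∈ Set.Ioo a b, (w (t, y) - w (a, y)) ⬝ᵥ (w (t, y) - w (a, y)) ≤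
      (b - a) * ∫ t in Set.Ioo a b, timeDeriv w (t, y) ⬝ᵥ timeDeriv w (t, y) := fun t ht =>
    sub_dotProduct_self_le (v := fun t => w (t, y)) (fun i t => hasDerivAt_time_apply hw t y i)
      (by fun_prop) (Set.Ioo_subset_Icc_self ht)
  have := setIntegral_mono_on (μ := volume)
    ((hF.comp (Continuous.prodMk_left y)).integrableOn_Ioo' a b)
    (integrableOn_const (by simp)) measurableSet_Ioo hpt
  simp only [integral_const, MeasurableSet.univ, measureReal_restrict_apply, Set.univ_inter,
    Real.volume_real_Ioo_of_le hab.le, smul_eq_mul] at this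
  refine this.trans_eq ?_
  ring

namespace SpaceTimeMesh

variable {T xL xR : ℝ} {𝒯 : SpaceTimeMesh T xL xR}

theorem sum_elem_eq_domain (𝒯 : SpaceTimeMesh T xL xR) {F : ℝ × ℝ → ℝ}
    (hF : ∀ m < 𝒯.M, ∀ i < 𝒯.N, IntegrableOn F (𝒯.elem m i)) :
    ∑ m ∈ Finset.range 𝒯.M, ∑ i ∈ Finset.range 𝒯.N, ∫ z in 𝒯.elem m i, F z =
      ∫ z in spaceTimeDomain T xL xR, F z := by
  rw [𝒯.setIntegral_domain fun m hm => 𝒯.integrableOn_slab (hF m hm)]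
  exact Finset.sum_congr rfl fun m hm =>
    (𝒯.setIntegral_slab (hF m (Finset.mem_range.1 hm))).symm

/-- The integral over the domain of a function whose integrals over the time levels are bounded. -/
theorem setIntegral_domain_le {F : ℝ × ℝ → ℝ} (hT : 0 < T) (hF : Continuous F)
    (hF0 : ∀ z, 0 ≤ F z) {B : ℝ} (hB : ∀ t, ∫ y in Set.Ioo xL xR, F (t, y) ≤ B) :
    ∫ z in spaceTimeDomain T xL xR, F z ≤ T * B := by
  rw [spaceTimeDomain, setIntegral_rect_eq hF]
  have := integral_mono_of_nonneg (μ := volume.restrict (Set.Ioo 0 T))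
    (Filter.Eventually.of_forall fun t => integral_nonneg fun y => hF0 (t, y))
    (integrable_const B) (Filter.Eventually.of_forall hB)
  simpa [Real.volume_real_Ioo_of_le hT.le] using this

end SpaceTimeMesh

/-! ### Bounds for the residual functional. -/

namespace SpaceTimeMesh

variable {T xL xR : ℝ} {𝒯 : SpaceTimeMesh T xL xR}

theorem M_mul_h_le_div {σ : ℝ} (hσ : 0 < σ) (hcmp : 𝒯.TimeStepsComparable σ) :
    𝒯.M * 𝒯.h ≤ T / σ := by
  rw [le_div_iff₀ hσ]
  have := 𝒯.M_mul_h_le hcmp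
  linarith

/-- Pieces with a common trace on the vertical mesh lines define one function on each slab. A point
lies in two closed cells only if it is on such a line. -/
theorem exists_isPieces_of_eq (hx : xL < xR) {k : ℕ} {q : ℕ → ℕ → ℝ × ℝ → Fin 3 → ℝ}
    {v : ℕ → ℝ × ℝ → Fin 3 → ℝ}
    (hq : ∀ m < 𝒯.M, ∀ i < 𝒯.N, ∀ j, IsTensorPoly k fun z => q m i z j)
    (hleft : ∀ m, ∀ i < 𝒯.N, ∀ t, q m i (t, 𝒯.x i) = v m (t, 𝒯.x i))
    (hright : ∀ m, ∀ i < 𝒯.N, ∀ t, q m i (t, 𝒯.x (i + 1)) = v m (t, 𝒯.x (i + 1)))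
    (hL : ∀ m t, v m (t, xL) = 0) (hR : ∀ m t, v m (t, xR) = 0) :
    ∃ g, 𝒯.IsPieces k g q := by
  classical
  have hex : ∀ m (z : ℝ × ℝ), ∃ a : Fin 3 → ℝ, ∀ i < 𝒯.N,
      z.2 ∈ Set.Icc (𝒯.x i) (𝒯.x (i + 1)) → a = q m i z := by
    intro m z
    by_cases h : ∃ i < 𝒯.N, z.2 ∈ Set.Icc (𝒯.x i) (𝒯.x (i + 1))
    · obtain ⟨i, hi, hiz⟩ := h
      have key : ∀ i < 𝒯.N, ∀ j < 𝒯.N, z.2 ∈ Set.Icc (𝒯.x i) (𝒯.x (i + 1)) →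
          z.2 ∈ Set.Icc (𝒯.x j) (𝒯.x (j + 1)) → i < j → q m i z = q m j z := by
        intro i hi j hj hiz hjz hij
        have h1 := 𝒯.x_mono (show i + 1 ≤ j by omega) hj.le
        have e1 : z = (z.1, 𝒯.x (i + 1)) := Prod.ext rfl (le_antisymm hiz.2 (h1.trans hjz.1))
        have e2 : z = (z.1, 𝒯.x j) := Prod.ext rfl (le_antisymm (hiz.2.trans h1) hjz.1)
        calc q m i z = v m z := by rw [e1]; exact hright m i hi _
          _ = q m j z := by rw [e2]; exact (hleft m j hj _).symm
      refine ⟨q m i z, fun j hj hjz => ?_⟩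
      rcases lt_trichotomy i j with hij | rfl | hij
      · exact key i hi j hj hiz hjz hij
      · rfl
      · exact (key j hj i hi hjz hiz hij).symm
    · exact ⟨0, fun i hi hiz => absurd ⟨i, hi, hiz⟩ h⟩
  choose g hg using hex
  have hN := 𝒯.N_pos hx
  refine ⟨g, hq, fun m _ i hi z hz => hg m z i hi hz.2, fun m _ t _ => ?_, fun m _ t _ => ?_⟩
  · have h0 : (𝒯.x 0) = xL := 𝒯.x_zero
    rw [hg m (t, xL) 0 hN ⟨h0.le, h0.ge.trans (𝒯.x_lt 0 hN).le⟩]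
    have e : ((t, xL) : ℝ × ℝ) = (t, 𝒯.x 0) := Prod.ext rfl h0.symm
    exact (congrArg _ e).trans ((hleft m 0 hN t).trans ((congrArg _ e.symm).trans (hL m t)))
  · obtain ⟨n, hn⟩ := Nat.exists_eq_succ_of_ne_zero hN.ne'
    have h0 : 𝒯.x (n + 1) = xR := (congrArg 𝒯.x hn.symm).trans 𝒯.x_last
    have hnN : n < 𝒯.N := by omega
    rw [hg m (t, xR) n hnN ⟨(𝒯.x_lt n hnN).le.trans h0.le, h0.ge⟩]
    have e : ((t, xR) : ℝ × ℝ) = (t, 𝒯.x (n + 1)) := Prod.ext rfl h0.symm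
    exact (congrArg _ e).trans ((hright m n hnN t).trans ((congrArg _ e.symm).trans (hR m t)))

namespace IsDiscretization

variable {k : ℕ} {κ σ δ : ℝ} {b : ℝ × ℝ → Fin 4 → ℝ} {W₀ : ℝ → Fin 3 → ℝ}
  {Wh : ℕ → ℝ × ℝ → Fin 3 → ℝ} {p : ℕ → ℕ → ℝ × ℝ → Fin 3 → ℝ}

/-- Pairings with the residuals, by Young's inequality. -/
theorem sum_residual_le_young (h : 𝒯.IsDiscretization k δ b W₀ Wh p) (hT : 0 < T) (hx : xL < xR)
    {X : ℕ → ℕ → ℝ × ℝ → Fin 4 → ℝ} {Y : ℕ → ℕ → ℝ → Fin 3 → ℝ}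
    (hX : ∀ m i, Continuous (X m i)) (hY : ∀ m i, Continuous (Y m i)) {μ : ℝ} (hμ : 0 < μ) :
    ∑ m ∈ Finset.range 𝒯.M, ∑ i ∈ Finset.range 𝒯.N,
      ((∫ z in 𝒯.elem m i, (b z - maxwellOp (p m i) z) ⬝ᵥ X m i z) -
        ∫ y in 𝒯.cell i, 𝒯.jump W₀ Wh m y ⬝ᵥ Y m i y) ≤
    μ / 2 * (𝒯.h * ∑ i ∈ Finset.range 𝒯.N, 𝒯.residualEnergy b W₀ Wh p i) +
      μ⁻¹ / 2 * ((𝒯.h ^ 2)⁻¹ * (∑ m ∈ Finset.range 𝒯.M, ∑ i ∈ Finset.range 𝒯.N,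
          ∫ z in 𝒯.elem m i, X m i z ⬝ᵥ X m i z) +
        𝒯.h⁻¹ * ∑ m ∈ Finset.range 𝒯.M, ∑ i ∈ Finset.range 𝒯.N,
          ∫ y in 𝒯.cell i, Y m i y ⬝ᵥ Y m i y) := by
  have hH := 𝒯.h_pos hT hx
  simp only [residualEnergy]
  rw [Finset.sum_comm (s := Finset.range 𝒯.N)]
  simp only [Finset.mul_sum, ← Finset.sum_add_distrib]
  refine Finset.sum_le_sum fun m hm => Finset.sum_le_sum fun i hi => ?_
  have hm := Finset.mem_range.1 hm
  have hi := Finset.mem_range.1 hi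
  -- The weights `μ h²` here and `μ h` for the jumps reproduce the powers of `h` in `h` times the
  -- residual energy.
  have y1 := integral_dotProduct_le_young (h.memLp_residual hm hi) (𝒯.memLp_elem (hX m i) m i)
    (c := μ * 𝒯.h ^ 2) (by positivity)
  have y2 := integral_dotProduct_le_young (h.memLp_jump hm hi).neg (𝒯.memLp_cell (hY m i) i)
    (c := μ * 𝒯.h) (by positivity)
  simp only [Pi.neg_apply, neg_dotProduct_neg] at y2
  simp only [neg_dotProduct, integral_neg] at y2
  rw [mul_inv] at y1 y2
  linarith

/-- The residual functional on functions vanishing on the lateral boundary. -/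
theorem errorFunctional_le_of_lateral (h : 𝒯.IsDiscretization k (κ * 𝒯.h) b W₀ Wh p)
    (hk : 1 ≤ k) (hT : 0 < T) (hx : xL < xR) (hσ : 0 < σ) (hcmp : 𝒯.TimeStepsComparable σ)
    {w : ℝ × ℝ → Fin 3 → ℝ} (hw : ContDiff ℝ ∞ w) (hL : ∀ t, w (t, xL) = 0)
    (hR : ∀ t, w (t, xR) = 0) {B : ℝ}
    (hBx : ∀ t, ∫ y in Set.Ioo xL xR, spaceDeriv w (t, y) ⬝ᵥ spaceDeriv w (t, y) ≤ B)
    (hBt : ∫ z in spaceTimeDomain T xL xR, timeDeriv w z ⬝ᵥ timeDeriv w z ≤ B)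
    {μ : ℝ} (hμ : 0 < μ) :
    𝒯.errorFunctional b W₀ Wh p w ≤
      μ / 2 * (𝒯.h * ∑ i ∈ Finset.range 𝒯.N, 𝒯.residualEnergy b W₀ Wh p i) +
        μ⁻¹ / 2 * ((8 + (32 + 4 * κ ^ 2) * T + 4 * T / σ) * B) := by
  have hH := 𝒯.h_pos hT hx
  set H := 𝒯.h with hHdef
  have hwc := hw.continuous
  have hxc := (contDiff_spaceDeriv hw).continuous
  have htc := (contDiff_timeDeriv hw).continuous
  -- The interpolant is frozen at the initial time of the slab, since discrete functions may jump in
  -- time, and linear in `x`. It involves `w` only at mesh points, so it inherits the zero lateral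
  -- values.
  set q : ℕ → ℕ → ℝ × ℝ → Fin 3 → ℝ := fun m i z =>
    secant (fun y => w (𝒯.t m, y)) (𝒯.x i) (𝒯.x (i + 1)) z.2 with hq
  have hqs : ∀ m i, ContDiff ℝ ∞ (q m i) := fun m i => contDiff_secant _ _ _
  set X : ℕ → ℕ → ℝ × ℝ → Fin 4 → ℝ := fun m i z =>
    hatVec (w z - q m i z) - (κ * H) • maxwellOp (q m i) z with hX
  set Y : ℕ → ℕ → ℝ → Fin 3 → ℝ := fun m i y => w (𝒯.t m, y) - q m i (𝒯.t m, y) with hY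
  have hXc : ∀ m i, Continuous (X m i) := fun m i =>
    (continuous_hatVec (hwc.sub (hqs m i).continuous)).sub
      ((contDiff_maxwellOp (hqs m i)).continuous.const_smul (κ * H))
  have hYc : ∀ m i, Continuous (Y m i) := fun m i =>
    (hwc.comp (by fun_prop)).sub ((hqs m i).continuous.comp (by fun_prop))
  set I : ℕ → ℕ → ℝ := fun m i =>
    ∫ y in 𝒯.cell i, spaceDeriv w (𝒯.t m, y) ⬝ᵥ spaceDeriv w (𝒯.t m, y) with hI
  have hI0 : ∀ m i, 0 ≤ I m i := fun m i => integral_dotProduct_self_nonneg _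
  -- The interpolant is built from traces at single times, so the space derivative has to be bounded
  -- at every time and not merely in the mean.
  have hIsum : ∀ m, ∑ i ∈ Finset.range 𝒯.N, I m i ≤ B := fun m => by
    refine le_of_eq_of_le (𝒯.setIntegral_space fun i hi => ?_).symm (hBx (𝒯.t m))
    exact ((continuous_dotProduct' hxc hxc).comp (Continuous.prodMk_right _)).integrableOn_Ioo' _ _
  have hB0 : 0 ≤ B := (integral_dotProduct_self_nonneg _).trans (hBx 0)
  obtain ⟨g, hg⟩ := 𝒯.exists_isPieces_of_eq hx (q := q) (v := fun m z => w (𝒯.t m, z.2))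
    (fun m _ i _ j => isTensorPoly_secant hk _ _ _ j) (fun m i _ t => secant_left _ _ _)
    (fun m i hi t => secant_right _ (𝒯.x_lt i hi)) (fun m _ => hL _) (fun m _ => hR _)
  -- Galerkin orthogonality: the discrete test function may be subtracted, including its streamline
  -- part.
  have hrew : 𝒯.errorFunctional b W₀ Wh p w = ∑ m ∈ Finset.range 𝒯.M, ∑ i ∈ Finset.range 𝒯.N,
      ((∫ z in 𝒯.elem m i, (b z - maxwellOp (p m i) z) ⬝ᵥ X m i z) -
        ∫ y in 𝒯.cell i, 𝒯.jump W₀ Wh m y ⬝ᵥ Y m i y) := by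
    refine Finset.sum_congr rfl fun m hm => ?_
    have hm := Finset.mem_range.1 hm
    have gal := h.galerkin hg hm
    rw [← sub_eq_zero, ← Finset.sum_sub_distrib] at gal ⊢
    rw [← gal]
    refine Finset.sum_congr rfl fun i hi => ?_
    have hi := Finset.mem_range.1 hi
    have mR := h.memLp_residual hm hi
    have mJ := h.memLp_jump hm hi
    have mw := 𝒯.memLp_elem (continuous_hatVec hwc) m i
    have mX := 𝒯.memLp_elem (hXc m i) m i
    have my := 𝒯.memLp_cell (u := fun y => w (𝒯.t m, y)) (by fun_prop) i
    have mY := 𝒯.memLp_cell (hYc m i) i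
    have e1 : ∫ z in 𝒯.elem m i, (b z - maxwellOp (p m i) z) ⬝ᵥ
        (hatVec (q m i z) + (κ * H) • maxwellOp (q m i) z) =
      (∫ z in 𝒯.elem m i, (b z - maxwellOp (p m i) z) ⬝ᵥ hatVec (w z)) -
        ∫ z in 𝒯.elem m i, (b z - maxwellOp (p m i) z) ⬝ᵥ X m i z := by
      rw [← integral_sub (MemLp.integrable_dotProduct mR mw) (MemLp.integrable_dotProduct mR mX)]
      congr 1 with z
      rw [← dotProduct_sub]
      congr 1
      simp only [hX, hatVec_sub]
      abel
    have e2 : ∫ y in 𝒯.cell i, 𝒯.jump W₀ Wh m y ⬝ᵥ q m i (𝒯.t m, y) =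
      (∫ y in 𝒯.cell i, 𝒯.jump W₀ Wh m y ⬝ᵥ w (𝒯.t m, y)) -
        ∫ y in 𝒯.cell i, 𝒯.jump W₀ Wh m y ⬝ᵥ Y m i y := by
      rw [← integral_sub (MemLp.integrable_dotProduct mJ my) (MemLp.integrable_dotProduct mJ mY)]
      congr 1 with y
      rw [← dotProduct_sub]
      congr 1
      simp only [hY]
      exact (sub_sub_cancel _ _).symm
    rw [e1, e2]
    ring
  rw [hrew]
  refine (h.sum_residual_le_young hT hx hXc hYc hμ).trans (add_le_add_right ?_ _)
  refine mul_le_mul_of_nonneg_left ?_ (by positivity)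
  have hder : ∀ m i x, HasDerivAt (fun y => w (𝒯.t m, y) i) (spaceDeriv w (𝒯.t m, x) i) x :=
    fun m i x => hasDerivAt_space_apply hw _ _ _
  have hXle : ∀ m < 𝒯.M, ∀ i < 𝒯.N, ∫ z in 𝒯.elem m i, X m i z ⬝ᵥ X m i z ≤
      H ^ 2 * (8 * (∫ z in 𝒯.elem m i, timeDeriv w z ⬝ᵥ timeDeriv w z) +
        (32 + 4 * κ ^ 2) * (𝒯.dt m * I m i)) := by
    intro m hm i hi
    have hdx := 𝒯.dx_pos hi
    have hdt := 𝒯.dt_pos hm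
    have hdxH : 𝒯.dx i ≤ H := 𝒯.dx_le_h hT hi
    have hdtH : 𝒯.dt m ≤ H := 𝒯.dt_le_h hx hm
    -- The interpolation error splits into freezing in time and a secant in space. The inverse of
    -- `dx` from the slope is cancelled by the width of the element on integration, so the space
    -- mesh need not be quasi-uniform.
    have hpt : ∀ z ∈ 𝒯.elem m i, X m i z ⬝ᵥ X m i z ≤
        8 * ((w z - w (𝒯.t m, z.2)) ⬝ᵥ (w z - w (𝒯.t m, z.2))) +
          (32 * 𝒯.dx i + 4 * (κ * H) ^ 2 * (𝒯.dx i)⁻¹) * I m i := by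
      intro z hz
      have f1 := add_dotProduct_self_le (hatVec (w z - q m i z)) (-((κ * H) • maxwellOp (q m i) z))
      rw [← sub_eq_add_neg, neg_dotProduct_neg, smul_dotProduct, dotProduct_smul, smul_eq_mul,
        smul_eq_mul] at f1
      have f2 := hatVec_dotProduct_self_le (w z - q m i z)
      have f3 := add_dotProduct_self_le (w z - w (𝒯.t m, z.2)) (w (𝒯.t m, z.2) - q m i z)
      rw [sub_add_sub_cancel] at f3
      have f4 : (w (𝒯.t m, z.2) - q m i z) ⬝ᵥ (w (𝒯.t m, z.2) - q m i z) ≤ 4 * 𝒯.dx i * I m i :=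
        sub_secant_dotProduct_self_le (hder m) (hxc.comp (Continuous.prodMk_right _))
          (𝒯.x_lt i hi) (Set.Ioo_subset_Icc_self hz.2)
      have f5 : maxwellOp (q m i) z ⬝ᵥ maxwellOp (q m i) z ≤ 2 * ((𝒯.dx i)⁻¹ * I m i) := by
        simp only [hq]
        rw [maxwellOp_secant]
        refine (maxwellRow_dotProduct_self_le _ _).trans ?_
        rw [dotProduct_zero, mul_zero, zero_add]
        exact mul_le_mul_of_nonneg_left (slope_dotProduct_self_le (hder m)
          (hxc.comp (Continuous.prodMk_right _)) (𝒯.x_lt i hi)) (by norm_num)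
      have f6 := mul_le_mul_of_nonneg_left f5 (show 0 ≤ 2 * (κ * H) ^ 2 by positivity)
      change X m i z ⬝ᵥ X m i z ≤ _ at f1
      linarith
    have mX := 𝒯.memLp_elem (hXc m i) m i
    have mF : MemLp (fun z => w z - w (𝒯.t m, z.2)) 2 (volume.restrict (𝒯.elem m i)) :=
      𝒯.memLp_elem (by fun_prop) m i
    have iF := (MemLp.integrable_dotProduct mF mF).const_mul 8
    set c := (32 * 𝒯.dx i + 4 * (κ * H) ^ 2 * (𝒯.dx i)⁻¹) * I m i with hc
    have ic : IntegrableOn (fun _ => c) (𝒯.elem m i) :=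
      Continuous.integrableOn_rect continuous_const _ _ _ _
    have g1 := setIntegral_mono_on (MemLp.integrable_dotProduct mX mX) (iF.add ic)
      (𝒯.measurableSet_elem m i) hpt
    have g2 : ∫ z in 𝒯.elem m i, c = 𝒯.dx i * (𝒯.dt m * c) := by
      have := setIntegral_rect_fst (F := fun _ => c) continuous_const (𝒯.t m) (𝒯.t (m + 1))
        (𝒯.x_lt i hi).le
      refine this.trans ?_
      simp [Real.volume_real_Ioo_of_le (𝒯.t_lt m hm).le, dx, dt]
    simp only [Pi.add_apply] at g1
    rw [integral_add iF ic, integral_const_mul, g2] at g1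
    have g3 : ∫ z in 𝒯.elem m i, (w z - w (𝒯.t m, z.2)) ⬝ᵥ (w z - w (𝒯.t m, z.2)) ≤
        𝒯.dt m ^ 2 * ∫ z in 𝒯.elem m i, timeDeriv w z ⬝ᵥ timeDeriv w z :=
      setIntegral_sub_frozen_le hw (𝒯.t_lt m hm)
    have g4 : 𝒯.dt m ^ 2 ≤ H ^ 2 := pow_le_pow_left₀ hdt.le hdtH 2
    have g5 : 𝒯.dx i ^ 2 ≤ H ^ 2 := pow_le_pow_left₀ hdx.le hdxH 2
    have g6 := mul_le_mul_of_nonneg_right g4 (integral_dotProduct_self_nonneg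
      (μ := volume.restrict (𝒯.elem m i)) (timeDeriv w))
    have g7 := mul_le_mul_of_nonneg_right g5 (mul_nonneg hdt.le (hI0 m i))
    have g8 : 𝒯.dx i * (𝒯.dt m * c) = 32 * (𝒯.dx i ^ 2 * (𝒯.dt m * I m i)) +
        4 * κ ^ 2 * H ^ 2 * (𝒯.dt m * I m i) := by
      rw [hc]; field_simp
    rw [g8] at g1
    linarith
  have hYle : ∀ m < 𝒯.M, ∀ i < 𝒯.N, ∫ y in 𝒯.cell i, Y m i y ⬝ᵥ Y m i y ≤ 4 * H ^ 2 * I m i := by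
    intro m hm i hi
    have hdx := 𝒯.dx_pos hi
    have hdxH : 𝒯.dx i ≤ H := 𝒯.dx_le_h hT hi
    have hpt : ∀ y ∈ 𝒯.cell i, Y m i y ⬝ᵥ Y m i y ≤ 4 * 𝒯.dx i * I m i := fun y hy =>
      sub_secant_dotProduct_self_le (hder m) (hxc.comp (Continuous.prodMk_right _))
          (𝒯.x_lt i hi) (Set.Ioo_subset_Icc_self hy)
    have mY := 𝒯.memLp_cell (hYc m i) i
    have g1 := setIntegral_mono_on (MemLp.integrable_dotProduct mY mY)
      (Continuous.integrableOn_Ioo' continuous_const _ _)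
      (𝒯.measurableSet_cell i) hpt
    have g2 : ∫ y in 𝒯.cell i, 4 * 𝒯.dx i * I m i = 𝒯.dx i * (4 * 𝒯.dx i * I m i) := by
      simp [cell, Real.volume_real_Ioo_of_le (𝒯.x_lt i hi).le, dx]
    rw [g2] at g1
    have g5 : 𝒯.dx i ^ 2 ≤ H ^ 2 := pow_le_pow_left₀ hdx.le hdxH 2
    have g7 := mul_le_mul_of_nonneg_right g5 (hI0 m i)
    linarith
  -- The jump terms are summed over `M` time levels rather than integrated in time; one power of `h`
  -- pays for this.
  have hMH : 𝒯.M * H ≤ T / σ := M_mul_h_le_div hσ hcmp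
  have s1 : (H ^ 2)⁻¹ * (∑ m ∈ Finset.range 𝒯.M, ∑ i ∈ Finset.range 𝒯.N,
      ∫ z in 𝒯.elem m i, X m i z ⬝ᵥ X m i z) ≤ 8 * B + (32 + 4 * κ ^ 2) * (T * B) := by
    rw [inv_mul_le_iff₀ (by positivity)]
    refine (Finset.sum_le_sum fun m hm => Finset.sum_le_sum fun i hi =>
      hXle m (Finset.mem_range.1 hm) i (Finset.mem_range.1 hi)).trans ?_
    simp only [← Finset.mul_sum, Finset.sum_add_distrib]
    refine mul_le_mul_of_nonneg_left (add_le_add ?_ ?_) (by positivity)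
    · refine mul_le_mul_of_nonneg_left ?_ (by norm_num)
      rw [𝒯.sum_elem_eq_domain fun m _ i _ =>
        (continuous_dotProduct' htc htc).integrableOn_rect _ _ _ _]
      exact hBt
    · refine mul_le_mul_of_nonneg_left ?_ (by positivity)
      refine le_of_le_of_eq ?_ (congrArg (· * B) 𝒯.sum_dt)
      simp only [Finset.sum_mul]
      exact Finset.sum_le_sum fun m hm => mul_le_mul_of_nonneg_left (hIsum m)
        (𝒯.dt_pos (Finset.mem_range.1 hm)).le
  have s2 : H⁻¹ * (∑ m ∈ Finset.range 𝒯.M, ∑ i ∈ Finset.range 𝒯.N,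
      ∫ y in 𝒯.cell i, Y m i y ⬝ᵥ Y m i y) ≤ 4 * (T / σ) * B := by
    rw [inv_mul_le_iff₀ hH]
    calc ∑ m ∈ Finset.range 𝒯.M, ∑ i ∈ Finset.range 𝒯.N, ∫ y in 𝒯.cell i, Y m i y ⬝ᵥ Y m i y
        ≤ ∑ m ∈ Finset.range 𝒯.M, 4 * H ^ 2 * B := by
          refine Finset.sum_le_sum fun m hm => (Finset.sum_le_sum fun i hi =>
            hYle m (Finset.mem_range.1 hm) i (Finset.mem_range.1 hi)).trans ?_
          rw [← Finset.mul_sum]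
          exact mul_le_mul_of_nonneg_left (hIsum m) (by positivity)
      _ = 𝒯.M * H * (4 * H * B) := by
          rw [Finset.sum_const, Finset.card_range, nsmul_eq_mul]; ring
      _ ≤ T / σ * (4 * H * B) := mul_le_mul_of_nonneg_right hMH (by positivity)
      _ = _ := by ring
  refine (add_le_add s1 s2).trans_eq ?_
  ring

end IsDiscretization

end SpaceTimeMesh

namespace SpaceTimeMesh

variable {T xL xR : ℝ} {𝒯 : SpaceTimeMesh T xL xR}

theorem sum_elem_hatVec_le (𝒯 : SpaceTimeMesh T xL xR) (hT : 0 < T) {v : ℝ × ℝ → Fin 3 → ℝ}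
    (hv : Continuous v) {B : ℝ}
    (hB : ∀ t, ∫ y in Set.Ioo xL xR, v (t, y) ⬝ᵥ v (t, y) ≤ B) :
    ∑ m ∈ Finset.range 𝒯.M, ∑ i ∈ Finset.range 𝒯.N,
      ∫ z in 𝒯.elem m i, hatVec (v z) ⬝ᵥ hatVec (v z) ≤ 2 * T * B := by
  have hc := continuous_dotProduct' (continuous_hatVec hv) (continuous_hatVec hv)
  have hc' := continuous_dotProduct' hv hv
  rw [𝒯.sum_elem_eq_domain fun m _ i _ => hc.integrableOn_rect _ _ _ _]
  have h1 : ∫ z in spaceTimeDomain T xL xR, hatVec (v z) ⬝ᵥ hatVec (v z) ≤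
      ∫ z in spaceTimeDomain T xL xR, 2 * (v z ⬝ᵥ v z) :=
    integral_mono (hc.integrableOn_rect _ _ _ _) ((hc'.const_mul 2).integrableOn_rect _ _ _ _)
      fun z => hatVec_dotProduct_self_le _
  rw [integral_const_mul] at h1
  have h2 := setIntegral_domain_le hT hc' (fun z => dotProduct_self_nonneg' _) hB
  linarith

theorem sum_cell_le (𝒯 : SpaceTimeMesh T xL xR) {v : ℝ × ℝ → Fin 3 → ℝ} (hv : Continuous v)
    {B : ℝ} (hB : ∀ t, ∫ y in Set.Ioo xL xR, v (t, y) ⬝ᵥ v (t, y) ≤ B) :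
    ∑ m ∈ Finset.range 𝒯.M, ∑ i ∈ Finset.range 𝒯.N,
      ∫ y in 𝒯.cell i, v (𝒯.t m, y) ⬝ᵥ v (𝒯.t m, y) ≤ 𝒯.M * B := by
  calc _ ≤ ∑ m ∈ Finset.range 𝒯.M, B := by
        refine Finset.sum_le_sum fun m _ =>
          le_of_eq_of_le (𝒯.setIntegral_space fun i hi => ?_).symm (hB (𝒯.t m))
        exact ((continuous_dotProduct' hv hv).comp
          (Continuous.prodMk_right _)).integrableOn_Ioo' _ _
    _ = _ := by rw [Finset.sum_const, Finset.card_range, nsmul_eq_mul]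

namespace IsDiscretization

variable {k : ℕ} {κ σ δ : ℝ} {b : ℝ × ℝ → Fin 4 → ℝ} {W₀ : ℝ → Fin 3 → ℝ}
  {Wh : ℕ → ℝ × ℝ → Fin 3 → ℝ} {p : ℕ → ℕ → ℝ × ℝ → Fin 3 → ℝ}

/-- The residual functional, without use of the Galerkin equations. -/
theorem errorFunctional_le_of_coarse (h : 𝒯.IsDiscretization k δ b W₀ Wh p)
    (hT : 0 < T) (hx : xL < xR) (hσ : 0 < σ) (hcmp : 𝒯.TimeStepsComparable σ)
    {v : ℝ × ℝ → Fin 3 → ℝ} (hv : Continuous v) {B : ℝ}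
    (hB : ∀ t, ∫ y in Set.Ioo xL xR, v (t, y) ⬝ᵥ v (t, y) ≤ B)
    {η : ℝ} (hη : 0 < η) (hη' : η ≤ 𝒯.h) {μ : ℝ} (hμ : 0 < μ) :
    𝒯.errorFunctional b W₀ Wh p v ≤
      μ / 2 * (𝒯.h * ∑ i ∈ Finset.range 𝒯.N, 𝒯.residualEnergy b W₀ Wh p i) +
        μ⁻¹ / 2 * ((2 * T + T / σ) / η ^ 2 * B) := by
  have hH := 𝒯.h_pos hT hx
  have hB0 : 0 ≤ B := (integral_dotProduct_self_nonneg _).trans (hB 0)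
  refine (h.sum_residual_le_young hT hx (X := fun _ _ z => hatVec (v z))
    (Y := fun m _ y => v (𝒯.t m, y)) (fun _ _ => continuous_hatVec hv)
    (fun m _ => hv.comp (Continuous.prodMk_right _)) hμ).trans (add_le_add_right ?_ _)
  refine mul_le_mul_of_nonneg_left ?_ (by positivity)
  have s1 := mul_le_mul_of_nonneg_left (𝒯.sum_elem_hatVec_le hT hv hB)
    (show 0 ≤ (𝒯.h ^ 2)⁻¹ by positivity)
  have s2 := mul_le_mul_of_nonneg_left (𝒯.sum_cell_le hv hB) (show 0 ≤ 𝒯.h⁻¹ by positivity)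
  refine (add_le_add s1 s2).trans ?_
  -- No power of `h` has been gained; on coarse meshes the negative powers are bounded through `η ≤
  -- h`.
  have e : (𝒯.h ^ 2)⁻¹ * (2 * T * B) + 𝒯.h⁻¹ * (𝒯.M * B) =
      (2 * T + 𝒯.M * 𝒯.h) / 𝒯.h ^ 2 * B := by
    field_simp
  rw [e]
  refine mul_le_mul_of_nonneg_right ?_ hB0
  have := M_mul_h_le_div hσ hcmp
  exact div_le_div₀ (by positivity) (by linarith) (by positivity) (pow_le_pow_left₀ hη.le hη' 2)

/-- The residual functional on functions supported in a region where the residuals of the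
characteristic variables are of higher order. -/
theorem errorFunctional_le_of_layer (h : 𝒯.IsDiscretization k δ b W₀ Wh p)
    (hT : 0 < T) (hx : xL < xR) (hσ : 0 < σ) (hcmp : 𝒯.TimeStepsComparable σ)
    {s : ℝ} (hs : s = 1 ∨ s = -1)
    {v : ℝ × ℝ → Fin 3 → ℝ} (hv : Continuous v) (hPv : ∀ z, chProj s (v z) = v z)
    {A : Finset ℕ} (hA : A ⊆ Finset.range 𝒯.N)
    (hvA : ∀ i < 𝒯.N, i ∉ A → ∀ t, ∀ y ∈ 𝒯.cell i, v (t, y) = 0)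
    (hb : ∀ m < 𝒯.M, ∀ i ∈ A, ∀ᵐ z ∂(volume.restrict (𝒯.elem m i)), b z = 0) {C : ℝ}
    (hC : ∑ i ∈ A, 𝒯.localEnergy W₀ Wh p s i ≤ C * 𝒯.h ^ 2 *
        ∑ i ∈ Finset.range 𝒯.N, 𝒯.residualEnergy b W₀ Wh p i) {B : ℝ}
    (hB : ∀ t, ∫ y in Set.Ioo xL xR, v (t, y) ⬝ᵥ v (t, y) ≤ B) {μ : ℝ} (hμ : 0 < μ) :
    𝒯.errorFunctional b W₀ Wh p v ≤
      μ / 2 * (C * (𝒯.h * ∑ i ∈ Finset.range 𝒯.N, 𝒯.residualEnergy b W₀ Wh p i)) +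
        μ⁻¹ / 2 * ((2 * T + T / σ) * B) := by
  have hH := 𝒯.h_pos hT hx
  have hB0 : 0 ≤ B := (integral_dotProduct_self_nonneg _).trans (hB 0)
  set E := ∑ i ∈ Finset.range 𝒯.N, 𝒯.residualEnergy b W₀ Wh p i with hE
  have hterm : ∀ m < 𝒯.M, ∀ i < 𝒯.N,
      (∫ z in 𝒯.elem m i, (b z - maxwellOp (p m i) z) ⬝ᵥ hatVec (v z)) -
        ∫ y in 𝒯.cell i, 𝒯.jump W₀ Wh m y ⬝ᵥ v (𝒯.t m, y) ≤
      (if i ∈ A then μ / 2 * 𝒯.h⁻¹ * (𝒯.h * (∫ z in 𝒯.elem m i,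
          maxwellOp (fun z => chProj s (p m i z)) z ⬝ᵥ maxwellOp (fun z => chProj s (p m i z)) z) +
        ∫ x in 𝒯.cell i, chProj s (𝒯.jump W₀ Wh m x) ⬝ᵥ chProj s (𝒯.jump W₀ Wh m x)) else 0) +
      μ⁻¹ / 2 * ((∫ z in 𝒯.elem m i, hatVec (v z) ⬝ᵥ hatVec (v z)) +
        𝒯.h * ∫ y in 𝒯.cell i, v (𝒯.t m, y) ⬝ᵥ v (𝒯.t m, y)) := by
    intro m hm i hi
    have n1 := integral_dotProduct_self_nonneg (μ := volume.restrict (𝒯.elem m i))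
      (fun z => hatVec (v z))
    have n2 := integral_dotProduct_self_nonneg (μ := volume.restrict (𝒯.cell i))
      (fun y => v (𝒯.t m, y))
    split_ifs with hiA
    · have hp := h.pieces.contDiff hm hi
      have hu := contDiff_chProj s hp
      have mU := 𝒯.memLp_elem (contDiff_maxwellOp hu).continuous m i
      have mv := 𝒯.memLp_elem (continuous_hatVec hv) m i
      have mJ := (h.memLp_jump hm hi).chProj s
      have my := 𝒯.memLp_cell (u := fun y => v (𝒯.t m, y)) (by fun_prop) i
      -- These weights produce `h⁻¹` times the local energy. The factor `h²` in `hC` then turns it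
      -- into `h` times the total, as if `v` had been interpolated.
      have y1 := integral_dotProduct_le_young mU.neg mv (c := μ) hμ
      have y2 := integral_dotProduct_le_young mJ.neg my (c := μ * 𝒯.h⁻¹) (by positivity)
      simp only [Pi.neg_apply, neg_dotProduct_neg] at y1 y2
      rw [mul_inv, inv_inv] at y2
      have e1 : ∫ z in 𝒯.elem m i, (b z - maxwellOp (p m i) z) ⬝ᵥ hatVec (v z) =
          ∫ z in 𝒯.elem m i, (-maxwellOp (fun z => chProj s (p m i z)) z) ⬝ᵥ hatVec (v z) := by
        refine integral_congr_ae ?_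
        filter_upwards [hb m hm i hiA] with z hz
        simp only [hz, zero_sub, neg_dotProduct, maxwellOp_eq, timeDeriv_chProj s hp,
          spaceDeriv_chProj s hp]
        rw [maxwellRow_dotProduct_hatVec_chProj hs _ _ _ (hPv z)]
      have e2 : ∫ y in 𝒯.cell i, 𝒯.jump W₀ Wh m y ⬝ᵥ v (𝒯.t m, y) =
          -∫ y in 𝒯.cell i, (-chProj s (𝒯.jump W₀ Wh m y)) ⬝ᵥ v (𝒯.t m, y) := by
        rw [← integral_neg]
        congr 1 with y
        rw [neg_dotProduct, neg_neg, ← hPv, dotProduct_chProj hs]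
      rw [e1, e2]
      have e3 : μ / 2 * 𝒯.h⁻¹ * (𝒯.h * (∫ z in 𝒯.elem m i,
          maxwellOp (fun z => chProj s (p m i z)) z ⬝ᵥ maxwellOp (fun z => chProj s (p m i z)) z) +
        ∫ x in 𝒯.cell i, chProj s (𝒯.jump W₀ Wh m x) ⬝ᵥ chProj s (𝒯.jump W₀ Wh m x)) =
        μ / 2 * (∫ z in 𝒯.elem m i,
          maxwellOp (fun z => chProj s (p m i z)) z ⬝ᵥ maxwellOp (fun z => chProj s (p m i z)) z) +
        μ / 2 * 𝒯.h⁻¹ * ∫ x in 𝒯.cell i,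
          chProj s (𝒯.jump W₀ Wh m x) ⬝ᵥ chProj s (𝒯.jump W₀ Wh m x) := by
        field_simp
      rw [e3]
      linarith
    · have e1 : ∫ z in 𝒯.elem m i, (b z - maxwellOp (p m i) z) ⬝ᵥ hatVec (v z) = 0 := by
        rw [setIntegral_congr_fun (g := fun _ => 0) (𝒯.measurableSet_elem m i) fun z hz => ?_]
        · simp
        · have : v z = 0 := hvA i hi hiA z.1 z.2 hz.2
          simp only [this, hatVec_zero, dotProduct_zero]
      have e2 : ∫ y in 𝒯.cell i, 𝒯.jump W₀ Wh m y ⬝ᵥ v (𝒯.t m, y) = 0 := by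
        rw [setIntegral_congr_fun (g := fun _ => 0) (𝒯.measurableSet_cell i) fun y hy => ?_]
        · simp
        · simp only [hvA i hi hiA _ y hy, dotProduct_zero]
      rw [e1, e2]
      have : 0 ≤ μ⁻¹ / 2 * ((∫ z in 𝒯.elem m i, hatVec (v z) ⬝ᵥ hatVec (v z)) +
        𝒯.h * ∫ y in 𝒯.cell i, v (𝒯.t m, y) ⬝ᵥ v (𝒯.t m, y)) := by positivity
      linarith
  refine (Finset.sum_le_sum fun m hm => Finset.sum_le_sum fun i hi =>
    hterm m (Finset.mem_range.1 hm) i (Finset.mem_range.1 hi)).trans ?_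
  simp only [Finset.sum_add_distrib, ← Finset.mul_sum]
  refine add_le_add ?_ (mul_le_mul_of_nonneg_left ?_ (by positivity))
  · have e : ∑ m ∈ Finset.range 𝒯.M, ∑ i ∈ Finset.range 𝒯.N,
        (if i ∈ A then μ / 2 * 𝒯.h⁻¹ * (𝒯.h * (∫ z in 𝒯.elem m i,
          maxwellOp (fun z => chProj s (p m i z)) z ⬝ᵥ maxwellOp (fun z => chProj s (p m i z)) z) +
        ∫ x in 𝒯.cell i, chProj s (𝒯.jump W₀ Wh m x) ⬝ᵥ chProj s (𝒯.jump W₀ Wh m x)) else 0) =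
        μ / 2 * 𝒯.h⁻¹ * ∑ i ∈ A, 𝒯.localEnergy W₀ Wh p s i := by
      rw [Finset.sum_comm, ← Finset.sum_subset hA, Finset.mul_sum]
      · refine Finset.sum_congr rfl fun i hi => ?_
        simp only [if_pos hi, localEnergy, Finset.mul_sum]
      · intro i _ hi
        simp only [if_neg hi, Finset.sum_const_zero]
    rw [e]
    refine (mul_le_mul_of_nonneg_left hC (by positivity)).trans_eq ?_
    field_simp
  · have s1 := 𝒯.sum_elem_hatVec_le hT hv hB
    have s2 := mul_le_mul_of_nonneg_left (𝒯.sum_cell_le hv hB) hH.le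
    have s3 := mul_le_mul_of_nonneg_right (M_mul_h_le_div hσ hcmp) hB0
    linarith

end IsDiscretization

end SpaceTimeMesh

/-! Cut-off in space. -/

section Cutoff

variable {χ : ℝ → ℝ} {φ : ℝ × ℝ → Fin 3 → ℝ}

theorem contDiff_smul_snd (hχ : ContDiff ℝ ∞ χ) (hφ : ContDiff ℝ ∞ φ) :
    ContDiff ℝ ∞ fun z => χ z.2 • φ z := (hχ.comp contDiff_snd).smul hφ

theorem timeDeriv_smul_snd (χ : ℝ → ℝ) (hφ : ContDiff ℝ ∞ φ) (z : ℝ × ℝ) :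
    timeDeriv (fun z => χ z.2 • φ z) z = χ z.2 • timeDeriv φ z :=
  timeDeriv_eq_of_hasDerivAt fun i => (hasDerivAt_time_apply hφ z.1 z.2 i).const_mul (χ z.2)

theorem spaceDeriv_smul_snd (hχ : ContDiff ℝ ∞ χ) (hφ : ContDiff ℝ ∞ φ) (z : ℝ × ℝ) :
    spaceDeriv (fun z => χ z.2 • φ z) z = deriv χ z.2 • φ z + χ z.2 • spaceDeriv φ z :=
  spaceDeriv_eq_of_hasDerivAt fun i =>
    ((hχ.differentiable (by simp) z.2).hasDerivAt).mul (hasDerivAt_space_apply hφ z.1 z.2 i)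

end Cutoff

theorem smul_dotProduct_smul_self_le {n : ℕ} {a c : ℝ} (h : a ^ 2 ≤ c) (v : Fin n → ℝ) :
    (a • v) ⬝ᵥ (a • v) ≤ c * (v ⬝ᵥ v) := by
  rw [smul_dotProduct, dotProduct_smul, smul_eq_mul, smul_eq_mul, ← mul_assoc, ← sq]
  exact mul_le_mul_of_nonneg_right h (dotProduct_self_nonneg' v)

/-- A smooth function vanishing on one side of an end point of an interval and equal to one at
distance `η` from it on the other side. -/
theorem exists_cutoff (s a : ℝ) {η : ℝ} (hη : 0 < η) (c d : ℝ) :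
    ∃ χ : ℝ → ℝ, ContDiff ℝ ∞ χ ∧ (∀ x, χ x ∈ Set.Icc 0 1) ∧ χ a = 0 ∧
      (∀ x, η ≤ s * (x - a) → χ x = 1) ∧ ∃ D, 0 ≤ D ∧ ∀ x ∈ Set.Icc c d, deriv χ x ^ 2 ≤ D := by
  set χ : ℝ → ℝ := fun x => Real.smoothTransition (s * (x - a) / η) with hχ
  have hχs : ContDiff ℝ ∞ χ := Real.smoothTransition.contDiff.comp (by fun_prop)
  have hc : Continuous fun x => deriv χ x ^ 2 := (hχs.continuous_deriv (by simp)).pow 2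
  obtain ⟨D, hD⟩ := isCompact_Icc.exists_bound_of_continuousOn (s := Set.Icc c d) hc.continuousOn
  refine ⟨χ, hχs, fun x => ⟨Real.smoothTransition.nonneg _, Real.smoothTransition.le_one _⟩, ?_,
    fun x hx => ?_, max D 0, le_max_right _ _, fun x hx => ?_⟩
  · simp [hχ]
  · exact Real.smoothTransition.one_of_one_le ((one_le_div hη).2 hx)
  · exact (le_abs_self _).trans ((hD x hx).trans (le_max_left _ _))

namespace SpaceTimeMesh

variable {T xL xR : ℝ} {𝒯 : SpaceTimeMesh T xL xR}

namespace IsDiscretization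

variable {k : ℕ} {κ σ δ : ℝ} {b : ℝ × ℝ → Fin 4 → ℝ} {W₀ : ℝ → Fin 3 → ℝ}
  {Wh : ℕ → ℝ × ℝ → Fin 3 → ℝ} {p : ℕ → ℕ → ℝ × ℝ → Fin 3 → ℝ}

theorem errorFunctional_add (h : 𝒯.IsDiscretization k δ b W₀ Wh p) {v w : ℝ × ℝ → Fin 3 → ℝ}
    (hv : Continuous v) (hw : Continuous w) :
    𝒯.errorFunctional b W₀ Wh p (fun z => v z + w z) =
      𝒯.errorFunctional b W₀ Wh p v + 𝒯.errorFunctional b W₀ Wh p w := by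
  simp only [errorFunctional, ← Finset.sum_add_distrib]
  refine Finset.sum_congr rfl fun m hm => Finset.sum_congr rfl fun i hi => ?_
  have hm := Finset.mem_range.1 hm
  have hi := Finset.mem_range.1 hi
  have mR := h.memLp_residual hm hi
  have mJ := h.memLp_jump hm hi
  simp only [hatVec_add, dotProduct_add]
  rw [integral_add (MemLp.integrable_dotProduct mR (𝒯.memLp_elem (continuous_hatVec hv) m i))
      (MemLp.integrable_dotProduct mR (𝒯.memLp_elem (continuous_hatVec hw) m i)),
    integral_add (MemLp.integrable_dotProduct mJ
        (𝒯.memLp_cell (u := fun y => v (𝒯.t m, y)) (by fun_prop) i))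
      (MemLp.integrable_dotProduct mJ
        (𝒯.memLp_cell (u := fun y => w (𝒯.t m, y)) (by fun_prop) i))]
  ring

/-- The residual functional on a dual solution, on fine meshes. -/
theorem errorFunctional_le_of_cutoff (h : 𝒯.IsDiscretization k (κ * 𝒯.h) b W₀ Wh p)
    (hk : 1 ≤ k) (hT : 0 < T) (hx : xL < xR) (hσ : 0 < σ) (hcmp : 𝒯.TimeStepsComparable σ)
    {s : ℝ} (hs : s = 1 ∨ s = -1) {B : ℝ} (hB : 0 ≤ B) {ψ φ : ℝ × ℝ → Fin 3 → ℝ}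
    (hφ : IsDualField T xL xR s B ψ φ) {χ : ℝ → ℝ} (hχ : ContDiff ℝ ∞ χ)
    (hχ01 : ∀ x, χ x ∈ Set.Icc 0 1) {D : ℝ} (hD0 : 0 ≤ D)
    (hD : ∀ x ∈ Set.Icc xL xR, deriv χ x ^ 2 ≤ D)
    (hL : ∀ t, χ xL • φ (t, xL) = 0) (hR : ∀ t, χ xR • φ (t, xR) = 0)
    {A : Finset ℕ} (hA : A ⊆ Finset.range 𝒯.N)
    (hχA : ∀ i < 𝒯.N, i ∉ A → ∀ y ∈ 𝒯.cell i, χ y = 1)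
    (hb : ∀ m < 𝒯.M, ∀ i ∈ A, ∀ᵐ z ∂(volume.restrict (𝒯.elem m i)), b z = 0) {C : ℝ}
    (hC : ∑ i ∈ A, 𝒯.localEnergy W₀ Wh p s i ≤ C * 𝒯.h ^ 2 *
        ∑ i ∈ Finset.range 𝒯.N, 𝒯.residualEnergy b W₀ Wh p i) {μ : ℝ} (hμ : 0 < μ) :
    𝒯.errorFunctional b W₀ Wh p φ ≤
      μ / 2 * ((1 + C) * (𝒯.h * ∑ i ∈ Finset.range 𝒯.N, 𝒯.residualEnergy b W₀ Wh p i)) +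
        μ⁻¹ / 2 * (((8 + (32 + 4 * κ ^ 2) * T + 4 * T / σ) *
          (2 * (D + 1) * T + (2 + 2 * T ^ 2)) + (2 * T + T / σ) * T) * B) := by
  have hφs := hφ.contDiff
  have hφc := hφs.continuous
  have hxc := (contDiff_spaceDeriv hφs).continuous
  have htc := (contDiff_timeDeriv hφs).continuous
  have hws := contDiff_smul_snd hχ hφs
  have hvs : ContDiff ℝ ∞ fun z : ℝ × ℝ => (1 - χ z.2) • φ z :=
    contDiff_smul_snd (χ := fun x => 1 - χ x) (contDiff_const.sub hχ) hφs
  -- The first part vanishes on the lateral boundary and can be interpolated; the second is zero off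
  -- the cells of `A`, where the residuals of speed `s` are small.
  have e : 𝒯.errorFunctional b W₀ Wh p φ =
      𝒯.errorFunctional b W₀ Wh p (fun z => χ z.2 • φ z) +
        𝒯.errorFunctional b W₀ Wh p (fun z => (1 - χ z.2) • φ z) := by
    rw [← h.errorFunctional_add hws.continuous hvs.continuous]
    congr 1 with z : 1
    rw [← add_smul, add_sub_cancel, one_smul]
  have hχ1 : ∀ x, χ x ^ 2 ≤ 1 := fun x => (sq_le_one_iff₀ (hχ01 x).1).2 (hχ01 x).2
  have hχ2 : ∀ x, (1 - χ x) ^ 2 ≤ 1 := fun x =>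
    (sq_le_one_iff₀ (sub_nonneg.2 (hχ01 x).2)).2 (by linarith [(hχ01 x).1])
  have hcs : ∀ {u : ℝ × ℝ → Fin 3 → ℝ} (_ : Continuous u) (t : ℝ),
      IntegrableOn (fun y => u (t, y) ⬝ᵥ u (t, y)) (Set.Ioo xL xR) := fun hu t =>
    ((continuous_dotProduct' hu hu).comp (Continuous.prodMk_right t)).integrableOn_Ioo' _ _
  have hwx : ∀ t, ∫ y in Set.Ioo xL xR, spaceDeriv (fun z => χ z.2 • φ z) (t, y) ⬝ᵥ
      spaceDeriv (fun z => χ z.2 • φ z) (t, y) ≤ (2 * (D + 1) * T + (2 + 2 * T ^ 2)) * B := by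
    intro t
    have i1 := ((hcs hφc t).const_mul (2 * D)).add ((hcs hxc t).const_mul 2)
    have g1 := setIntegral_mono_on (hcs (contDiff_spaceDeriv hws).continuous t) i1
      measurableSet_Ioo fun y hy => by
        rw [spaceDeriv_smul_snd hχ hφs]
        have f1 := add_dotProduct_self_le (deriv χ y • φ (t, y)) (χ y • spaceDeriv φ (t, y))
        have f2 := smul_dotProduct_smul_self_le (hD y (Set.Ioo_subset_Icc_self hy)) (φ (t, y))
        have f3 := smul_dotProduct_smul_self_le (hχ1 y) (spaceDeriv φ (t, y))
        change _ ≤ 2 * D * (φ (t, y) ⬝ᵥ φ (t, y)) +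
          2 * (spaceDeriv φ (t, y) ⬝ᵥ spaceDeriv φ (t, y))
        linarith
    simp only [Pi.add_apply] at g1
    rw [integral_add ((hcs hφc t).const_mul (2 * D)) ((hcs hxc t).const_mul 2),
      integral_const_mul, integral_const_mul] at g1
    have g2 := mul_le_mul_of_nonneg_left (hφ.sq_le t) (show 0 ≤ 2 * D by positivity)
    have g3 := hφ.space_sq_le t
    have g4 : 0 ≤ (2 + 2 * T ^ 2) * B := by positivity
    linarith
  -- A common constant for the space and time derivatives: it is the sum of `2 (D + 1) T` and `2 + 2
  -- T²`.
  have hwt : ∫ z in spaceTimeDomain T xL xR, timeDeriv (fun z => χ z.2 • φ z) z ⬝ᵥ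
      timeDeriv (fun z => χ z.2 • φ z) z ≤ (2 * (D + 1) * T + (2 + 2 * T ^ 2)) * B := by
    have hwt' := (contDiff_timeDeriv hws).continuous
    have g1 : ∫ z in spaceTimeDomain T xL xR, timeDeriv (fun z => χ z.2 • φ z) z ⬝ᵥ
        timeDeriv (fun z => χ z.2 • φ z) z ≤
        ∫ z in spaceTimeDomain T xL xR, timeDeriv φ z ⬝ᵥ timeDeriv φ z :=
      integral_mono ((continuous_dotProduct' hwt' hwt').integrableOn_rect _ _ _ _)
        ((continuous_dotProduct' htc htc).integrableOn_rect _ _ _ _) fun z => by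
          simp only [timeDeriv_smul_snd χ hφs]
          simpa using smul_dotProduct_smul_self_le (hχ1 z.2) (timeDeriv φ z)
    have g4 : 0 ≤ 2 * (D + 1) * T * B := by positivity
    have := hφ.time_sq_le
    linarith
  have hv : ∀ t, ∫ y in Set.Ioo xL xR, ((1 - χ y) • φ (t, y)) ⬝ᵥ ((1 - χ y) • φ (t, y)) ≤
      T * B := fun t =>
    (integral_mono (hcs hvs.continuous t) (hcs hφc t) fun y => by
      simpa using smul_dotProduct_smul_self_le (hχ2 y) (φ (t, y))).trans (hφ.sq_le t)
  have b1 := h.errorFunctional_le_of_lateral hk hT hx hσ hcmp hws hL hR hwx hwt hμ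
  have b2 := h.errorFunctional_le_of_layer hT hx hσ hcmp hs hvs.continuous
    (fun z => by rw [chProj_smul, hφ.chProj_eq]) hA
    (fun i hi hiA t y hy => by simp only [hχA i hi hiA y hy, sub_self, zero_smul]) hb hC hv hμ
  rw [e]
  refine (add_le_add b1 b2).trans_eq ?_
  ring

end IsDiscretization

/-- The residual functional on dual solutions, for data supported away from the boundary. -/
theorem exists_errorFunctional_le (hT : 0 < T) (hx : xL < xR) {k : ℕ} (hk : 1 ≤ k) {σ κ : ℝ}
    (hσ : 0 < σ) (hκ : 0 < κ) {s : ℝ} (hs : s = 1 ∨ s = -1) {ε : ℝ} (hε : 0 < ε)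
    (hεx : xL + ε ≤ xR) :
    ∃ C, 0 < C ∧ ∀ (𝒯 : SpaceTimeMesh T xL xR), 𝒯.TimeStepsComparable σ →
      ∀ {b : ℝ × ℝ → Fin 4 → ℝ} {W₀ : ℝ → Fin 3 → ℝ} {Wh : ℕ → ℝ × ℝ → Fin 3 → ℝ}
        {p : ℕ → ℕ → ℝ × ℝ → Fin 3 → ℝ}, 𝒯.IsDiscretization k (κ * 𝒯.h) b W₀ Wh p →
      (∀ᵐ z ∂(volume.restrict (spaceTimeDomain T xL xR)),
        z.2 ∉ Set.Icc (xL + ε) (xR - ε) → b z = 0) →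
      (∀ᵐ y ∂(volume.restrict (Set.Ioo xL xR)), y ∉ Set.Icc (xL + ε) (xR - ε) → W₀ y = 0) →
      ∀ {B : ℝ} {ψ φ : ℝ × ℝ → Fin 3 → ℝ}, 0 ≤ B → IsDualField T xL xR s B ψ φ →
      ∀ {μ : ℝ}, 0 < μ → 𝒯.errorFunctional b W₀ Wh p φ ≤
        μ / 2 * (C * (𝒯.h * ∑ i ∈ Finset.range 𝒯.N, 𝒯.residualEnergy b W₀ Wh p i)) +
          μ⁻¹ / 2 * (C * B) := by
  obtain ⟨Ci, hCi, hinv⟩ := exists_time_inverse_inequality k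
  -- The cut-off vanishes at the end from which the characteristics of speed `s` start. It depends
  -- on the domain, `ε` and `s` only, and so does the bound for its derivative.
  obtain ⟨χ, hχ, hχ01, hχa, hχ1, D, hD0, hD⟩ := exists_cutoff s
    (if s = 1 then xL else xR) (show 0 < ε / 4 by positivity) xL xR
  set C₁ := 1 + (8 * decayConst σ κ Ci / ε) ^ 2 with hC₁
  set C₂ := (8 + (32 + 4 * κ ^ 2) * T + 4 * T / σ) *
          (2 * (D + 1) * T + (2 + 2 * T ^ 2)) + (2 * T + T / σ) * T with hC₂
  set C₃ := (2 * T + T / σ) / (ε / 8) ^ 2 * T with hC₃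
  have h1 : 0 < C₁ := by positivity
  have h2 : 0 < C₂ := by positivity
  have h3 : 0 < C₃ := by positivity
  refine ⟨C₁ + C₂ + C₃, by positivity, fun 𝒯 hcmp b W₀ Wh p h hb hW₀ B ψ φ hB hφ μ hμ => ?_⟩
  have hH := 𝒯.h_pos hT hx
  have hE : 0 ≤ 𝒯.h * ∑ i ∈ Finset.range 𝒯.N, 𝒯.residualEnergy b W₀ Wh p i :=
    mul_nonneg hH.le (Finset.sum_nonneg fun i _ => 𝒯.residualEnergy_nonneg hT hx _ _ _ _ _)
  have hmono : ∀ {a c : ℝ}, a ≤ C₁ + C₂ + C₃ → c ≤ C₁ + C₂ + C₃ →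
      μ / 2 * (a * (𝒯.h * ∑ i ∈ Finset.range 𝒯.N, 𝒯.residualEnergy b W₀ Wh p i)) +
        μ⁻¹ / 2 * (c * B) ≤ μ / 2 * ((C₁ + C₂ + C₃) *
          (𝒯.h * ∑ i ∈ Finset.range 𝒯.N, 𝒯.residualEnergy b W₀ Wh p i)) +
        μ⁻¹ / 2 * ((C₁ + C₂ + C₃) * B) := fun ha hc =>
    add_le_add (mul_le_mul_of_nonneg_left (mul_le_mul_of_nonneg_right ha hE) (by positivity))
      (mul_le_mul_of_nonneg_left (mul_le_mul_of_nonneg_right hc hB) (by positivity))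
  have h4 : (1 : ℝ) ≤ C₁ := by rw [hC₁]; linarith [sq_nonneg (8 * decayConst σ κ Ci / ε)]
  -- If the mesh is too coarse to fit two strips in the layer, `h` is bounded below and the crude
  -- bound suffices.
  rcases le_or_gt (ε / 8) 𝒯.h with hh | hh
  · refine (h.errorFunctional_le_of_coarse hT hx hσ hcmp hφ.contDiff.continuous hφ.sq_le
      (show 0 < ε / 8 by positivity) hh hμ).trans (le_of_eq_of_le ?_
        (hmono (a := 1) (c := C₃) (by linarith) (by linarith)))
    rw [hC₃]; ring
  · refine le_trans ?_ (hmono (a := C₁) (c := C₂) (by linarith) (by linarith))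
    rcases hs with rfl | rfl
    · rw [if_pos rfl] at hχa hχ1
      obtain ⟨A, hA, hAx, hbA, hCA⟩ := h.exists_left_layer hk hT hx hσ hκ hcmp hCi hinv hε hεx hb
        hW₀ hh
      refine h.errorFunctional_le_of_cutoff hk hT hx hσ hcmp (Or.inl rfl) hB hφ hχ hχ01 hD0 hD
        (fun t => by rw [hχa, zero_smul])
        (fun t => by rw [hφ.outflow_right rfl _ le_rfl, smul_zero]) hA
        (fun i hi hiA y hy => hχ1 y ?_) hbA hCA hμ
      have := hAx i hi hiA
      linarith [hy.1]
    · rw [if_neg (by norm_num)] at hχa hχ1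
      obtain ⟨A, hA, hAx, hbA, hCA⟩ := h.exists_right_layer hk hT hx hσ hκ hcmp hCi hinv hε hεx hb
        hW₀ hh
      refine h.errorFunctional_le_of_cutoff hk hT hx hσ hcmp (Or.inr rfl) hB hφ hχ hχ01 hD0 hD
        (fun t => by rw [hφ.outflow_left rfl _ le_rfl, smul_zero])
        (fun t => by rw [hχa, zero_smul]) hA
        (fun i hi hiA y hy => hχ1 y ?_) hbA hCA hμ
      have := hAx i hi hiA
      linarith [hy.2]

end SpaceTimeMesh

/-! ### From the energy bounds to the norms of the statement. -/

/-- Optimisation of Young's inequality. -/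
theorem le_two_mul_sqrt_mul_sqrt {x a c : ℝ} (ha : 0 ≤ a) (hc : 0 ≤ c)
    (h : ∀ μ > 0, x ≤ μ * a + μ⁻¹ * c) : x ≤ 2 * (Real.sqrt a * Real.sqrt c) := by
  -- The optimal `μ = √(c / a)` is available only for positive `a` and `c`; both are shifted by `η`,
  -- which then tends to zero.
  have key : ∀ η > 0, x ≤ 2 * (Real.sqrt (a + η) * Real.sqrt (c + η)) := by
    intro η hη
    have h1 : 0 < Real.sqrt (a + η) := Real.sqrt_pos.2 (by linarith)
    have h2 : 0 < Real.sqrt (c + η) := Real.sqrt_pos.2 (by linarith)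
    have e1 := Real.mul_self_sqrt (show 0 ≤ a + η by linarith)
    have e2 := Real.mul_self_sqrt (show 0 ≤ c + η by linarith)
    have hμ : 0 < Real.sqrt (c + η) / Real.sqrt (a + η) := by positivity
    refine (h _ hμ).trans ((add_le_add (mul_le_mul_of_nonneg_left
      (show a ≤ a + η by linarith) hμ.le) (mul_le_mul_of_nonneg_left
      (show c ≤ c + η by linarith) (inv_nonneg.2 hμ.le))).trans_eq ?_)
    have e3 : ∀ {p q : ℝ}, 0 < p → 0 < q → q / p * (p * p) + p / q * (q * q) = 2 * (p * q) := by
      intro p q hp hq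
      field_simp
      ring
    rw [inv_div, ← e3 h1 h2, e1, e2]
  have hlim : Filter.Tendsto (fun η : ℝ => 2 * (Real.sqrt (a + η) * Real.sqrt (c + η)))
      (nhdsWithin 0 (Set.Ioi 0)) (nhds (2 * (Real.sqrt a * Real.sqrt c))) := by
    have : Continuous fun η : ℝ => 2 * (Real.sqrt (a + η) * Real.sqrt (c + η)) := by fun_prop
    refine (this.tendsto' 0 _ (by simp)).mono_left nhdsWithin_le_nhds
  exact ge_of_tendsto hlim (by filter_upwards [self_mem_nhdsWithin] with η hη using key η hη)

theorem ofReal_sqrt_le_l2Norm {n : ℕ} (D : Set (ℝ × ℝ)) (u : ℝ × ℝ → Fin n → ℝ) :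
    ENNReal.ofReal (Real.sqrt (∫ z in D, u z ⬝ᵥ u z)) ≤ l2Norm D u := by
  have h1 : ENNReal.ofReal (∫ z in D, u z ⬝ᵥ u z) ≤
      ∫⁻ z in D, ‖WithLp.toLp 2 (u z)‖ₑ ^ (2 : ℝ) := by
    have e : ∀ z, ‖WithLp.toLp 2 (u z)‖ₑ ^ (2 : ℝ) = ENNReal.ofReal (u z ⬝ᵥ u z) := by
      intro z
      rw [← ofReal_norm, ENNReal.ofReal_rpow_of_nonneg (norm_nonneg _) (by norm_num)]
      congr 1
      rw [Real.rpow_two, EuclideanSpace.real_norm_sq_eq]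
      simp [dotProduct, sq]
    simp only [e]
    -- Without integrability the left side is the integral's default value `0`, so the inequality
    -- needs no hypothesis.
    by_cases hi : Integrable (fun z => u z ⬝ᵥ u z) (volume.restrict D)
    · rw [ofReal_integral_eq_lintegral_ofReal hi
        (Filter.Eventually.of_forall fun z => dotProduct_self_nonneg' _)]
    · rw [integral_undef hi, ENNReal.ofReal_zero]
      exact zero_le
  rw [l2Norm, eLpNorm_eq_lintegral_rpow_enorm_toReal (by norm_num) (by norm_num),
    ENNReal.toReal_ofNat, Real.sqrt_eq_rpow,
    ← ENNReal.ofReal_rpow_of_nonneg (integral_dotProduct_self_nonneg _) (by norm_num)]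
  exact ENNReal.rpow_le_rpow h1 (by norm_num)

namespace SpaceTimeMesh

variable {T xL xR : ℝ} {𝒯 : SpaceTimeMesh T xL xR}

namespace IsDiscretization

variable {k : ℕ} {κ σ δ : ℝ} {b : ℝ × ℝ → Fin 4 → ℝ} {W₀ : ℝ → Fin 3 → ℝ}
  {Wh : ℕ → ℝ × ℝ → Fin 3 → ℝ} {p : ℕ → ℕ → ℝ × ℝ → Fin 3 → ℝ}

theorem integral_residual₁ (h : 𝒯.IsDiscretization k δ b W₀ Wh p) :
    ∫ z in spaceTimeDomain T xL xR, (𝒯.h • 𝒯.residual₁ b Wh) z ⬝ᵥ (𝒯.h • 𝒯.residual₁ b Wh) z =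
      ∑ m ∈ Finset.range 𝒯.M, ∑ i ∈ Finset.range 𝒯.N, 𝒯.h ^ 2 *
        ∫ z in 𝒯.elem m i, (b z - maxwellOp (p m i) z) ⬝ᵥ (b z - maxwellOp (p m i) z) := by
  have hE : ∀ m < 𝒯.M, ∀ i < 𝒯.N, Set.EqOn
      (fun z => 𝒯.h ^ 2 * ((b z - maxwellOp (p m i) z) ⬝ᵥ (b z - maxwellOp (p m i) z)))
      (fun z => (𝒯.h • 𝒯.residual₁ b Wh) z ⬝ᵥ (𝒯.h • 𝒯.residual₁ b Wh) z) (𝒯.elem m i) := by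
    intro m hm i hi z hz
    simp only [Pi.smul_apply, residual₁]
    rw [𝒯.glue_eq _ hm (𝒯.elem_subset_slab hi hz), h.pieces.maxwellOp_eq hm hi hz,
      smul_dotProduct, dotProduct_smul, smul_eq_mul, smul_eq_mul, ← mul_assoc, ← sq]
  have hI := fun m hm i hi => (MemLp.integrable_dotProduct (h.memLp_residual (m := m) (i := i)
    hm hi) (h.memLp_residual hm hi)).const_mul (𝒯.h ^ 2)
  rw [← 𝒯.sum_elem_eq_domain fun m hm i hi =>
    IntegrableOn.congr_fun (hI m hm i hi) (hE m hm i hi) (𝒯.measurableSet_elem m i)]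
  refine Finset.sum_congr rfl fun m hm => Finset.sum_congr rfl fun i hi => ?_
  rw [← setIntegral_congr_fun (𝒯.measurableSet_elem m i)
    (hE m (Finset.mem_range.1 hm) i (Finset.mem_range.1 hi)), integral_const_mul]

/-- The jump residual is constant in time on each slab, so integrating in time yields the factor `dt
m`. -/
theorem integral_residual₂ (h : 𝒯.IsDiscretization k δ b W₀ Wh p) (hh : 𝒯.h ≠ 0) :
    ∫ z in spaceTimeDomain T xL xR, (𝒯.h • 𝒯.residual₂ W₀ Wh) z ⬝ᵥ (𝒯.h • 𝒯.residual₂ W₀ Wh) z =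
      ∑ m ∈ Finset.range 𝒯.M, ∑ i ∈ Finset.range 𝒯.N, 𝒯.dt m *
        ∫ y in 𝒯.cell i, 𝒯.jump W₀ Wh m y ⬝ᵥ 𝒯.jump W₀ Wh m y := by
  have hE : ∀ m < 𝒯.M, ∀ i < 𝒯.N, Set.EqOn
      (fun z => 𝒯.jump W₀ Wh m z.2 ⬝ᵥ 𝒯.jump W₀ Wh m z.2)
      (fun z => (𝒯.h • 𝒯.residual₂ W₀ Wh) z ⬝ᵥ (𝒯.h • 𝒯.residual₂ W₀ Wh) z) (𝒯.elem m i) := by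
    intro m hm i hi z hz
    simp only [Pi.smul_apply, residual₂]
    rw [𝒯.glue_eq _ hm (𝒯.elem_subset_slab hi hz), smul_smul, mul_inv_cancel₀ hh, one_smul]
    rfl
  have hr : ∀ m i, (volume : Measure (ℝ × ℝ)).restrict (𝒯.elem m i) =
      (volume.restrict (Set.Ioo (𝒯.t m) (𝒯.t (m + 1)))).prod (volume.restrict (𝒯.cell i)) := by
    intro m i
    rw [Measure.prod_restrict, ← Measure.volume_eq_prod]
    rfl
  have hI : ∀ m < 𝒯.M, ∀ i < 𝒯.N, IntegrableOn
      (fun z : ℝ × ℝ => 𝒯.jump W₀ Wh m z.2 ⬝ᵥ 𝒯.jump W₀ Wh m z.2) (𝒯.elem m i) := by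
    intro m hm i hi
    rw [IntegrableOn, hr]
    exact (MemLp.integrable_dotProduct (h.memLp_jump hm hi) (h.memLp_jump hm hi)).comp_snd _
  rw [← 𝒯.sum_elem_eq_domain fun m hm i hi =>
    IntegrableOn.congr_fun (hI m hm i hi) (hE m hm i hi) (𝒯.measurableSet_elem m i)]
  refine Finset.sum_congr rfl fun m hm => Finset.sum_congr rfl fun i hi => ?_
  have hm := Finset.mem_range.1 hm
  rw [← setIntegral_congr_fun (𝒯.measurableSet_elem m i) (hE m hm i (Finset.mem_range.1 hi)), hr,
    integral_fun_snd (fun y => 𝒯.jump W₀ Wh m y ⬝ᵥ 𝒯.jump W₀ Wh m y)]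
  simp [Real.volume_real_Ioo_of_le (𝒯.t_lt m hm).le, dt]

/-- The residuals are controlled by the norms in the error estimate. -/
theorem ofReal_sqrt_residualEnergy_le (h : 𝒯.IsDiscretization k δ b W₀ Wh p) (hT : 0 < T)
    (hx : xL < xR) (hσ : 0 < σ) (hcmp : 𝒯.TimeStepsComparable σ) :
    ENNReal.ofReal (Real.sqrt (𝒯.h * ∑ i ∈ Finset.range 𝒯.N, 𝒯.residualEnergy b W₀ Wh p i)) ≤
      ENNReal.ofReal (Real.sqrt (1 + σ⁻¹)) *
        (l2Norm (spaceTimeDomain T xL xR) (𝒯.h • 𝒯.residual₁ b Wh) +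
          l2Norm (spaceTimeDomain T xL xR) (𝒯.h • 𝒯.residual₂ W₀ Wh)) := by
  have hH := 𝒯.h_pos hT hx
  set I₁ := ∫ z in spaceTimeDomain T xL xR,
    (𝒯.h • 𝒯.residual₁ b Wh) z ⬝ᵥ (𝒯.h • 𝒯.residual₁ b Wh) z with hI₁
  set I₂ := ∫ z in spaceTimeDomain T xL xR,
    (𝒯.h • 𝒯.residual₂ W₀ Wh) z ⬝ᵥ (𝒯.h • 𝒯.residual₂ W₀ Wh) z with hI₂
  have n1 : 0 ≤ I₁ := integral_dotProduct_self_nonneg _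
  have n2 : 0 ≤ I₂ := integral_dotProduct_self_nonneg _
  have hle : 𝒯.h * ∑ i ∈ Finset.range 𝒯.N, 𝒯.residualEnergy b W₀ Wh p i ≤ I₁ + σ⁻¹ * I₂ := by
    rw [hI₁, hI₂, h.integral_residual₁, h.integral_residual₂ hH.ne']
    simp only [residualEnergy]
    rw [Finset.sum_comm (s := Finset.range 𝒯.N)]
    simp only [Finset.mul_sum, ← Finset.sum_add_distrib]
    refine Finset.sum_le_sum fun m hm => Finset.sum_le_sum fun i _ => ?_
    -- The energy weighs the jumps with `h`, the norm with the length of the time step; the lower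
    -- bound on the time steps reconciles them.
    have h1 : 𝒯.h ≤ σ⁻¹ * 𝒯.dt m := by
      rw [le_inv_mul_iff₀ hσ]
      exact hcmp m (Finset.mem_range.1 hm)
    have h2 := mul_le_mul_of_nonneg_right h1 (integral_dotProduct_self_nonneg
      (μ := volume.restrict (𝒯.cell i)) (𝒯.jump W₀ Wh m))
    linarith
  have hsq : Real.sqrt (𝒯.h * ∑ i ∈ Finset.range 𝒯.N, 𝒯.residualEnergy b W₀ Wh p i) ≤
      Real.sqrt (1 + σ⁻¹) * (Real.sqrt I₁ + Real.sqrt I₂) := by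
    have hσ' : 0 ≤ σ⁻¹ := inv_nonneg.2 hσ.le
    refine Real.sqrt_le_iff.2 ⟨by positivity, hle.trans ?_⟩
    rw [mul_pow, Real.sq_sqrt (by positivity), add_sq, Real.sq_sqrt n1, Real.sq_sqrt n2]
    have : 0 ≤ 2 * Real.sqrt I₁ * Real.sqrt I₂ := by positivity
    nlinarith [mul_nonneg hσ' n1, mul_nonneg hσ' n2, mul_nonneg hσ' this]
  refine (ENNReal.ofReal_le_ofReal hsq).trans ?_
  rw [ENNReal.ofReal_mul (Real.sqrt_nonneg _), ENNReal.ofReal_add (Real.sqrt_nonneg _)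
    (Real.sqrt_nonneg _)]
  exact mul_le_mul_right (add_le_add (ofReal_sqrt_le_l2Norm _ _) (ofReal_sqrt_le_l2Norm _ _)) _

end IsDiscretization

end SpaceTimeMesh
-- The error estimate.
theorem mainTheorem1 (T xL xR : ℝ) (hT : 0 < T) (hx : xL < xR)
    (k : ℕ) (hk : 1 ≤ k) (σ κ : ℝ) (hσ : 0 < σ) (hκ : 0 < κ)
    (K : Set ℝ) (hK : IsCompact K) (hKΩ : K ⊆ Set.Ioo xL xR) :
    ∃ C : ℝ≥0, ∀ 𝒯 : SpaceTimeMesh T xL xR, 𝒯.TimeStepsComparable σ →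
      ∀ (b : ℝ × ℝ → Fin 4 → ℝ) (W₀ : ℝ → Fin 3 → ℝ)
        (W : ℝ × ℝ → Fin 3 → ℝ) (Wh : ℕ → ℝ × ℝ → Fin 3 → ℝ),
        MemLp b 2 (volume.restrict (spaceTimeDomain T xL xR)) →
        MemLp W₀ 2 (volume.restrict (Set.Ioo xL xR)) →
        IsWeakMaxwellSolution T xL xR b W₀ W →
        (∀ᵐ z ∂(volume.restrict (spaceTimeDomain T xL xR)), z.2 ∉ K → W z = 0) →
        𝒯.IsStreamlineDiffusionSolution k (κ * 𝒯.h) b W₀ Wh →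
        hNegOneNorm (spaceTimeDomain T xL xR) (fun z => W z - 𝒯.glue Wh z) ≤
          C * (l2Norm (spaceTimeDomain T xL xR) (𝒯.h • 𝒯.residual₁ b Wh) +
            l2Norm (spaceTimeDomain T xL xR) (𝒯.h • 𝒯.residual₂ W₀ Wh)) := by
  obtain ⟨ε₀, hε₀, hKε₀⟩ := hK.exists_subset_Icc_of_subset_Ioo hKΩ
  -- The minimum keeps `xL + ε ≤ xR` when `K` is empty, in which case `ε₀` is unrelated to the
  -- interval.
  set ε := min ε₀ (xR - xL) with hεdef
  have hε : 0 < ε := lt_min hε₀ (sub_pos.2 hx)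
  have hεx : xL + ε ≤ xR := by linarith [min_le_right ε₀ (xR - xL)]
  have hKε : K ⊆ Set.Icc (xL + ε) (xR - ε) := hKε₀.trans
    (Set.Icc_subset_Icc (by linarith [min_le_left ε₀ (xR - xL)])
      (by linarith [min_le_left ε₀ (xR - xL)]))
  obtain ⟨C₁, hC₁, h₁⟩ := SpaceTimeMesh.exists_errorFunctional_le hT hx hk hσ hκ
    (Or.inl rfl : (1 : ℝ) = 1 ∨ (1 : ℝ) = -1) hε hεx
  obtain ⟨C₂, hC₂, h₂⟩ := SpaceTimeMesh.exists_errorFunctional_le hT hx hk hσ hκ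
    (Or.inr rfl : (-1 : ℝ) = 1 ∨ (-1 : ℝ) = -1) hε hεx
  refine ⟨((C₁ + C₂) * Real.sqrt (1 + σ⁻¹)).toNNReal,
    fun 𝒯 hcmp b W₀ W Wh hb hW₀ hW hWK hWh => ?_⟩
  obtain ⟨p, hp⟩ := SpaceTimeMesh.IsFiniteElement.exists_pieces 𝒯 hWh.1
  have h : 𝒯.IsDiscretization k (κ * 𝒯.h) b W₀ Wh p := ⟨hb, hW₀, hWh, hp⟩
  have hbK : ∀ᵐ z ∂(volume.restrict (spaceTimeDomain T xL xR)),
      z.2 ∉ Set.Icc (xL + ε) (xR - ε) → b z = 0 := by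
    filter_upwards [hW.source_ae_eq_zero hK hb hWK] with z hz hzK
    exact hz fun hz' => hzK (hKε hz')
  have hWK₀ : ∀ᵐ y ∂(volume.restrict (Set.Ioo xL xR)),
      y ∉ Set.Icc (xL + ε) (xR - ε) → W₀ y = 0 := by
    filter_upwards [hW.init_ae_eq_zero hT hK hb hW₀ hWK] with y hy hyK
    exact hy fun hy' => hyK (hKε hy')
  set E := 𝒯.h * ∑ i ∈ Finset.range 𝒯.N, 𝒯.residualEnergy b W₀ Wh p i with hE
  have hE0 : 0 ≤ E := mul_nonneg (𝒯.h_pos hT hx).le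
    (Finset.sum_nonneg fun i _ => 𝒯.residualEnergy_nonneg hT hx _ _ _ _ _)
  have hbound : hNegOneNorm (spaceTimeDomain T xL xR) (fun z => W z - 𝒯.glue Wh z) ≤
      ENNReal.ofReal ((C₁ + C₂) * Real.sqrt E) := by
    refine iSup₂_le fun ψ hψ => ENNReal.ofReal_le_ofReal ?_
    -- A zero denominator does no harm, since the quotient is then `0`.
    refine div_le_of_le_mul₀ (Real.sqrt_nonneg _) (by positivity) ?_
    obtain ⟨v₁, hv₁⟩ := exists_isDualField hT (Or.inl rfl : (1 : ℝ) = 1 ∨ (1 : ℝ) = -1)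
      hψ.1 hψ.2.1 hψ.2.2
    obtain ⟨v₂, hv₂⟩ := exists_isDualField hT (Or.inr rfl : (-1 : ℝ) = 1 ∨ (-1 : ℝ) = -1)
      hψ.1 hψ.2.1 hψ.2.2
    rw [h.error_eq hT hK hKΩ hW hWK hv₁ hv₂]
    set B := h1Sq (spaceTimeDomain T xL xR) ψ with hB
    have hB0 : 0 ≤ B := h1Sq_nonneg _ _
    -- Both speeds are added before `μ` is optimised. The factor `√B` that comes out is the `H¹`
    -- norm of `ψ`.
    refine (le_two_mul_sqrt_mul_sqrt (a := (C₁ + C₂) / 2 * E) (c := (C₁ + C₂) / 2 * B)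
      (by positivity) (by positivity) fun μ hμ => ?_).trans_eq ?_
    · have f₁ := h₁ 𝒯 hcmp h hbK hWK₀ hB0 hv₁ hμ
      have f₂ := h₂ 𝒯 hcmp h hbK hWK₀ hB0 hv₂ hμ
      refine (add_le_add f₁ f₂).trans_eq ?_
      ring
    · change _ = (C₁ + C₂) * Real.sqrt E * Real.sqrt B
      have hC : 0 ≤ (C₁ + C₂) / 2 := by positivity
      rw [Real.sqrt_mul hC E, Real.sqrt_mul hC B]
      have := Real.mul_self_sqrt hC
      linear_combination 2 * Real.sqrt E * Real.sqrt B * this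
  refine hbound.trans ?_
  rw [ENNReal.ofReal_mul (by positivity)]
  refine (mul_le_mul_right (h.ofReal_sqrt_residualEnergy_le hT hx hσ hcmp) _).trans_eq ?_
  rw [← mul_assoc, ← ENNReal.ofReal_mul (by positivity)]
  rfl
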